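/- **Definitions.** A closed path of length $\nu$ on the square lattice $\mathbb Z^2$ is a cyclic sequence $(P_i)_{i\in\mathbb Z/\nu}$ of lattice points such that $P_i,P_{i+1}$ are nearest neighbours and $P_{i+1}\neq P_{i-1}$ (no U-turns). A *distorted disk* is an oriented surface obtained by gluing finitely many unit squares along their sides, drawn isometrically on the square lattice (each square sits on a lattice tile, overlaps being allowed), which is topologically a disk (connected, $V-E+F=1$), all of whose bulk vertices have degree four and all of whose boundary vertices have degree two, three or four; two such drawn surfaces are identified if they differ by a relabelling of the squares. A *self-overlapping polygon* (SOP) is a closed path $\gamma$ that is the boundary of a distorted disk located on its left. Its boundary length is its number of edges, its area is the number of squares of a distorted disk bounded by $\gamma$, and its multiplicity $\mu_\gamma$ is the number of distorted disks bounded by $\gamma$. SOPs are counted modulo lattice translations (rotated and reflected configurations are counted as distinct): $\mathcal W_{2n,p,\mu}$, $\hat W_{2n,p}$ and $\hat w_{2n}$ are the numbers of elements of the sets $\mathrm{SOP}_{2n,p,\mu}$, $\mathrm{SOP}_{2n,p}$ and $\mathrm{SOP}_{2n}$ of SOPs of boundary length $2n$, area $p$ and multiplicity $\mu$, of boundary length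 $2n$ and area $p$, and of boundary length $2n$, respectively, each SOP being counted once. An upper (lower) edge of $\gamma$ is a horizontal edge of $\gamma$ at the maximal (minimal) height reached by $\gamma$. Given SOPs $\gamma_1,\gamma_2$, an upper edge $e_{\rm u}$ of $\gamma_1$ and a lower edge $e_{\rm l}$ of $\gamma_2$, the gluing $\gamma_1\sqcup\gamma_2=\gamma_1(e_{\rm u})\sqcup\gamma_2(e_{\rm l})$ is obtained by translating $\gamma_2$ so that $e_{\rm l}$ lies one lattice unit above $e_{\rm u}$ and by replacing $e_{\rm u}$ and $e_{\rm l}$ by the two vertical sides of the tile located between them. **Proposition.** The multiplicity of any closed path and all the sets $\mathrm{SOP}_{2n}$ are finite, the area of a SOP is well defined, and any SOP has at least one upper edge and one lower edge. For all SOPs $\gamma_1,\gamma_2$ and any upper edge of $\gamma_1$ and lower edge of $\gamma_2$, $\gamma_1\sqcup\gamma_2$ is a SOP whose boundary length is the sum of the boundary lengths of $\gamma_1$ and $\gamma_2$, whose area is the sum of the areas of $\gamma_1$ and $\gamma_2$ plus one, and whose multiplicity is $\mu_{\gamma_1}\mu_{\gamma_2}$. Gluing maps $(\gamma_1,\gamma_2)\mapsto\gamma_1\sqcup\gamma_2$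 on SOPs modulo translations, obtained by choosing an upper edge of $\gamma_1$ and a lower edge of $\gamma_2$ for each pair $(\gamma_1,\gamma_2)$, exist, and, for any such choice and all $n_i,p_i,\mu_i$, the gluing defines injective maps $$\mathrm{SOP}_{2n_1,p_1,\mu_1}\times\mathrm{SOP}_{2n_2,p_2,\mu_2}\to\mathrm{SOP}_{2(n_1+n_2),p_1+p_2+1,\mu_1\mu_2},$$ $$\mathrm{SOP}_{2n_1,p_1}\times\mathrm{SOP}_{2n_2,p_2}\to\mathrm{SOP}_{2(n_1+n_2),p_1+p_2+1},\qquad \mathrm{SOP}_{2n_1}\times\mathrm{SOP}_{2n_2}\to\mathrm{SOP}_{2(n_1+n_2)}.$$ Consequently, $$\mathcal W_{2(n_1+n_2),p_1+p_2+1,\mu_1\mu_2}\ge\mathcal W_{2n_1,p_1,\mu_1}\mathcal W_{2n_2,p_2,\mu_2},$$ $$\hat W_{2(n_1+n_2),p_1+p_2+1}\ge\hat W_{2n_1,p_1}\hat W_{2n_2,p_2},\qquad \hat w_{2(n_1+n_2)}\ge\hat w_{2n_1}\hat w_{2n_2}.$$ -/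

import Mathlib

/-! # Self-overlapping polygons on the square lattice

Closed lattice paths, discretized flat disks drawn isometrically on the square lattice,
self-overlapping polygons (SOP), their length, area and multiplicity, and the gluing of two SOP
along an upper edge of the first one and a lower edge of the second one. -/

namespace SOPoly

/-- Points of the square lattice. -/
abbrev Pt : Type := ℤ × ℤ

/-- Nearest neighbours on the square lattice. -/
def Adj (P Q : Pt) : Prop := (Q.1 - P.1).natAbs + (Q.2 - P.2).natAbs = 1

/-- A closed path (polygon) on the square lattice: a cyclic sequence of lattice points in which
consecutive points are nearest neighbours, and without U-turns: any two cyclically consecutive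
points `P, Q` are followed by a point `R ≠ P`. -/
structure IsClosedPath (γ : Cycle Pt) : Prop where
  chain : γ.Chain Adj
  no_uturn : ∀ (P Q : Pt) (l : List Pt), ((P :: Q :: l : List Pt) : Cycle Pt) = γ →
    ∃ (R : Pt) (l' : List Pt), l = R :: l' ∧ R ≠ P

/-! ### Discretized surfaces made of squares, drawn isometrically on the lattice -/

/-- The sides of `p` squares. The sides of a square are numbered anticlockwise: bottom, right, top,
left. The pair `(f, k)` also denotes the corner of the square `f` where the side `k` starts. -/
abbrev Side (p : ℕ) : Type := Fin p × Fin 4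

/-- The next side of the same square, anticlockwise. As a corner, this is the endpoint of `s`. -/
def Side.next {p : ℕ} (s : Side p) : Side p := (s.1, s.2 + 1)

/-- Position of the four corners of a tile, with respect to the lower left one. -/
def cornerOffset : Fin 4 → Pt := ![(0, 0), (1, 0), (1, 1), (0, 1)]

/-- `p` squares glued along their sides and drawn isometrically on the square lattice. The square
`f` is put on the tile with lower left corner `tile f`. The involution `glue` pairs the sides that
are glued together; its fixed points are the sides that are left free, i.e. the boundary edges.
Two sides that are glued together sit on the same lattice edge, with opposite orientations. -/
structure SquareSurface (p : ℕ) where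
  tile : Fin p → Pt
  glue : Side p → Side p
  glue_glue : ∀ s, glue (glue s) = s
  isometric : ∀ s, glue s ≠ s →
    tile (glue s).1 + cornerOffset (glue s).2 = tile s.1 + cornerOffset s.next.2 ∧
    tile (glue s).1 + cornerOffset (glue s).next.2 = tile s.1 + cornerOffset s.2

namespace SquareSurface

variable {p : ℕ} (D : SquareSurface p)

/-- The lattice point at which a side, oriented anticlockwise, starts. -/
def start (s : Side p) : Pt := D.tile s.1 + cornerOffset s.2

/-- The corners identified by the gluing: when the side `s` is glued to another side, its starting
point is identified with the endpoint of that side. -/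
def CornerRel (c d : Side p) : Prop := D.glue c ≠ c ∧ d = (D.glue c).next

/-- The vertices of the surface: corners of squares, modulo the identifications implied by the
gluing of the sides. -/
def Vertex : Type := Quot D.CornerRel

/-- The vertex at a given corner. -/
def vertex (c : Side p) : D.Vertex := Quot.mk _ c

/-- The edges of the surface: sides of squares, two sides glued together forming one edge. -/
def Edge : Type := Quot (fun s t : Side p => t = D.glue s)

/-- A vertex belongs to the boundary when a boundary edge starts there. -/
def IsBoundaryVertex (v : D.Vertex) : Prop := ∃ s : Side p, D.glue s = s ∧ D.vertex s = v

/-- Number of corners of squares that meet at a vertex. -/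
noncomputable def corners (v : D.Vertex) : ℕ := Nat.card {c : Side p // D.vertex c = v}

/-- A discretized flat disk (distorted disk): the surface is connected, of Euler characteristic
`V - E + F = 1`; the bulk vertices have degree four (no curvature); the boundary vertices have
degree two, three or four. At a bulk vertex, the degree (number of incident edges) is the number of
corners meeting there; at a boundary vertex, it is this number plus one. -/
structure IsDisk : Prop where
  pos : 0 < p
  connected : ∀ f g : Fin p,
    Relation.ReflTransGen (fun a b => ∃ k : Fin 4, (D.glue (a, k)).1 = b) f g
  euler : (Nat.card D.Vertex : ℤ) - Nat.card D.Edge + p = 1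
  bulk_degree : ∀ v, ¬ D.IsBoundaryVertex v → D.corners v = 4
  boundary_degree : ∀ v, D.IsBoundaryVertex v → D.corners v + 1 ∈ ({2, 3, 4} : Set ℕ)

/-- The boundary of the surface is the closed path `γ`, with the surface on the left: the boundary
edges can be arranged in a cyclic sequence `β` without repetition, each one ending at the vertex of
the surface where the next one starts, and their starting points form the cyclic sequence `γ`. -/
def Bounds (γ : Cycle Pt) : Prop :=
  ∃ β : Cycle (Side p), β.Nodup ∧ (∀ s, s ∈ β ↔ D.glue s = s) ∧
    β.Chain (fun s t => D.vertex s.next = D.vertex t) ∧ β.map D.start = γ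

end SquareSurface

/-! ### Self-overlapping polygons -/

/-- The distorted disks bounded by `γ`, with their squares numbered. -/
structure Filling (γ : Cycle Pt) where
  faces : ℕ
  disk : SquareSurface faces
  isDisk : disk.IsDisk
  bounds : disk.Bounds γ

/-- Two numbered disks are the same when they differ by a renumbering of the squares. -/
def Filling.Iso {γ : Cycle Pt} (A B : Filling γ) : Prop :=
  ∃ e : Fin A.faces ≃ Fin B.faces, (∀ f, B.disk.tile (e f) = A.disk.tile f) ∧
    ∀ s : Side A.faces, B.disk.glue (e s.1, s.2) = (e (A.disk.glue s).1, (A.disk.glue s).2)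

theorem Filling.iso_equivalence (γ : Cycle Pt) : Equivalence (Filling.Iso (γ := γ)) where
  refl A := ⟨Equiv.refl _, fun _ => rfl, fun _ => rfl⟩
  symm := by
    rintro A B ⟨e, h₁, h₂⟩
    refine ⟨e.symm, fun f => ?_, fun s => ?_⟩
    · rw [← h₁, e.apply_symm_apply]
    · have h := h₂ (e.symm s.1, s.2)
      simp only [e.apply_symm_apply] at h
      rw [show B.disk.glue s = _ from h]
      simp
  trans := by
    rintro A B C ⟨e, h₁, h₂⟩ ⟨e', h₁', h₂'⟩
    refine ⟨e.trans e', fun f => ?_, fun s => ?_⟩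
    · simp [h₁', h₁]
    · have h := h₂' (e s.1, s.2)
      rw [h₂ s] at h
      exact h

/-- The distorted disks bounded by `γ`. -/
def DistortedDisk (γ : Cycle Pt) : Type :=
  Quotient (⟨Filling.Iso, Filling.iso_equivalence γ⟩ : Setoid (Filling γ))

/-- The multiplicity `μ_γ`: the number of distorted disks bounded by `γ`. -/
noncomputable def multiplicity (γ : Cycle Pt) : ℕ := Nat.card (DistortedDisk γ)

/-- A self-overlapping polygon, with its canonical anticlockwise orientation: a closed path that
bounds a distorted disk located on its left. -/
def IsSOP (γ : Cycle Pt) : Prop := IsClosedPath γ ∧ Nonempty (Filling γ)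

/-- `γ` has area `p`: it bounds a distorted disk that has `p` faces. -/
def HasArea (γ : Cycle Pt) (p : ℕ) : Prop := ∃ A : Filling γ, A.faces = p

/-! ### Counting, modulo lattice translations -/

/-- Two closed paths are identified when they differ by a lattice translation. -/
def Translate (γ γ' : Cycle Pt) : Prop := ∃ v : Pt, γ' = γ.map (· + v)

theorem map_map_add (γ : Cycle Pt) (v w : Pt) :
    (γ.map (· + v)).map (· + w) = γ.map (· + (v + w)) := by
  induction γ using Quotient.inductionOn' with
  | h l =>
    change ((List.map _ (List.map _ l) : List Pt) : Cycle Pt) = ((List.map _ l : List Pt) : Cycle Pt)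
    simp [Function.comp_def, add_assoc]

theorem map_add_zero (γ : Cycle Pt) : γ.map (· + (0 : Pt)) = γ := by
  induction γ using Quotient.inductionOn' with
  | h l =>
    change ((List.map _ l : List Pt) : Cycle Pt) = (l : Cycle Pt)
    simp

theorem translate_equivalence : Equivalence Translate where
  refl γ := ⟨0, (map_add_zero γ).symm⟩
  symm := by
    rintro γ _ ⟨v, rfl⟩
    exact ⟨-v, by rw [map_map_add, add_neg_cancel, map_add_zero]⟩
  trans := by
    rintro γ _ _ ⟨v, rfl⟩ ⟨w, rfl⟩
    exact ⟨v + w, by rw [map_map_add]⟩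

/-- Cyclic sequences of lattice points modulo lattice translations. Configurations that are related
by a rotation or a reflection are not identified. -/
def PathClass : Type := Quotient (⟨Translate, translate_equivalence⟩ : Setoid (Cycle Pt))

/-- The class of a cyclic sequence of lattice points modulo translations. -/
def toClass (γ : Cycle Pt) : PathClass := Quotient.mk _ γ

/-- `SOP_{2n}`: the SOP of boundary length `2n`, modulo translations. -/
def sopLength (n : ℕ) : Set PathClass :=
  toClass '' {γ | IsSOP γ ∧ γ.length = 2 * n}

/-- `SOP_{2n,p}`: the SOP of boundary length `2n` and area `p`, modulo translations. -/
def sopArea (n p : ℕ) : Set PathClass :=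
  toClass '' {γ | IsSOP γ ∧ γ.length = 2 * n ∧ HasArea γ p}

/-- `SOP_{2n,p,μ}`: the SOP of boundary length `2n`, area `p` and multiplicity `μ`, modulo
translations. -/
def sopMult (n p μ : ℕ) : Set PathClass :=
  toClass '' {γ | IsSOP γ ∧ γ.length = 2 * n ∧ HasArea γ p ∧ multiplicity γ = μ}

/-- The number of SOP of boundary length `2n`, area `p` and multiplicity `μ`. -/
noncomputable def calW (n p μ : ℕ) : ℕ := (sopMult n p μ).ncard

/-- The number of SOP of boundary length `2n` and area `p`, each counted once. -/
noncomputable def hatW (n p : ℕ) : ℕ := (sopArea n p).ncard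

/-- The number of SOP of boundary length `2n`, each counted once. -/
noncomputable def hatw (n : ℕ) : ℕ := (sopLength n).ncard

/-! ### Gluing -/

/-- An upper edge of `γ`: a horizontal edge located at the maximal height reached by `γ`. An edge of
`γ` is given by the list `root` of the successive points of `γ` in which this edge goes from the
last point to the first one. -/
structure UpperEdge (γ : Cycle Pt) where
  root : List Pt
  ne_nil : root ≠ []
  coe_root : (root : Cycle Pt) = γ
  horizontal : (root.getLast ne_nil).2 = (root.head ne_nil).2
  highest : ∀ P ∈ root, P.2 ≤ (root.head ne_nil).2

/-- A lower edge of `γ`: a horizontal edge located at the minimal height reached by `γ`. -/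
structure LowerEdge (γ : Cycle Pt) where
  root : List Pt
  ne_nil : root ≠ []
  coe_root : (root : Cycle Pt) = γ
  horizontal : (root.getLast ne_nil).2 = (root.head ne_nil).2
  lowest : ∀ P ∈ root, (root.head ne_nil).2 ≤ P.2

/-- The gluing `γ₁(u) ⊔ γ₂(l)`: the path `γ₂` is translated so that its lower edge `l` lies one
lattice unit above the upper edge `u` of `γ₁`; then `u` and `l` are removed and replaced by the two
vertical sides of the tile between them. That is, one follows `γ₁` from the end of `u` to its
beginning, goes up, follows `γ₂` from the end of `l` to its beginning, and goes down. -/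
def gluing {γ₁ γ₂ : Cycle Pt} (u : UpperEdge γ₁) (l : LowerEdge γ₂) : Cycle Pt :=
  ((u.root ++ l.root.map
    (· + (u.root.head u.ne_nil + ((0, 1) : Pt) - l.root.getLast l.ne_nil)) : List Pt) : Cycle Pt)

/-- `G` is a gluing map on SOP modulo translations, for some choice, for each pair, of an upper edge
of the first SOP and a lower edge of the second SOP. -/
def IsGluingMap (G : PathClass × PathClass → PathClass) : Prop :=
  ∀ γ₁ γ₂ : Cycle Pt, IsSOP γ₁ → IsSOP γ₂ →
    ∃ (u : UpperEdge γ₁) (l : LowerEdge γ₂), G (toClass γ₁, toClass γ₂) = toClass (gluing u l)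

end SOPoly

/-! On a flat surface each boundary vertex has a turning angle determined by its number of squares,
so double counting vertices and edges turns `V - E + F = 1` into the statement that the boundary
makes exactly one full turn. The boundary path determines the direction and the tile of each free
side, hence the area, by integrating `x dy`.

Let `T` be the tile inserted between an upper edge of `γ₁` and a lower edge of `γ₂`. Putting `T`
between a disk bounded by `γ₁` and a disk bounded by `γ₂` yields a disk bounded by the gluing.
Conversely, in a disk bounded by the gluing, the two vertical sides of `T` are boundary edges lying
between the heights reached by `γ₁` and `γ₂`. The disk is therefore cut along the horizontal sides
of a single square into two flat pieces bounded by `γ₁` and `γ₂`; each of their boundaries makes one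
full turn, so both pieces are disks. Hence multiplicities multiply.

In the gluing, all the points of `γ₁` are strictly below those of `γ₂`, and `γ₁` is an arc of known
length: it can be cut off at the right place, which gives injectivity once the lengths are fixed. -/

namespace SOPoly

/-! ### Local geometry of glued squares -/

theorem eq_of_add_cornerOffset_eq {S T : Pt} {j k : Fin 4}
    (h₁ : S + cornerOffset j = T + cornerOffset k)
    (h₂ : S + cornerOffset (j + 1) = T + cornerOffset (k + 1)) : j = k ∧ S = T := by
  obtain ⟨a, b⟩ := S
  obtain ⟨c, d⟩ := T
  fin_cases j <;> fin_cases k <;> simp [cornerOffset] at h₁ h₂ ⊢ <;> omega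

/-- The unit outward normal of a side of a square. -/
def normal : Fin 4 → Pt := ![(0, -1), (1, 0), (0, 1), (-1, 0)]

theorem eq_add_normal_of_add_cornerOffset_eq {S T : Pt} {j k : Fin 4}
    (h₁ : S + cornerOffset j = T + cornerOffset (k + 1))
    (h₂ : S + cornerOffset (j + 1) = T + cornerOffset k) : j = k + 2 ∧ S = T + normal k := by
  obtain ⟨a, b⟩ := S
  obtain ⟨c, d⟩ := T
  fin_cases j <;> fin_cases k <;> simp [cornerOffset, normal] at h₁ h₂ ⊢ <;> omega

theorem add_normal_add_cornerOffset (T : Pt) (k : Fin 4) :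
    T + normal k + cornerOffset (k + 2) = T + cornerOffset (k + 1) ∧
      T + normal k + cornerOffset (k + 2 + 1) = T + cornerOffset k := by
  obtain ⟨c, d⟩ := T
  fin_cases k <;> simp [cornerOffset, normal]

/-- The coordinate of a point along the outward normal of the sides of index `k`. -/
def height (k : Fin 4) (Q : Pt) : ℤ := (normal k).1 * Q.1 + (normal k).2 * Q.2

theorem height_zero (Q : Pt) : height 0 Q = -Q.2 := by simp [height, normal]

theorem height_two (Q : Pt) : height 2 Q = Q.2 := by simp [height, normal]

theorem height_add (k : Fin 4) (P Q : Pt) : height k (P + Q) = height k P + height k Q := by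
  simp only [height, Prod.fst_add, Prod.snd_add]
  ring

theorem height_add_two (k : Fin 4) (Q : Pt) : height (k + 2) Q = -height k Q := by
  have hnormal : ∀ k, normal (k + 2) = -normal k := by decide
  simp only [height, hnormal, Prod.fst_neg, Prod.snd_neg]
  ring

theorem eq_of_height_eq {k : Fin 4} {P Q : Pt} (h : height k P = height k Q)
    (h' : height (k + 1) P = height (k + 1) Q) : P = Q := by
  fin_cases k <;> simp [height, normal] at h h' <;> exact Prod.ext (by omega) (by omega)

theorem height_normal_self (k : Fin 4) : height k (normal k) = 1 := by decide +revert

theorem height_normal_add_one (k : Fin 4) : height k (normal (k + 1)) = 0 := by decide +revert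

theorem neg_one_le_height_normal (k l : Fin 4) : -1 ≤ height k (normal l) := by decide +revert

theorem eq_add_two_of_height_normal_lt {k l : Fin 4} (h : height k (normal l) < 0) :
    l = k + 2 := by decide +revert

theorem height_cornerOffset (k l : Fin 4) : height k (cornerOffset l) =
    height k (cornerOffset k) - if l = k ∨ l = k + 1 then 0 else 1 := by decide +revert

namespace Side

variable {p : ℕ}

@[simp] theorem next_fst (s : Side p) : s.next.1 = s.1 := rfl

@[simp] theorem next_snd (s : Side p) : s.next.2 = s.2 + 1 := rfl

theorem next_injective : Function.Injective (Side.next (p := p)) := by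
  rintro ⟨f, j⟩ ⟨g, k⟩ h
  simpa [Side.next] using h

end Side

namespace SquareSurface

variable {p : ℕ} (D : SquareSurface p)

theorem glue_injective : Function.Injective D.glue :=
  Function.LeftInverse.injective D.glue_glue

/-- The rotation about the corner `c` to the next corner at the same vertex, across the side that
starts at `c`. It leaves the vertex when that side is free. -/
def rot (c : Side p) : Side p := (D.glue c).next

theorem rot_injective : Function.Injective D.rot :=
  Side.next_injective.comp D.glue_injective

theorem rot_of_free {s : Side p} (h : D.glue s = s) : D.rot s = s.next := by
  rw [rot, h]

theorem glue_snd_and_tile {s : Side p} (h : D.glue s ≠ s) :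
    (D.glue s).2 = s.2 + 2 ∧ D.tile (D.glue s).1 = D.tile s.1 + normal s.2 :=
  eq_add_normal_of_add_cornerOffset_eq (D.isometric s h).1 (D.isometric s h).2

theorem rot_snd {c : Side p} (h : D.glue c ≠ c) : (D.rot c).2 = c.2 + 3 := by
  rw [rot, Side.next_snd, (D.glue_snd_and_tile h).1, add_assoc]
  rfl

theorem start_rot {c : Side p} (h : D.glue c ≠ c) : D.start (D.rot c) = D.start c :=
  (D.isometric c h).2

theorem rot_ne_next_of_free {s c : Side p} (hs : D.glue s = s) (hc : D.glue c ≠ c) :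
    D.rot c ≠ s.next := by
  rw [← D.rot_of_free hs]
  exact fun h => hc (D.rot_injective h ▸ hs)

variable {D} in
theorem snd_eq_and_tile_eq_of_start_eq {q : ℕ} {D' : SquareSurface q} {s : Side p} {t : Side q}
    {v : Pt} (h₁ : D'.start t = D.start s + v) (h₂ : D'.start t.next = D.start s.next + v) :
    t.2 = s.2 ∧ D'.tile t.1 = D.tile s.1 + v := by
  refine eq_of_add_cornerOffset_eq (T := D.tile s.1 + v) ?_ ?_
  · rw [add_right_comm]; exact h₁
  · rw [add_right_comm]; exact h₂

theorem exists_free_of_height_maximal (k : Fin 4) (S : Fin p → Prop)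
    (hS : ∀ g, S g → D.glue (g, k) ≠ (g, k) → S (D.glue (g, k)).1) {g : Fin p} (hg : S g) :
    ∃ g', S g' ∧ D.glue (g', k) = (g', k) ∧
      ∀ g'', S g'' → height k (D.tile g'') ≤ height k (D.tile g') := by
  classical
  obtain ⟨g', hg', hmax⟩ := (Finset.univ.filter S).exists_max_image (fun g => height k (D.tile g))
    ⟨g, by simpa using hg⟩
  simp only [Finset.mem_filter, Finset.mem_univ, true_and] at hg' hmax
  refine ⟨g', hg', ?_, hmax⟩
  by_contra hne
  have h := hmax _ (hS g' hg' hne)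
  rw [(D.glue_snd_and_tile hne).2, height_add, height_normal_self] at h
  linarith

/-! ### Rotating about a vertex until the boundary is reached -/

/-- Iterating the rotation from the corner `c` leads to the free side `t`. This is the form in
which the relation between `c` and the boundary edge that starts at its vertex is used. -/
inductive Reach : Side p → Side p → Prop
  | refl {t : Side p} : D.glue t = t → Reach t t
  | step {c t : Side p} : D.glue c ≠ c → Reach (D.rot c) t → Reach c t

variable {D}

theorem Reach.free {c t : Side p} (h : D.Reach c t) : D.glue t = t := by
  induction h with
  | refl h => exact h
  | step _ _ ih => exact ih

theorem Reach.eq_of_free {c t : Side p} (h : D.Reach c t) (hc : D.glue c = c) : t = c := by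
  cases h with
  | refl => rfl
  | step h _ => exact absurd hc h

theorem Reach.of_not_free {c t : Side p} (h : D.Reach c t) (hc : D.glue c ≠ c) :
    D.Reach (D.rot c) t := by
  cases h with
  | refl h => exact absurd h hc
  | step _ h => exact h

theorem Reach.unique {c t t' : Side p} (h : D.Reach c t) (h' : D.Reach c t') : t = t' := by
  induction h with
  | refl h => exact (h'.eq_of_free h).symm
  | step hc _ ih => exact ih (h'.of_not_free hc)

theorem Reach.mem_of_closed {c t : Side p} (h : D.Reach c t) {S : Finset (Side p)} (ht : t ∈ S)
    (hS : ∀ c, D.glue c ≠ c → D.rot c ∈ S → c ∈ S) : c ∈ S := by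
  induction h with
  | refl => exact ht
  | step hc _ ih => exact hS _ hc (ih ht)

theorem Reach.start_eq {c t : Side p} (h : D.Reach c t) : D.start c = D.start t := by
  induction h with
  | refl => rfl
  | step hc _ ih => rw [← ih, D.start_rot hc]

theorem vertex_rot {c : Side p} (hc : D.glue c ≠ c) : D.vertex (D.rot c) = D.vertex c :=
  (Quot.sound ⟨hc, rfl⟩).symm

theorem iff_of_vertex_eq {P : Side p → Prop} (hP : ∀ c, D.glue c ≠ c → (P (D.rot c) ↔ P c))
    {c d : Side p} (h : D.vertex c = D.vertex d) : P c ↔ P d := by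
  have hrel : ∀ a b, D.CornerRel a b → P a = P b := by
    rintro a b ⟨ha, rfl⟩
    exact propext (hP a ha).symm
  exact iff_of_eq (congrArg (Quot.lift P hrel) h)

theorem vertex_eq_iff_reach {c t : Side p} (ht : D.glue t = t) :
    D.vertex c = D.vertex t ↔ D.Reach c t := by
  constructor
  · intro h
    refine (iff_of_vertex_eq (P := fun x => D.Reach x t) (fun c hc => ?_) h).2 (.refl ht)
    exact ⟨Reach.step hc, fun h => h.of_not_free hc⟩
  · intro h
    induction h with
    | refl => rfl
    | step hc _ ih => rw [← ih ht, vertex_rot hc]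

theorem free_eq_of_vertex_eq {s t : Side p} (hs : D.glue s = s) (ht : D.glue t = t)
    (h : D.vertex s = D.vertex t) : s = t :=
  (((vertex_eq_iff_reach ht).1 h).eq_of_free hs).symm

theorem corners_eq_card {v : D.Vertex} (S : Finset (Side p)) (h : ∀ c, D.vertex c = v ↔ c ∈ S) :
    D.corners v = S.card := by
  rw [corners, Nat.card_congr (Equiv.subtypeEquivRight h), Nat.card_eq_finsetCard]

theorem corners_eq_card_of_reach {t : Side p} {S : Finset (Side p)} (ht : t ∈ S)
    (hreach : ∀ c ∈ S, D.Reach c t) (hclosed : ∀ c, D.glue c ≠ c → D.rot c ∈ S → c ∈ S) :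
    D.corners (D.vertex t) = S.card := by
  have hfree : D.glue t = t := (hreach t ht).free
  refine corners_eq_card S fun c => ?_
  rw [vertex_eq_iff_reach hfree]
  exact ⟨fun h => h.mem_of_closed ht hclosed, hreach c⟩

/-! ### The degree conditions, in local form -/

variable (D)

/-- Flatness at the corner `c`, in terms of rotations instead of degrees: rotating about `c`, one
meets the boundary after at most three corners, or one comes back to `c` after four of them. -/
def FlatAt (c : Side p) : Prop := D.glue c = c ∨ D.glue (D.rot c) = D.rot c ∨
  D.glue (D.rot (D.rot c)) = D.rot (D.rot c) ∨
  (D.glue (D.rot (D.rot (D.rot c))) ≠ D.rot (D.rot (D.rot c)) ∧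
    D.rot (D.rot (D.rot (D.rot c))) = c)

/-- Flatness everywhere, equivalent to the degree conditions on disks. -/
def Flat : Prop := ∀ c, D.FlatAt c

/-- Adjacency of squares along a side, where a square with a free side is adjacent to itself. -/
def Adj (f g : Fin p) : Prop := ∃ k : Fin 4, (D.glue (f, k)).1 = g

/-- Any two squares are joined by a path of adjacent squares. -/
def Connected : Prop := ∀ f g, Relation.ReflTransGen D.Adj f g

/-- The corner `c` and its first three rotations. -/
def orbit (c : Side p) : Finset (Side p) := {c, D.rot c, D.rot (D.rot c), D.rot (D.rot (D.rot c))}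

theorem mem_orbit {c d : Side p} : d ∈ D.orbit c ↔
    d = c ∨ d = D.rot c ∨ d = D.rot (D.rot c) ∨ d = D.rot (D.rot (D.rot c)) := by
  simp only [orbit, Finset.mem_insert, Finset.mem_singleton]

variable {D}

section Orbit

variable {c : Side p}

theorem mem_orbit_rot_iff (h : D.rot (D.rot (D.rot (D.rot c))) = c) {d : Side p} :
    D.rot d ∈ D.orbit c ↔ d ∈ D.orbit c := by
  have hd : D.rot d = c ↔ d = D.rot (D.rot (D.rot c)) := by
    rw [← D.rot_injective.eq_iff (a := d), h]
  simp only [mem_orbit, D.rot_injective.eq_iff, hd]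
  tauto

variable (h₀ : D.glue c ≠ c) (h₁ : D.glue (D.rot c) ≠ D.rot c)
  (h₂ : D.glue (D.rot (D.rot c)) ≠ D.rot (D.rot c))

include h₀ h₁ h₂

theorem vertex_eq_of_mem_orbit {d : Side p} (hd : d ∈ D.orbit c) : D.vertex d = D.vertex c := by
  rcases (D.mem_orbit).1 hd with rfl | rfl | rfl | rfl
  · rfl
  · exact vertex_rot h₀
  · exact (vertex_rot h₁).trans (vertex_rot h₀)
  · exact (vertex_rot h₂).trans ((vertex_rot h₁).trans (vertex_rot h₀))

theorem image_snd_orbit : (D.orbit c).image Prod.snd = Finset.univ := by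
  simp only [orbit, Finset.image_insert, Finset.image_singleton, D.rot_snd h₀, D.rot_snd h₁,
    D.rot_snd h₂]
  generalize c.2 = k
  revert k
  decide

theorem card_orbit : (D.orbit c).card = 4 := by
  refine le_antisymm Finset.card_le_four ?_
  calc 4 = ((D.orbit c).image Prod.snd).card := by rw [image_snd_orbit h₀ h₁ h₂]; rfl
    _ ≤ (D.orbit c).card := Finset.card_image_le

theorem rot_four_eq_of_mem_orbit
    (h₃ : D.glue (D.rot (D.rot (D.rot c))) ≠ D.rot (D.rot (D.rot c)))
    (hmem : D.rot (D.rot (D.rot (D.rot c))) ∈ D.orbit c) :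
    D.rot (D.rot (D.rot (D.rot c))) = c := by
  have hdir : (D.rot (D.rot (D.rot (D.rot c)))).2 = c.2 := by
    rw [D.rot_snd h₃, D.rot_snd h₂, D.rot_snd h₁, D.rot_snd h₀]
    generalize c.2 = k
    revert k
    decide
  have hinj : Set.InjOn Prod.snd (D.orbit c : Set (Side p)) := by
    rw [← Finset.card_image_iff, image_snd_orbit h₀ h₁ h₂, card_orbit h₀ h₁ h₂]
    rfl
  exact hinj hmem (D.mem_orbit.2 (.inl rfl)) hdir

end Orbit

theorem flat_of_degrees (hbulk : ∀ v, ¬ D.IsBoundaryVertex v → D.corners v = 4)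
    (hbdry : ∀ v, D.IsBoundaryVertex v → D.corners v + 1 ∈ ({2, 3, 4} : Set ℕ)) : D.Flat := by
  classical
  intro c
  by_cases h₀ : D.glue c = c
  · exact .inl h₀
  by_cases h₁ : D.glue (D.rot c) = D.rot c
  · exact .inr (.inl h₁)
  by_cases h₂ : D.glue (D.rot (D.rot c)) = D.rot (D.rot c)
  · exact .inr (.inr (.inl h₂))
  refine .inr (.inr (.inr ?_))
  set F : Finset (Side p) := Finset.univ.filter fun d => D.vertex d = D.vertex c with hF
  have mem_F : ∀ {d}, d ∈ F ↔ D.vertex d = D.vertex c := by simp [hF]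
  have hcorners : D.corners (D.vertex c) = F.card := corners_eq_card F fun d => mem_F.symm
  have hsub : D.orbit c ⊆ F := fun d hd => mem_F.2 (vertex_eq_of_mem_orbit h₀ h₁ h₂ hd)
  have hcard : (D.orbit c).card = 4 := card_orbit h₀ h₁ h₂
  have hinner : ¬ D.IsBoundaryVertex (D.vertex c) := by
    intro hb
    have hdeg := hbdry _ hb
    have hle := Finset.card_le_card hsub
    simp only [Set.mem_insert_iff, Set.mem_singleton_iff] at hdeg
    omega
  have hv : D.vertex (D.rot (D.rot (D.rot c))) = D.vertex c :=
    vertex_eq_of_mem_orbit h₀ h₁ h₂ (D.mem_orbit.2 (.inr (.inr (.inr rfl))))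
  have h₃ : D.glue (D.rot (D.rot (D.rot c))) ≠ D.rot (D.rot (D.rot c)) :=
    fun h => hinner ⟨_, h, hv⟩
  have horbit : D.orbit c = F :=
    Finset.eq_of_subset_of_card_le hsub (by rw [← hcorners, hbulk _ hinner, hcard])
  refine ⟨h₃, rot_four_eq_of_mem_orbit h₀ h₁ h₂ h₃ ?_⟩
  rw [horbit]
  exact mem_F.2 ((vertex_rot h₃).trans hv)

theorem IsDisk.flat (h : D.IsDisk) : D.Flat := flat_of_degrees h.bulk_degree h.boundary_degree

theorem Flat.corners_eq_four (hD : D.Flat) {v : D.Vertex} (hv : ¬ D.IsBoundaryVertex v) :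
    D.corners v = 4 := by
  obtain ⟨c, rfl⟩ := Quot.exists_rep v
  change ¬ D.IsBoundaryVertex (D.vertex c) at hv
  change D.corners (D.vertex c) = 4
  have h₀ : D.glue c ≠ c := fun h => hv ⟨_, h, rfl⟩
  have v₁ := vertex_rot h₀
  have h₁ : D.glue (D.rot c) ≠ D.rot c := fun h => hv ⟨_, h, v₁⟩
  have v₂ := (vertex_rot h₁).trans v₁
  have h₂ : D.glue (D.rot (D.rot c)) ≠ D.rot (D.rot c) := fun h => hv ⟨_, h, v₂⟩
  obtain ⟨-, hrot⟩ := (((hD c).resolve_left h₀).resolve_left h₁).resolve_left h₂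
  rw [← card_orbit h₀ h₁ h₂]
  refine corners_eq_card _ fun d => ⟨fun h => ?_, vertex_eq_of_mem_orbit h₀ h₁ h₂⟩
  exact (iff_of_vertex_eq (P := (· ∈ D.orbit c)) (fun x _ => mem_orbit_rot_iff hrot) h).2
    (D.mem_orbit.2 (.inl rfl))

theorem Flat.corners_boundary_cases (hD : D.Flat) {s t : Side p} (hs : D.glue s = s)
    (h : D.Reach s.next t) :
    (t.2 = s.2 + 1 ∧ D.corners (D.vertex t) = 1) ∨ (t.2 = s.2 ∧ D.corners (D.vertex t) = 2) ∨
      (t.2 = s.2 + 3 ∧ D.corners (D.vertex t) = 3) := by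
  have hback : ∀ c, D.glue c ≠ c → D.rot c ≠ s.next := fun c => D.rot_ne_next_of_free hs
  by_cases h₀ : D.glue s.next = s.next
  · obtain rfl := h.eq_of_free h₀
    refine .inl ⟨rfl, ?_⟩
    rw [corners_eq_card_of_reach (S := {s.next}) (by simp) (by simpa using h) (fun c hc hmem => ?_),
      Finset.card_singleton]
    exact absurd (Finset.mem_singleton.1 hmem) (hback c hc)
  have d₁ : (D.rot s.next).2 = s.2 := by
    rw [D.rot_snd h₀, Side.next_snd, add_assoc]
    exact add_zero s.2
  have r₁ := h.of_not_free h₀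
  by_cases h₁ : D.glue (D.rot s.next) = D.rot s.next
  · obtain rfl := r₁.eq_of_free h₁
    refine .inr (.inl ⟨d₁, ?_⟩)
    rw [corners_eq_card_of_reach (S := {s.next, D.rot s.next}) (by simp)
      (by simpa using And.intro h r₁) (fun c hc hmem => ?_),
      Finset.card_pair fun e => h₀ (by rw [e, h₁])]
    simp only [Finset.mem_insert, Finset.mem_singleton, D.rot_injective.eq_iff] at hmem ⊢
    exact .inl (hmem.resolve_left (hback c hc))
  have r₂ := r₁.of_not_free h₁
  have h₂ : D.glue (D.rot (D.rot s.next)) = D.rot (D.rot s.next) := by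
    by_contra h₂
    obtain ⟨h₃, h₄⟩ := (((hD s.next).resolve_left h₀).resolve_left h₁).resolve_left h₂
    exact hback _ h₃ h₄
  obtain rfl := r₂.eq_of_free h₂
  refine .inr (.inr ⟨by rw [D.rot_snd h₁, d₁], ?_⟩)
  rw [corners_eq_card_of_reach (S := {s.next, D.rot s.next, D.rot (D.rot s.next)}) (by simp)
    (by simpa using And.intro h (And.intro r₁ r₂)) (fun c hc hmem => ?_)]
  · exact Finset.card_eq_three.2 ⟨_, _, _, (hback _ h₀).symm, fun e => h₀ (by rw [e, h₂]),
      fun e => h₁ (by rw [e, h₂]), rfl⟩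
  · simp only [Finset.mem_insert, Finset.mem_singleton, D.rot_injective.eq_iff] at hmem ⊢
    rcases hmem with e | e | e
    exacts [absurd e (hback c hc), .inl e, .inr (.inl e)]

/-- The signed quarter turn from the direction `j` to the direction `k`. The opposite direction
`j + 2` gets the junk value `0`: it is excluded on paths without U-turns. -/
def turn (j k : Fin 4) : ℤ := if k = j + 1 then 1 else if k = j + 3 then -1 else 0

theorem turn_add (j : Fin 4) : turn j (j + 1) = 1 ∧ turn j j = 0 ∧ turn j (j + 3) = -1 := by
  revert j
  decide

theorem Flat.two_sub_corners_eq_turn (hD : D.Flat) {s t : Side p} (hs : D.glue s = s)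
    (h : D.Reach s.next t) : (2 : ℤ) - D.corners (D.vertex t) = turn s.2 t.2 := by
  obtain ⟨left, straight, right⟩ := turn_add s.2
  rcases hD.corners_boundary_cases hs h with ⟨hdir, hn⟩ | ⟨hdir, hn⟩ | ⟨hdir, hn⟩ <;> rw [hdir, hn]
  exacts [left.symm, straight.symm, right.symm]

theorem Flat.snd_ne_add_two (hD : D.Flat) {s t : Side p} (hs : D.glue s = s)
    (h : D.Reach s.next t) : t.2 ≠ s.2 + 2 := by
  have hne : ∀ j : Fin 4, j + 1 ≠ j + 2 ∧ j ≠ j + 2 ∧ j + 3 ≠ j + 2 := by decide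
  obtain ⟨n₁, n₂, n₃⟩ := hne s.2
  rcases hD.corners_boundary_cases hs h with ⟨hdir, -⟩ | ⟨hdir, -⟩ | ⟨hdir, -⟩ <;> rw [hdir]
  exacts [n₁, n₂, n₃]

end SquareSurface

/-! ### Lists arranged in a cycle -/

theorem chain_append_singleton_iff {α : Type*} {r : α → α → Prop} {d : List α} {v x : α}
    (hx : x ∈ (d ++ [v]).head?) :
    ((d ++ [v] : List α) : Cycle α).Chain r ↔ (d ++ [v]).IsChain r ∧ r v x := by
  obtain ⟨l, hl⟩ := List.head?_eq_some_iff.1 hx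
  have hlast : v ∈ (x :: l).getLast? := by simp [← hl]
  rw [hl, Cycle.chain_coe_cons, ← List.cons_append, List.isChain_append, hlast]
  simp

theorem chain_iff_getElem {α : Type*} {r : α → α → Prop} {b : List α} :
    (b : Cycle α).Chain r ↔
      ∀ (i : ℕ) (h : i < b.length), r b[i] (b[(i + 1) % b.length]'(Nat.mod_lt _ (by omega))) := by
  rcases b.eq_nil_or_concat' with rfl | ⟨d, v, rfl⟩
  · simp
  have hx : (d ++ [v])[0] ∈ (d ++ [v]).head? := by simp [List.head?_eq_getElem?]
  have hlen : (d ++ [v]).length = d.length + 1 := by simp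
  rw [chain_append_singleton_iff hx, List.isChain_iff_getElem]
  refine ⟨fun ⟨hchain, hlast⟩ i hi => ?_, fun h => ⟨fun i hi => ?_, ?_⟩⟩
  · rcases Nat.lt_succ_iff_lt_or_eq.1 (hlen ▸ hi) with hi | rfl
    · have hi : i + 1 < (d ++ [v]).length := by omega
      simpa only [Nat.mod_eq_of_lt hi] using hchain i hi
    · simpa using hlast
  · simpa only [Nat.mod_eq_of_lt hi] using h i (by omega)
  · simpa using h d.length (by omega)

theorem exists_pred_of_chain {α : Type*} {r : α → α → Prop} {b : List α}
    (h : (b : Cycle α).Chain r) {t : α} (ht : t ∈ b) : ∃ s ∈ b, r s t := by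
  obtain ⟨d, l, rfl⟩ := List.append_of_mem ht
  have hrot : ((d ++ t :: l : List α) : Cycle α) = ((t :: (l ++ d) : List α) : Cycle α) :=
    Cycle.coe_eq_coe.2 (by simpa using List.isRotated_append (l := d) (l' := t :: l))
  rw [hrot, ← List.cons_append] at h
  obtain ⟨e, s, he⟩ := (t :: l ++ d).eq_nil_or_concat'.resolve_left (by simp)
  have hx : t ∈ (e ++ [s]).head? := by simp [← he]
  rw [he, chain_append_singleton_iff hx] at h
  refine ⟨s, ?_, h.2⟩
  have hs : s ∈ t :: l ++ d := by simp [he]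
  simpa [or_comm, or_assoc, or_left_comm] using hs

section Sums

variable {α β M : Type*} [AddCommMonoid M] (f : α → α → M)

/-- The sum of `f` over the pairs of consecutive elements of a list. -/
def pathSum (l : List α) : M := (List.zipWith f l l.tail).sum

/-- The sum of `f` over the pairs of consecutive elements of a list arranged in a cycle. -/
def cycSum (l : List α) : M := (List.zipWith f l (l.rotate 1)).sum

theorem pathSum_cons_cons (a b : α) (l : List α) :
    pathSum f (a :: b :: l) = f a b + pathSum f (b :: l) := by
  simp [pathSum]

theorem pathSum_append_cons (l : List α) (a : α) (m : List α) :
    pathSum f (l ++ a :: m) = pathSum f (l ++ [a]) + pathSum f (a :: m) := by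
  induction l with
  | nil => simp [pathSum]
  | cons b l ih =>
    cases l with
    | nil => simp [pathSum]
    | cons c l =>
      simp only [List.cons_append, pathSum_cons_cons] at ih ⊢
      rw [ih, add_assoc]

theorem pathSum_cons_append_singleton {l : List α} {x y : α} (hx : l.head? = some x)
    (hy : l.getLast? = some y) (a b : α) :
    pathSum f (a :: (l ++ [b])) = f a x + pathSum f l + f y b := by
  have hlast : pathSum f (l ++ [b]) = pathSum f l + f y b := by
    obtain ⟨m, rfl⟩ := List.getLast?_eq_some_iff.1 hy
    rw [List.append_assoc, List.singleton_append, pathSum_append_cons]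
    simp [pathSum]
  obtain ⟨m, rfl⟩ := List.head?_eq_some_iff.1 hx
  rw [add_assoc, ← hlast, List.cons_append, pathSum_cons_cons]

theorem cycSum_append_singleton (l : List α) (a : α) :
    cycSum f (l ++ [a]) = pathSum f (a :: (l ++ [a])) := by
  cases l with
  | nil => simp [cycSum, pathSum]
  | cons x l =>
    rw [List.cons_append, pathSum_cons_cons, cycSum, pathSum, List.rotate_cons_succ,
      List.rotate_zero, List.tail_cons, ← List.cons_append, List.zipWith_append (by simp),
      ← List.append_nil (l ++ [a]), List.zipWith_append (by simp)]
    simp [add_comm]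

variable {f}

theorem sum_map_eq_cycSum {g : β → M} {q : β → α} {b : List β}
    (h : (b : Cycle β).Chain fun x y => g y = f (q x) (q y)) :
    (b.map g).sum = cycSum f (b.map q) := by
  have hrot : (b.rotate 1).map g = List.zipWith f (b.map q) ((b.map q).rotate 1) := by
    refine List.ext_getElem (by simp) fun i h₁ _ => ?_
    have hi : i < b.length := by simpa using h₁
    simpa [List.getElem_rotate] using chain_iff_getElem.1 h i hi
  rw [cycSum, ← hrot]
  exact ((List.rotate_perm b 1).map g).sum_eq.symm

theorem cycSum_eq_sum_range {l : List α} {x : ℕ → α}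
    (hx : ∀ i, l[i % l.length]? = some (x i)) :
    cycSum f l = ∑ i ∈ Finset.range l.length, f (x i) (x (i + 1)) := by
  have hzip : List.zipWith f l (l.rotate 1) =
      (List.range l.length).map fun i => f (x i) (x (i + 1)) := by
    refine List.ext_getElem (by simp) fun i h₁ _ => ?_
    have hi : i < l.length := by simpa using h₁
    have h₀ := hx i
    have h₁ := hx (i + 1)
    rw [Nat.mod_eq_of_lt hi, List.getElem?_eq_getElem hi, Option.some_inj] at h₀
    rw [List.getElem?_eq_getElem (Nat.mod_lt _ (by omega)), Option.some_inj] at h₁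
    simp [List.getElem_rotate, h₀, h₁]
  rw [cycSum, hzip]
  rfl

end Sums

/-! ### Counting vertices and edges -/

/-- Double counting: each point of `S` corrects for the fibre that contains it. -/
theorem mul_card_eq_add_sum {X Y : Type*} [Finite X] [Finite Y] {q : X → Y} (m : ℤ)
    (S : Finset X) (hS : Set.InjOn q S)
    (hm : ∀ y, (∀ x ∈ S, q x ≠ y) → (Nat.card {x // q x = y} : ℤ) = m) :
    m * Nat.card Y = Nat.card X + ∑ x ∈ S, (m - Nat.card {z // q z = q x}) := by
  classical
  have := Fintype.ofFinite X
  have := Fintype.ofFinite Y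
  have hX : (Nat.card X : ℤ) = ∑ y : Y, (Nat.card {x // q x = y} : ℤ) := by
    rw [← Nat.cast_sum, ← Nat.card_sigma, Nat.card_congr (Equiv.sigmaFiberEquiv q)]
  have hdefect : ∑ x ∈ S, (m - (Nat.card {z // q z = q x} : ℤ)) =
      ∑ y : Y, (m - (Nat.card {z // q z = y} : ℤ)) := by
    rw [← Finset.sum_image (f := fun y => m - (Nat.card {z // q z = y} : ℤ)) hS]
    refine Finset.sum_subset (Finset.subset_univ _) fun y _ hy => ?_
    rw [hm y fun x hx h => hy (Finset.mem_image.2 ⟨x, hx, h⟩), sub_self]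
  rw [hdefect, hX, Finset.sum_sub_distrib, Nat.card_eq_fintype_card]
  simp [mul_comm]

namespace SquareSurface

variable {p : ℕ} {D : SquareSurface p}

instance : Finite D.Vertex := inferInstanceAs (Finite (Quot _))

instance : Finite D.Edge := inferInstanceAs (Finite (Quot _))

variable (D) in
/-- The Euler characteristic `V - E + F`. -/
noncomputable def euler : ℤ := (Nat.card D.Vertex : ℤ) - Nat.card D.Edge + p

variable (D) in
/-- The edge of the surface that carries a given side. -/
def edge (s : Side p) : D.Edge := Quot.mk _ s

theorem edge_eq_iff {s t : Side p} : D.edge s = D.edge t ↔ s = t ∨ s = D.glue t := by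
  constructor
  · intro h
    have hglue (a b : Side p) (hab : b = D.glue a) :
        (a = t ∨ a = D.glue t) = (b = t ∨ b = D.glue t) := by
      subst hab
      rw [D.glue_injective.eq_iff, or_comm, ← D.glue_injective.eq_iff, D.glue_glue]
    exact (iff_of_eq (congrArg (Quot.lift (fun a => a = t ∨ a = D.glue t) hglue) h)).2 (.inl rfl)
  · rintro (rfl | rfl)
    exacts [rfl, (Quot.sound (r := fun a b : Side p => b = D.glue a) rfl).symm]

theorem card_edge_fiber (t : Side p) :
    (Nat.card {s // D.edge s = D.edge t} : ℤ) = if D.glue t = t then 1 else 2 := by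
  classical
  have hfiber : Nat.card {s // D.edge s = D.edge t} = ({t, D.glue t} : Finset (Side p)).card := by
    simp only [edge_eq_iff]
    exact Nat.subtype_card _ fun s => by simp
  rw [hfiber]
  split_ifs with h
  · simp [h]
  · rw [Finset.card_pair (Ne.symm h)]
    rfl

variable {F : Finset (Side p)}

theorem two_mul_card_edge (hF : ∀ s, s ∈ F ↔ D.glue s = s) :
    (2 : ℤ) * Nat.card D.Edge = 4 * p + F.card := by
  have hinj : Set.InjOn D.edge F := fun s _ t ht h => by
    simpa [(hF t).1 ht] using edge_eq_iff.1 h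
  have hbulk (y : D.Edge) (hy : ∀ x ∈ F, D.edge x ≠ y) :
      (Nat.card {s // D.edge s = y} : ℤ) = 2 := by
    obtain ⟨t, rfl⟩ := Quot.mk_surjective y
    exact (card_edge_fiber t).trans (if_neg fun h => hy t ((hF t).2 h) rfl)
  have hfree : ∀ s ∈ F, (2 : ℤ) - Nat.card {z // D.edge z = D.edge s} = 1 := fun s hs => by
    rw [card_edge_fiber, if_pos ((hF s).1 hs)]
    norm_num
  rw [mul_card_eq_add_sum 2 F hinj hbulk, Finset.sum_congr rfl hfree]
  simp [mul_comm]

theorem Flat.four_mul_card_vertex (hD : D.Flat) (hF : ∀ s, s ∈ F ↔ D.glue s = s) :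
    (4 : ℤ) * Nat.card D.Vertex = 4 * p + ∑ t ∈ F, (4 - (D.corners (D.vertex t) : ℤ)) := by
  have hinj : Set.InjOn D.vertex F := fun s hs t ht h =>
    free_eq_of_vertex_eq ((hF s).1 hs) ((hF t).1 ht) h
  have hbulk (v : D.Vertex) (hv : ∀ x ∈ F, D.vertex x ≠ v) :
      (Nat.card {c // D.vertex c = v} : ℤ) = 4 := by
    refine mod_cast hD.corners_eq_four ?_
    rintro ⟨s, hs, rfl⟩
    exact hv s ((hF s).2 hs) rfl
  rw [mul_card_eq_add_sum 4 F hinj hbulk]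
  simp [mul_comm, corners]

theorem Flat.four_mul_euler (hD : D.Flat) (hF : ∀ s, s ∈ F ↔ D.glue s = s) :
    4 * D.euler = ∑ t ∈ F, (2 - (D.corners (D.vertex t) : ℤ)) := by
  have hE := two_mul_card_edge hF
  have hV := hD.four_mul_card_vertex hF
  simp only [Finset.sum_sub_distrib, Finset.sum_const, nsmul_eq_mul] at hV ⊢
  rw [euler]
  linarith

/-! ### The boundary, as a list of free sides -/

variable (D) in
/-- The list `b` enumerates the free sides of `D` in the order in which they are met along the
boundary. -/
structure BoundaryList (b : List (Side p)) : Prop where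
  nodup : b.Nodup
  mem_iff : ∀ s, s ∈ b ↔ D.glue s = s
  chain : (b : Cycle (Side p)).Chain fun s t => D.Reach s.next t

theorem chain_reach_iff {b : List (Side p)} (hb : ∀ s ∈ b, D.glue s = s) :
    (b : Cycle (Side p)).Chain (fun s t => D.Reach s.next t) ↔
      (b : Cycle (Side p)).Chain (fun s t => D.vertex s.next = D.vertex t) := by
  simp only [chain_iff_getElem]
  exact forall₂_congr fun i hi => (vertex_eq_iff_reach (hb _ (List.getElem_mem _))).symm

theorem BoundaryList.rotate {b : List (Side p)} (h : D.BoundaryList b) (k : ℕ) :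
    D.BoundaryList (b.rotate k) where
  nodup := List.nodup_rotate.2 h.nodup
  mem_iff s := by rw [List.mem_rotate, h.mem_iff]
  chain := by
    rw [Cycle.coe_eq_coe.2 (List.IsRotated.symm ⟨k, rfl⟩ : b.rotate k ~r b)]
    exact h.chain

theorem bounds_coe_iff {root : List Pt} :
    D.Bounds root ↔ ∃ b, D.BoundaryList b ∧ b.map D.start = root := by
  constructor
  · rintro ⟨β, hnodup, hmem, hchain, hmap⟩
    induction β using Quotient.inductionOn' with
    | h b =>
      have hb : D.BoundaryList b := ⟨hnodup, hmem, (chain_reach_iff fun s => (hmem s).1).2 hchain⟩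
      obtain ⟨k, hk⟩ := Cycle.coe_eq_coe.1 hmap
      exact ⟨b.rotate k, hb.rotate k, by rw [List.map_rotate, hk]⟩
  · rintro ⟨b, h, rfl⟩
    exact ⟨b, h.nodup, h.mem_iff, (chain_reach_iff fun s => (h.mem_iff s).1).1 h.chain, rfl⟩

theorem isDisk_iff {b : List (Side p)} (h : D.BoundaryList b) :
    D.IsDisk ↔ 0 < p ∧ D.Connected ∧ D.Flat ∧ D.euler = 1 := by
  refine ⟨fun hD => ⟨hD.pos, hD.connected, hD.flat, hD.euler⟩, fun ⟨hpos, hconn, hflat, heuler⟩ =>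
    ⟨hpos, hconn, heuler, fun _ => hflat.corners_eq_four, ?_⟩⟩
  rintro _ ⟨t, ht, rfl⟩
  obtain ⟨s, hs, hst⟩ := exists_pred_of_chain h.chain ((h.mem_iff t).2 ht)
  rcases hflat.corners_boundary_cases ((h.mem_iff s).1 hs) hst with ⟨-, e⟩ | ⟨-, e⟩ | ⟨-, e⟩ <;>
    simp [e]

/-- Gauss–Bonnet: the curvature is concentrated on the boundary, where it is the turning angle. -/
theorem Flat.four_mul_euler_eq_turn (hD : D.Flat) {b : List (Side p)} (h : D.BoundaryList b) :
    4 * D.euler = cycSum turn (b.map Prod.snd) := by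
  classical
  rw [hD.four_mul_euler (F := b.toFinset) (by simpa using h.mem_iff),
    List.sum_toFinset _ h.nodup]
  refine sum_map_eq_cycSum (chain_iff_getElem.2 fun i hi => ?_)
  exact hD.two_sub_corners_eq_turn ((h.mem_iff _).1 (List.getElem_mem _))
    (chain_iff_getElem.1 h.chain i hi)

theorem IsDisk.cycSum_turn (hD : D.IsDisk) {b : List (Side p)} (h : D.BoundaryList b) :
    cycSum turn (b.map Prod.snd) = 4 := by
  rw [← hD.flat.four_mul_euler_eq_turn h, show D.euler = 1 from hD.euler]
  rfl

theorem IsDisk.boundary_ne_nil (hD : D.IsDisk) {b : List (Side p)} (h : D.BoundaryList b) :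
    b ≠ [] := by
  rintro rfl
  simpa [cycSum] using hD.cycSum_turn h

theorem BoundaryList.map_tile_snd_eq {q : ℕ} {D' : SquareSurface q} {b : List (Side p)}
    {b' : List (Side q)} (h : D.BoundaryList b) (h' : D'.BoundaryList b') {v : Pt}
    (e : b'.map D'.start = (b.map D.start).map (· + v)) :
    b'.map (fun s => (D'.tile s.1, s.2)) = b.map (fun s => (D.tile s.1 + v, s.2)) := by
  have hl : b'.length = b.length := by simpa using congrArg List.length e
  have hstart (i : ℕ) (hi : i < b.length) :
      D'.start (b'[i]'(by omega)) = D.start b[i] + v := by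
    simpa [hi, hl] using congrArg (·[i]?) e
  refine List.ext_getElem (by simpa using hl) fun i h₁ h₂ => ?_
  have hi : i < b.length := by simpa using h₂
  have hnext := (chain_iff_getElem.1 h.chain i hi).start_eq
  have hnext' := (chain_iff_getElem.1 h'.chain i (by omega)).start_eq
  obtain ⟨hdir, htile⟩ := snd_eq_and_tile_eq_of_start_eq (hstart i hi) (by
    rw [hnext, hnext']
    simp only [hl]
    exact hstart _ _)
  simp [hdir, htile]

/-! ### The area -/

/-- The contribution of a side to the area `∮ x dy`, for the side in direction `s.2` of the unit
square whose lower left corner is `s.1`. -/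
def areaForm (s : Pt × Fin 4) : ℤ := ![0, s.1.1 + 1, 0, -s.1.1] s.2

theorem areaForm_add_normal (T : Pt) (k : Fin 4) :
    areaForm (T + normal k, k + 2) = -areaForm (T, k) := by
  fin_cases k <;> simp [areaForm, normal]

theorem BoundaryList.sum_areaForm {b : List (Side p)} (h : D.BoundaryList b) :
    ((b.map fun s => (D.tile s.1, s.2)).map areaForm).sum = (p : ℤ) := by
  classical
  set W : Side p → ℤ := fun s => areaForm (D.tile s.1, s.2) with hW
  have hall : ∑ s, W s = p := by
    rw [Fintype.sum_prod_type]
    simp [hW, areaForm, Fin.sum_univ_four]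
  have hglued : ∑ s with D.glue s ≠ s, W s = 0 := by
    refine Finset.sum_involution (fun s _ => D.glue s) (fun s hs => ?_) (fun s hs _ => ?_)
      (fun s hs => ?_) (fun s _ => D.glue_glue s)
    · obtain ⟨hdir, htile⟩ := D.glue_snd_and_tile (Finset.mem_filter.1 hs).2
      simp only [hW]
      rw [hdir, htile, areaForm_add_normal, add_neg_cancel]
    · exact (Finset.mem_filter.1 hs).2
    · simpa [D.glue_glue, eq_comm] using hs
  have hfree : Finset.univ.filter (fun s => ¬ D.glue s ≠ s) = b.toFinset := by
    ext s
    simp [h.mem_iff]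
  rw [List.map_map, ← hall, ← Finset.sum_filter_add_sum_filter_not _ (fun s => D.glue s ≠ s),
    hglued, zero_add, hfree, List.sum_toFinset _ h.nodup]
  rfl

theorem BoundaryList.faces_eq {q : ℕ} {D' : SquareSurface q} {b : List (Side p)}
    {b' : List (Side q)} (h : D.BoundaryList b) (h' : D'.BoundaryList b')
    (e : b'.map D'.start = b.map D.start) : q = p := by
  have hmap := h.map_tile_snd_eq h' (v := 0) (by rw [e]; simp [Function.comp_def])
  have harea := h'.sum_areaForm
  rw [hmap] at harea
  simp only [add_zero] at harea
  exact_mod_cast harea.symm.trans h.sum_areaForm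

end SquareSurface

/-! ### Extremal squares and finiteness -/

namespace SquareSurface

variable {p : ℕ} (D : SquareSurface p)

/-- No square lies beyond the line that contains the side `u`. -/
def Extremal (u : Side p) : Prop := ∀ g, height u.2 (D.tile g) ≤ height u.2 (D.tile u.1)

variable {D}

theorem exists_free_extremal (k : Fin 4) (g : Fin p) :
    ∃ f, D.glue (f, k) = (f, k) ∧ D.Extremal (f, k) := by
  obtain ⟨f, -, hfree, hmax⟩ :=
    D.exists_free_of_height_maximal k (fun _ => True) (fun _ _ _ => trivial) (g := g) trivial
  exact ⟨f, hfree, fun g => hmax g trivial⟩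

theorem height_start (k : Fin 4) (s : Side p) : height k (D.start s) =
    height k (D.tile s.1) +
      (height k (cornerOffset k) - if s.2 = k ∨ s.2 = k + 1 then 0 else 1) := by
  rw [start, height_add, height_cornerOffset]

theorem height_start_next (u : Side p) : height u.2 (D.start u.next) = height u.2 (D.start u) := by
  simp only [height_start, Side.next_fst, Side.next_snd, or_true, true_or, if_true]

theorem Extremal.height_start_le {u : Side p} (h : D.Extremal u) (s : Side p) :
    height u.2 (D.start s) ≤ height u.2 (D.start u) := by
  have htile := h s.1
  simp only [height_start, true_or, if_true]
  split <;> linarith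

theorem Extremal.height_start_lt {u : Side p} (h : D.Extremal u) {s : Side p} (h₀ : s.2 ≠ u.2)
    (h₁ : s.2 ≠ u.2 + 1) : height u.2 (D.start s) < height u.2 (D.start u) := by
  have htile := h s.1
  simp only [height_start, true_or, h₀, h₁, or_self, if_true, if_false]
  linarith

theorem height_tile_add_le {k : Fin 4} {m : ℤ} (hm : ∀ s, D.glue s = s → height k (D.start s) ≤ m)
    (g : Fin p) : height k (D.tile g) + height k (cornerOffset k) ≤ m := by
  obtain ⟨f, hfree, hmax⟩ := D.exists_free_extremal k g
  have htop := hm _ hfree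
  rw [start, height_add] at htop
  exact (add_le_add_left (hmax g) _).trans htop

theorem snd_eq_and_extremal_of_height {k : Fin 4} {u : Side p}
    (hu : height k (D.start u.next) = height k (D.start u))
    (hmax : ∀ s, D.glue s = s → height k (D.start s) ≤ height k (D.start u)) :
    u.2 = k ∧ D.Extremal u := by
  have htile := height_tile_add_le hmax
  have hk : ∀ l k : Fin 4, (l = k ∨ l = k + 1) → (l + 1 = k ∨ l + 1 = k + 1) → l = k := by decide
  have hu₀ : u.2 = k ∨ u.2 = k + 1 := by
    by_contra hne
    have h := htile u.1
    rw [D.height_start k u, if_neg hne] at h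
    linarith
  have hu₁ : u.2 + 1 = k ∨ u.2 + 1 = k + 1 := by
    by_contra hne
    have h := htile u.1
    rw [← hu, D.height_start, Side.next_snd, if_neg hne, Side.next_fst] at h
    linarith
  obtain rfl := hk _ _ hu₀ hu₁
  refine ⟨rfl, fun g => ?_⟩
  have h := htile g
  rw [start, height_add] at h
  linarith

theorem tile_mem_Icc {P Q : Pt} (h : ∀ s, D.glue s = s → D.start s ∈ Set.Icc P Q) (g : Fin p) :
    D.tile g ∈ Set.Icc P Q := by
  have bottom := height_tile_add_le (k := 0) (m := -P.2)
    (fun s hs => by simpa [height, normal] using (h s hs).1.2) g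
  have right := height_tile_add_le (k := 1) (m := Q.1)
    (fun s hs => by simpa [height, normal] using (h s hs).2.1) g
  have top := height_tile_add_le (k := 2) (m := Q.2)
    (fun s hs => by simpa [height, normal] using (h s hs).2.2) g
  have left := height_tile_add_le (k := 3) (m := -P.1)
    (fun s hs => by simpa [height, normal] using (h s hs).1.1) g
  refine ⟨⟨?_, ?_⟩, ?_, ?_⟩
  · simpa [height, normal, cornerOffset] using left
  · simpa [height, normal, cornerOffset] using bottom
  · have : (D.tile g).1 + 1 ≤ Q.1 := by simpa [height, normal, cornerOffset] using right
    linarith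
  · have : (D.tile g).2 + 1 ≤ Q.2 := by simpa [height, normal, cornerOffset] using top
    linarith

theorem finite_of_tile_mem (p : ℕ) {B : Set Pt} (hB : B.Finite) :
    {D : SquareSurface p | ∀ g, D.tile g ∈ B}.Finite := by
  have := hB.to_subtype
  refine Finite.of_injective (β := (Fin p → B) × (Side p → Side p))
    (fun D => (fun g => ⟨D.1.tile g, D.2 g⟩, D.1.glue)) ?_
  rintro ⟨⟨tile, glue, _, _⟩, _⟩ ⟨⟨tile', glue', _, _⟩, _⟩ h
  simp only [Prod.mk.injEq, funext_iff, Subtype.mk.injEq] at h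
  obtain ⟨htile, hglue⟩ := h
  obtain rfl : tile = tile' := funext htile
  obtain rfl : glue = glue' := funext hglue
  rfl

end SquareSurface

open SquareSurface

theorem Filling.exists_boundaryList {root : List Pt} (A : Filling root) :
    ∃ b, A.disk.BoundaryList b ∧ b.map A.disk.start = root :=
  bounds_coe_iff.1 A.bounds

theorem Filling.faces_eq {γ : Cycle Pt} (A B : Filling γ) : A.faces = B.faces := by
  induction γ using Quotient.inductionOn' with
  | h root =>
    obtain ⟨b, hb, hroot⟩ := Filling.exists_boundaryList (root := root) A
    obtain ⟨b', hb', hroot'⟩ := Filling.exists_boundaryList (root := root) B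
    exact hb'.faces_eq hb (hroot.trans hroot'.symm)

theorem IsSOP.existsUnique_area {γ : Cycle Pt} (h : IsSOP γ) : ∃! p, HasArea γ p := by
  obtain ⟨A⟩ := h.2
  exact ⟨A.faces, ⟨A, rfl⟩, fun q ⟨B, hB⟩ => hB ▸ B.faces_eq A⟩

theorem Filling.exists_tile_mem_Icc (γ : Cycle Pt) :
    ∃ P Q : Pt, ∀ (A : Filling γ) (g : Fin A.faces), A.disk.tile g ∈ Set.Icc P Q := by
  induction γ using Quotient.inductionOn' with
  | h root =>
    obtain ⟨P, hP⟩ := root.finite_toSet.bddBelow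
    obtain ⟨Q, hQ⟩ := root.finite_toSet.bddAbove
    refine ⟨P, Q, fun A => tile_mem_Icc fun s hs => ?_⟩
    obtain ⟨b, hb, hroot⟩ := Filling.exists_boundaryList (root := root) A
    have hmem := List.mem_map_of_mem (f := A.disk.start) ((hb.mem_iff s).2 hs)
    rw [hroot] at hmem
    exact ⟨hP hmem, hQ hmem⟩

instance (γ : Cycle Pt) : Finite (Filling γ) := by
  rcases isEmpty_or_nonempty (Filling γ) with _ | ⟨⟨A₀⟩⟩
  · infer_instance
  obtain ⟨P, Q, hbox⟩ := Filling.exists_tile_mem_Icc γ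
  have := (finite_of_tile_mem A₀.faces (Set.finite_Icc P Q)).to_subtype
  let X := {D : {D : SquareSurface A₀.faces | ∀ g, D.tile g ∈ Set.Icc P Q} //
    D.1.IsDisk ∧ D.1.Bounds γ}
  refine Finite.of_surjective (α := X) (fun D => ⟨A₀.faces, D.1.1, D.2.1, D.2.2⟩) fun A => ?_
  have hfaces := A.faces_eq A₀
  have htile := hbox A
  obtain ⟨q, D, hdisk, hbounds⟩ := A
  obtain rfl : q = A₀.faces := hfaces
  exact ⟨⟨⟨D, htile⟩, hdisk, hbounds⟩, rfl⟩

instance (γ : Cycle Pt) : Finite (DistortedDisk γ) :=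
  inferInstanceAs (Finite (Quotient _))

/-! ### Upper and lower edges -/

namespace SquareSurface

variable {p : ℕ} {D : SquareSurface p}

theorem BoundaryList.exists_last {b : List (Side p)} (h : D.BoundaryList b) {s : Side p}
    (hs : D.glue s = s) : ∃ d, D.BoundaryList (d ++ [s]) ∧ d ++ [s] ~r b := by
  obtain ⟨l₁, l₂, rfl⟩ := List.append_of_mem ((h.mem_iff s).2 hs)
  have hr : (l₁ ++ s :: l₂).rotate (l₁ ++ [s]).length = l₂ ++ l₁ ++ [s] := by
    rw [List.append_cons, List.rotate_append_length_eq, List.append_assoc]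
  exact ⟨l₂ ++ l₁, hr ▸ h.rotate _, List.IsRotated.symm ⟨_, hr⟩⟩

theorem BoundaryList.start_next_last {d : List (Side p)} {u x : Side p}
    (h : D.BoundaryList (d ++ [u])) (hx : x ∈ (d ++ [u]).head?) :
    D.start u.next = D.start x :=
  ((chain_append_singleton_iff hx).1 h.chain).2.start_eq

end SquareSurface

theorem Filling.exists_root {γ : Cycle Pt} (A : Filling γ) (k : Fin 4) :
    ∃ (root : List Pt) (hne : root ≠ []), (root : Cycle Pt) = γ ∧
      height k (root.getLast hne) = height k (root.head hne) ∧
      ∀ P ∈ root, height k P ≤ height k (root.head hne) := by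
  obtain ⟨f, hfree, hmax⟩ := A.disk.exists_free_extremal k ⟨0, A.isDisk.pos⟩
  induction γ using Quotient.inductionOn' with
  | h root =>
    obtain ⟨b, hb, hroot⟩ := Filling.exists_boundaryList (root := root) A
    obtain ⟨d, hd, hrot⟩ := hb.exists_last hfree
    refine ⟨(d ++ [(f, k)]).map A.disk.start, by simp,
      (Cycle.coe_eq_coe.2 (hrot.map _)).trans (congrArg _ hroot), ?_⟩
    have hhead : height k (A.disk.start ((d ++ [(f, k)]).head (by simp))) =
        height k (A.disk.start (f, k)) := by
      rw [← hd.start_next_last (List.head?_eq_some_head _)]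
      exact height_start_next (f, k)
    rw [List.getLast_map, List.head_map, List.getLast_append_singleton, hhead, List.forall_mem_map]
    exact ⟨rfl, fun s _ => hmax.height_start_le s⟩

theorem Filling.getLast_add_cornerOffset {root : List Pt} (A : Filling root) (hne : root ≠ [])
    {k : Fin 4} (hheight : height k (root.getLast hne) = height k (root.head hne))
    (hmax : ∀ P ∈ root, height k P ≤ height k (root.head hne)) :
    root.getLast hne + cornerOffset (k + 1) = root.head hne + cornerOffset k := by
  obtain ⟨_, D, -, hbounds⟩ := A
  obtain ⟨b, hb, rfl⟩ := bounds_coe_iff.1 hbounds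
  have hmem : ∀ s, D.glue s = s → D.start s ∈ b.map D.start :=
    fun s hs => List.mem_map_of_mem ((hb.mem_iff s).2 hs)
  obtain ⟨d, u, rfl⟩ := List.eq_nil_or_concat' b |>.resolve_left (by simpa using hne)
  have hhead := hb.start_next_last (List.head?_eq_some_head (by simp))
  simp only [List.getLast_map, List.getLast_append_singleton, List.head_map, ← hhead]
    at hheight hmax ⊢
  obtain ⟨rfl, -⟩ := snd_eq_and_extremal_of_height hheight.symm
    fun s hs => hheight ▸ hmax _ (hmem s hs)
  exact add_right_comm _ _ _

theorem IsSOP.nonempty_upperEdge {γ : Cycle Pt} (h : IsSOP γ) : Nonempty (UpperEdge γ) := by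
  obtain ⟨A⟩ := h.2
  obtain ⟨root, hne, hγ, hlast, hmax⟩ := A.exists_root 2
  simp only [height_two] at hlast hmax
  exact ⟨⟨root, hne, hγ, hlast, hmax⟩⟩

theorem IsSOP.nonempty_lowerEdge {γ : Cycle Pt} (h : IsSOP γ) : Nonempty (LowerEdge γ) := by
  obtain ⟨A⟩ := h.2
  obtain ⟨root, hne, hγ, hlast, hmax⟩ := A.exists_root 0
  simp only [height_zero, neg_inj, neg_le_neg_iff] at hlast hmax
  exact ⟨⟨root, hne, hγ, hlast, hmax⟩⟩

/-! ### Uniqueness of the boundary list -/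

theorem sum_range_mul_of_periodic {M : Type*} [AddCommMonoid M] {x : ℕ → M} {n : ℕ}
    (h : ∀ i, x (n + i) = x i) (m : ℕ) :
    ∑ i ∈ Finset.range (n * m), x i = m • ∑ i ∈ Finset.range n, x i := by
  induction m with
  | zero => simp
  | succ m ih =>
    rw [Nat.mul_succ, add_comm, Finset.sum_range_add, Finset.sum_congr rfl fun i _ => h i, ih,
      succ_nsmul']

namespace SquareSurface

theorem turn_modEq {j k : Fin 4} (h : k ≠ j + 2) :
    ((k : ℕ) : ℤ) ≡ (j : ℕ) + turn j k [ZMOD 4] := by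
  revert h
  fin_cases j <;> fin_cases k <;> simp +decide

theorem sum_turn_modEq {δ : ℕ → Fin 4} (hδ : ∀ i, δ (i + 1) ≠ δ i + 2) (m : ℕ) :
    ((δ m : ℕ) : ℤ) ≡
      (δ 0 : ℕ) + ∑ i ∈ Finset.range m, turn (δ i) (δ (i + 1)) [ZMOD 4] := by
  induction m with
  | zero => simp
  | succ m ih =>
    rw [Finset.sum_range_succ, ← add_assoc]
    exact (turn_modEq (hδ m)).trans (ih.add_right _)

/-- A period `k` contains a whole number `j` of full turns, and `n * k` steps make `k` full turns
when counted by the period `n`, but `n * j` full turns when counted by the period `k`. -/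
theorem dvd_of_periodic {δ : ℕ → Fin 4} {n k : ℕ} (hn : ∀ i, δ (n + i) = δ i)
    (hk : ∀ i, δ (k + i) = δ i) (hδ : ∀ i, δ (i + 1) ≠ δ i + 2)
    (h4 : ∑ i ∈ Finset.range n, turn (δ i) (δ (i + 1)) = 4) : n ∣ k := by
  have hsum_n := sum_range_mul_of_periodic (x := fun i => turn (δ i) (δ (i + 1))) (n := n)
    (fun i => by rw [hn, add_assoc, hn]) k
  have hsum_k := sum_range_mul_of_periodic (x := fun i => turn (δ i) (δ (i + 1))) (n := k)
    (fun i => by rw [hk, add_assoc, hk]) n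
  obtain ⟨j, hj⟩ : (4 : ℤ) ∣ ∑ i ∈ Finset.range k, turn (δ i) (δ (i + 1)) := by
    have hmod := sum_turn_modEq hδ k
    rw [show δ k = δ 0 from hk 0] at hmod
    simpa using Int.modEq_iff_dvd.1 hmod
  rw [mul_comm n k, hsum_k, h4, hj, nsmul_eq_mul, nsmul_eq_mul] at hsum_n
  exact Int.natCast_dvd_natCast.1 ⟨j, by linarith⟩

variable {p : ℕ} {D : SquareSurface p} {b b' : List (Side p)}

theorem BoundaryList.isRotated (h : D.BoundaryList b) (h' : D.BoundaryList b') : b ~r b' := by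
  have hperm : b.Perm b' := (List.perm_ext_iff_of_nodup h.nodup h'.nodup).2 fun s => by
    rw [h.mem_iff, h'.mem_iff]
  have hl := hperm.length_eq
  rcases b.eq_nil_or_concat with rfl | hne
  · rw [hperm.nil_eq]
  have hpos : 0 < b.length := by
    obtain ⟨d, v, rfl⟩ := hne
    simp
  obtain ⟨k, hk, e⟩ := List.getElem_of_mem (hperm.mem_iff.2 (List.getElem_mem (hl ▸ hpos)))
  refine ⟨k, List.ext_getElem (by simpa using hl) fun i h₁ h₂ => ?_⟩
  rw [List.getElem_rotate]
  induction i with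
  | zero => simp [Nat.mod_eq_of_lt hk, e]
  | succ i ih =>
    have hnext' := chain_iff_getElem.1 h'.chain i (by omega)
    have hnext := chain_iff_getElem.1 h.chain ((i + k) % b.length) (Nat.mod_lt _ hpos)
    simp only [Nat.mod_eq_of_lt h₂] at hnext'
    simp only [Nat.mod_add_mod, add_right_comm i k 1] at hnext
    rw [ih (by simp; omega) (by omega)] at hnext
    exact hnext.unique hnext'

/-- The boundary path of a disk has rotation number one, so that it is not periodic. -/
theorem IsDisk.boundaryList_unique (hD : D.IsDisk) (h : D.BoundaryList b)
    (h' : D.BoundaryList b') (e : b'.map D.start = b.map D.start) : b' = b := by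
  obtain ⟨k, rfl⟩ := h.isRotated h'
  have hpos : 0 < b.length := List.length_pos_iff.2 (hD.boundary_ne_nil h)
  have hmod (i : ℕ) : i % b.length < b.length := Nat.mod_lt i hpos
  set δ : ℕ → Fin 4 := fun i => (b[i % b.length]'(hmod i)).2 with hδ
  suffices hdvd : b.length ∣ k by
    obtain ⟨m, rfl⟩ := hdvd
    rw [List.rotate_length_mul]
  refine dvd_of_periodic (δ := δ) (fun i => by simp [hδ]) (fun i => ?_) (fun i => ?_) ?_
  · have hdir := h.map_tile_snd_eq h' (v := 0) (by rw [e]; simp [Function.comp_def])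
    have hdir_i := congrArg (·[i % b.length]?) hdir
    simp only [List.map_rotate, List.getElem?_rotate, List.length_map, hmod,
      List.getElem?_eq_getElem, List.getElem_map, Option.some_inj, Prod.mk.injEq,
      Nat.mod_add_mod] at hdir_i
    simpa only [hδ, Nat.add_comm k i] using hdir_i.2
  · have hnext := chain_iff_getElem.1 h.chain (i % b.length) (hmod i)
    have hturn := hD.flat.snd_ne_add_two ((h.mem_iff _).1 (List.getElem_mem _)) hnext
    simpa [hδ] using hturn
  · rw [← hD.cycSum_turn h, cycSum_eq_sum_range (x := δ) fun i => by simp [hδ, hmod]]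
    simp

end SquareSurface

/-- The image of a side under a map of squares. -/
def Side.lift {a n : ℕ} (i : Fin a → Fin n) (s : Side a) : Side n := (i s.1, s.2)

theorem Side.lift_next {a n : ℕ} (i : Fin a → Fin n) (s : Side a) :
    (Side.lift i s).next = Side.lift i s.next := rfl

theorem Side.lift_injective {a n : ℕ} {i : Fin a → Fin n} (hi : Function.Injective i) :
    Function.Injective (Side.lift i) :=
  hi.prodMap Function.injective_id

theorem isChain_append_singleton_map_iff {α β : Type*} {r : α → α → Prop} {r' : β → β → Prop}
    {j : α → β} {d : List α} {v : α} (h : ∀ s ∈ d, ∀ t, r s t ↔ r' (j s) (j t)) :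
    (d ++ [v]).IsChain r ↔ ((d ++ [v]).map j).IsChain r' := by
  rw [List.isChain_map, List.isChain_iff_getElem, List.isChain_iff_getElem]
  refine forall₂_congr fun i hi => h _ ?_ _
  have hi : i < d.length := by simpa using hi
  rw [List.getElem_append_left hi]
  exact List.getElem_mem hi

namespace SquareSurface

variable {a b n : ℕ}

/-! ### Constructions of surfaces -/

/-- The surface `D` moved by the translation of vector `v`. -/
def translate (D : SquareSurface n) (v : Pt) : SquareSurface n where
  tile g := D.tile g + v
  glue := D.glue
  glue_glue := D.glue_glue
  isometric s hs := by
    simp only [add_right_comm _ v, D.isometric s hs, true_and]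

/-- The surface made of the single square at `T`. -/
def square (T : Pt) : SquareSurface 1 where
  tile _ := T
  glue := id
  glue_glue _ := rfl
  isometric _ hs := absurd rfl hs

/-- The disjoint union of two surfaces, the squares of `A` being numbered before those of `B`. -/
def disjointUnion (A : SquareSurface a) (B : SquareSurface b) : SquareSurface (a + b) where
  tile := Fin.append A.tile B.tile
  glue s := Fin.addCases (motive := fun _ => Side (a + b))
    (fun x => Side.lift (Fin.castAdd b) (A.glue (x, s.2)))
    (fun y => Side.lift (Fin.natAdd a) (B.glue (y, s.2))) s.1
  glue_glue := by
    rintro ⟨g, k⟩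
    refine Fin.addCases (fun x => ?_) (fun y => ?_) g <;>
      simp [Side.lift, A.glue_glue, B.glue_glue]
  isometric := by
    rintro ⟨g, k⟩
    refine Fin.addCases (fun x hs => ?_) (fun y hs => ?_) g
    · simpa [Side.lift] using A.isometric (x, k) (by simpa [Side.lift, Prod.ext_iff] using hs)
    · simpa [Side.lift] using B.isometric (y, k) (by simpa [Side.lift, Prod.ext_iff] using hs)

theorem disjointUnion_glue_left (A : SquareSurface a) (B : SquareSurface b) (s : Side a) :
    (A.disjointUnion B).glue (Side.lift (Fin.castAdd b) s) =
      Side.lift (Fin.castAdd b) (A.glue s) := by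
  simp [disjointUnion, Side.lift]

theorem disjointUnion_glue_right (A : SquareSurface a) (B : SquareSurface b) (s : Side b) :
    (A.disjointUnion B).glue (Side.lift (Fin.natAdd a) s) =
      Side.lift (Fin.natAdd a) (B.glue s) := by
  simp [disjointUnion, Side.lift]

/-- The surface obtained from `D` by gluing two free sides `s` and `t`, which have to sit on the
same lattice edge, with opposite orientations. -/
def glueSides (D : SquareSurface n) {s t : Side n} (hs : D.glue s = s) (ht : D.glue t = t)
    (hst : D.start t = D.start s.next) (hts : D.start t.next = D.start s) : SquareSurface n where
  tile := D.tile
  glue r := Equiv.swap s t (D.glue r)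
  glue_glue r := by
    have hcomm (q : Side n) : D.glue (Equiv.swap s t q) = Equiv.swap s t (D.glue q) := by
      by_cases hqs : q = s
      · rw [hqs, hs, Equiv.swap_apply_left, ht]
      by_cases hqt : q = t
      · rw [hqt, ht, Equiv.swap_apply_right, hs]
      · rw [Equiv.swap_apply_of_ne_of_ne hqs hqt, Equiv.swap_apply_of_ne_of_ne]
        · exact fun h => hqs (D.glue_injective (h.trans hs.symm))
        · exact fun h => hqt (D.glue_injective (h.trans ht.symm))
    rw [hcomm, D.glue_glue, Equiv.swap_apply_self]
  isometric r hr := by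
    by_cases hrs : r = s
    · subst hrs
      rw [hs, Equiv.swap_apply_left]
      exact ⟨hst, hts⟩
    by_cases hrt : r = t
    · subst hrt
      rw [ht, Equiv.swap_apply_right]
      exact ⟨hts.symm, hst.symm⟩
    have hswap : Equiv.swap s t (D.glue r) = D.glue r := Equiv.swap_apply_of_ne_of_ne
      (fun h => hrs (D.glue_injective (h.trans hs.symm)))
      (fun h => hrt (D.glue_injective (h.trans ht.symm)))
    rw [hswap] at hr ⊢
    exact D.isometric r hr

section GlueSides

variable {D : SquareSurface n} {s t : Side n} {hs : D.glue s = s} {ht : D.glue t = t}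
  {hst : D.start t = D.start s.next} {hts : D.start t.next = D.start s}

theorem glueSides_glue_right : (D.glueSides hs ht hst hts).glue t = s :=
  (congrArg _ ht).trans (Equiv.swap_apply_right s t)

theorem glueSides_glue_of_ne {r : Side n} (hrs : r ≠ s) (hrt : r ≠ t) :
    (D.glueSides hs ht hst hts).glue r = D.glue r :=
  Equiv.swap_apply_of_ne_of_ne (fun h => hrs (D.glue_injective (h.trans hs.symm)))
    (fun h => hrt (D.glue_injective (h.trans ht.symm)))

end GlueSides

section Attach

variable (A : SquareSurface a) (D : SquareSurface n) {v : Pt} {u : Side a} {r : Side n}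
  (hu : A.glue u = u) (hr : D.glue r = r) (hur : A.start u + v = D.start r.next)
  (hru : A.start u.next + v = D.start r)

/-- The surface `A`, translated by `v`, attached by its free side `u` to the free side `r` of
`D`. -/
def attach : SquareSurface (a + n) :=
  ((A.translate v).disjointUnion D).glueSides (s := Side.lift (Fin.natAdd a) r)
    (t := Side.lift (Fin.castAdd n) u)
    ((disjointUnion_glue_right ..).trans (congrArg _ hr))
    ((disjointUnion_glue_left ..).trans (congrArg _ hu))
    (by simpa [start, disjointUnion, translate, Side.lift, add_right_comm] using hur)
    (by simpa [start, disjointUnion, translate, Side.lift, add_right_comm] using hru)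

theorem castAdd_ne_natAdd {x : Fin a} {y : Fin n} : Fin.castAdd n x ≠ Fin.natAdd a y := by
  simp only [ne_eq, Fin.ext_iff, Fin.val_castAdd, Fin.val_natAdd]
  omega

theorem attach_tile_left (x : Fin a) :
    (attach A D hu hr hur hru).tile (Fin.castAdd n x) = A.tile x + v :=
  Fin.append_left ..

theorem attach_tile_right (g : Fin n) :
    (attach A D hu hr hur hru).tile (Fin.natAdd a g) = D.tile g :=
  Fin.append_right ..

theorem attach_glue_left {s : Side a} (hs : s ≠ u) :
    (attach A D hu hr hur hru).glue (Side.lift (Fin.castAdd n) s) =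
      Side.lift (Fin.castAdd n) (A.glue s) :=
  (glueSides_glue_of_ne (fun h => castAdd_ne_natAdd (congrArg Prod.fst h))
    ((Side.lift_injective (Fin.castAdd_injective _ _)).ne hs)).trans (disjointUnion_glue_left ..)

theorem attach_glue_right {s : Side n} (hs : s ≠ r) :
    (attach A D hu hr hur hru).glue (Side.lift (Fin.natAdd a) s) =
      Side.lift (Fin.natAdd a) (D.glue s) :=
  (glueSides_glue_of_ne ((Side.lift_injective (Fin.natAdd_injective _ _)).ne hs)
    (fun h => castAdd_ne_natAdd (congrArg Prod.fst h).symm)).trans (disjointUnion_glue_right ..)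

theorem attach_glue_attached : (attach A D hu hr hur hru).glue (Side.lift (Fin.castAdd n) u) =
    Side.lift (Fin.natAdd a) r :=
  glueSides_glue_right

end Attach

open Classical in
/-- The part of `C` made of the squares `i x`, separated from the other squares. -/
noncomputable def restrict (C : SquareSurface n) (i : Fin a ↪ Fin n) : SquareSurface a where
  tile x := C.tile (i x)
  glue s := if h : ∃ t, Side.lift i t = C.glue (Side.lift i s) then h.choose else s
  glue_glue s := by
    by_cases h : ∃ t, Side.lift i t = C.glue (Side.lift i s)
    · have hs : Side.lift i s = C.glue (Side.lift i h.choose) := by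
        rw [h.choose_spec, C.glue_glue]
      have h' : ∃ t, Side.lift i t = C.glue (Side.lift i h.choose) := ⟨s, hs⟩
      rw [dif_pos h, dif_pos h']
      exact Side.lift_injective i.injective (h'.choose_spec.trans hs.symm)
    · rw [dif_neg h, dif_neg h]
  isometric s hs := by
    by_cases h : ∃ t, Side.lift i t = C.glue (Side.lift i s)
    · rw [dif_pos h] at hs ⊢
      have hspec := h.choose_spec
      have hlift : Side.lift i h.choose ≠ Side.lift i s :=
        fun e => hs (Side.lift_injective i.injective e)
      generalize h.choose = t at hspec hlift ⊢
      have hiso := C.isometric (Side.lift i s) (hspec ▸ hlift)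
      rwa [← hspec] at hiso
    · exact absurd (dif_neg h) hs

theorem restrict_glue_of_eq {C : SquareSurface n} {i : Fin a ↪ Fin n} {s t : Side a}
    (h : C.glue (Side.lift i s) = Side.lift i t) : (C.restrict i).glue s = t := by
  have h' : ∃ t, Side.lift i t = C.glue (Side.lift i s) := ⟨t, h.symm⟩
  exact (dif_pos h').trans (Side.lift_injective i.injective (h'.choose_spec.trans h))

theorem restrict_glue_of_notMem {C : SquareSurface n} {i : Fin a ↪ Fin n} {s : Side a}
    (h : (C.glue (Side.lift i s)).1 ∉ Set.range i) : (C.restrict i).glue s = s :=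
  dif_neg fun ⟨t, ht⟩ => h ⟨t.1, congrArg Prod.fst ht⟩

/-! ### A surface attached to a square -/

/-- `A`, translated by `v`, is embedded by `i` as a part of `C` that is attached to the rest of `C`
by its side `u` only, which is glued to the side `k` of the square `f`, the two adjacent sides of
`f` being free. -/
structure Half (A : SquareSurface a) (C : SquareSurface n) (i : Fin a → Fin n) (f : Fin n)
    (u : Side a) (k : Fin 4) (v : Pt) : Prop where
  inj : Function.Injective i
  ne_f : ∀ x, i x ≠ f
  tile : ∀ x, C.tile (i x) = A.tile x + v
  glue : ∀ s, s ≠ u → C.glue (Side.lift i s) = Side.lift i (A.glue s)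
  free_u : A.glue u = u
  glue_u : C.glue (Side.lift i u) = (f, k)
  free_one : C.glue (f, k + 1) = (f, k + 1)
  free_three : C.glue (f, k + 3) = (f, k + 3)

/-- The correspondence between the free sides of `A` and those of `C`, with `u` replaced by a free
side of `f`. -/
def outer (i : Fin a → Fin n) (f : Fin n) (u : Side a) (k : Fin 4) (s : Side a) : Side n :=
  if s = u then (f, k + 1) else Side.lift i s

theorem outer_self (i : Fin a → Fin n) (f : Fin n) (u : Side a) (k : Fin 4) :
    outer i f u k u = (f, k + 1) := if_pos rfl

theorem outer_of_ne (i : Fin a → Fin n) (f : Fin n) {s u : Side a} (h : s ≠ u) (k : Fin 4) :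
    outer i f u k s = Side.lift i s := if_neg h

theorem Adj.symm {D : SquareSurface n} {f g : Fin n} : D.Adj f g → D.Adj g f := by
  rintro ⟨k, rfl⟩
  exact ⟨(D.glue (f, k)).2, congrArg Prod.fst (D.glue_glue (f, k))⟩

namespace Half

variable {A : SquareSurface a} {C : SquareSurface n} {i : Fin a → Fin n} {f : Fin n} {u : Side a}
  {k : Fin 4} {v : Pt}

theorem lift_injective (H : Half A C i f u k v) : Function.Injective (Side.lift i) :=
  Side.lift_injective H.inj

theorem lift_ne (H : Half A C i f u k v) (s : Side a) (l : Fin 4) : Side.lift i s ≠ (f, l) :=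
  fun h => H.ne_f _ (congrArg Prod.fst h)

theorem outer_injective (H : Half A C i f u k v) : Function.Injective (outer i f u k) := by
  intro s t h
  by_cases hs : s = u <;> by_cases ht : t = u
  · rw [hs, ht]
  · rw [hs, outer_self, outer_of_ne _ _ ht] at h
    exact absurd h.symm (H.lift_ne _ _)
  · rw [ht, outer_self, outer_of_ne _ _ hs] at h
    exact absurd h (H.lift_ne _ _)
  · rw [outer_of_ne _ _ hs, outer_of_ne _ _ ht] at h
    exact H.lift_injective h

theorem ne_u (H : Half A C i f u k v) {s : Side a} (hs : A.glue s ≠ s) : s ≠ u := by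
  rintro rfl
  exact hs H.free_u

theorem glue_f (H : Half A C i f u k v) : C.glue (f, k) = Side.lift i u := by
  rw [← H.glue_u, C.glue_glue]

theorem glue_u_ne (H : Half A C i f u k v) : C.glue (Side.lift i u) ≠ Side.lift i u := by
  rw [H.glue_u]
  exact (H.lift_ne _ _).symm

theorem glue_f_ne (H : Half A C i f u k v) : C.glue (f, k) ≠ (f, k) := by
  rw [H.glue_f]
  exact H.lift_ne _ _

theorem u_snd (H : Half A C i f u k v) : u.2 = k + 2 := by
  have h := (C.glue_snd_and_tile H.glue_f_ne).1
  rwa [H.glue_f] at h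

theorem tile_u (H : Half A C i f u k v) : A.tile u.1 + v = C.tile f + normal k := by
  have h := (C.glue_snd_and_tile H.glue_f_ne).2
  rw [H.glue_f] at h
  rw [← h, ← H.tile]
  rfl

theorem start_lift (H : Half A C i f u k v) (s : Side a) :
    C.start (Side.lift i s) = A.start s + v := by
  rw [start, start, add_right_comm, ← H.tile]
  rfl

theorem start_outer (H : Half A C i f u k v) (s : Side a) :
    C.start (outer i f u k s) = A.start s + v := by
  by_cases hs : s = u
  · subst hs
    rw [outer_self, start, start, add_right_comm, H.tile_u, H.u_snd]
    exact (add_normal_add_cornerOffset _ _).1.symm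
  · rw [outer_of_ne _ _ hs, H.start_lift]

theorem free_lift (H : Half A C i f u k v) {s : Side a} (hs : s ≠ u) :
    C.glue (Side.lift i s) = Side.lift i s ↔ A.glue s = s := by
  rw [H.glue _ hs, H.lift_injective.eq_iff]

theorem free_outer (H : Half A C i f u k v) (s : Side a) :
    C.glue (outer i f u k s) = outer i f u k s ↔ A.glue s = s := by
  by_cases hs : s = u
  · subst hs
    rw [outer_self]
    exact iff_of_true H.free_one H.free_u
  · rw [outer_of_ne _ _ hs, H.free_lift hs]

theorem rot_lift (H : Half A C i f u k v) {s : Side a} (hs : s ≠ u) :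
    C.rot (Side.lift i s) = Side.lift i (A.rot s) := by
  rw [rot, H.glue _ hs]
  rfl

theorem rot_u (H : Half A C i f u k v) : C.rot (Side.lift i u) = (f, k + 1) := by
  rw [rot, H.glue_u]
  rfl

theorem rot_f (H : Half A C i f u k v) : C.rot (f, k) = Side.lift i u.next := by
  rw [rot, H.glue_f]
  rfl

theorem reach_lift (H : Half A C i f u k v) {c t : Side a} (h : A.Reach c t) :
    C.Reach (Side.lift i c) (outer i f u k t) := by
  induction h with
  | @refl t ht =>
    by_cases hs : t = u
    · subst hs
      refine .step H.glue_u_ne ?_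
      rw [H.rot_u, outer_self]
      exact .refl H.free_one
    · rw [outer_of_ne _ _ hs]
      exact .refl ((H.free_lift hs).2 ht)
  | step hc _ ih =>
    have hu := H.ne_u hc
    refine .step (fun h => hc ((H.free_lift hu).1 h)) ?_
    rwa [H.rot_lift hu]

theorem exists_of_reach (H : Half A C i f u k v) {c : Side a} {t' : Side n}
    (h : C.Reach (Side.lift i c) t') : ∃ t, t' = outer i f u k t ∧ A.Reach c t := by
  generalize hc' : Side.lift i c = c' at h
  induction h generalizing c with
  | @refl t' ht =>
    subst hc'
    have hu : c ≠ u := by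
      rintro rfl
      exact H.glue_u_ne ht
    exact ⟨c, (outer_of_ne _ _ hu _).symm, .refl ((H.free_lift hu).1 ht)⟩
  | step hc hr ih =>
    subst hc'
    by_cases hu : c = u
    · subst hu
      rw [H.rot_u] at hr
      exact ⟨c, by rw [hr.eq_of_free H.free_one, outer_self], .refl H.free_u⟩
    · obtain ⟨t, ht, hreach⟩ := ih (H.rot_lift hu).symm
      exact ⟨t, ht, .step (fun h => hc ((H.free_lift hu).2 h)) hreach⟩

theorem reach_iff (H : Half A C i f u k v) {c t : Side a} :
    C.Reach (Side.lift i c) (outer i f u k t) ↔ A.Reach c t := by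
  refine ⟨fun h => ?_, H.reach_lift⟩
  obtain ⟨t', ht', hreach⟩ := H.exists_of_reach h
  rwa [H.outer_injective ht']

theorem reach_f_iff (H : Half A C i f u k v) {t : Side n} :
    C.Reach (f, k) t ↔ C.Reach (Side.lift i u.next) t := by
  rw [← H.rot_f]
  exact ⟨fun h => h.of_not_free H.glue_f_ne, .step H.glue_f_ne⟩

theorem isChain_iff (H : Half A C i f u k v) {d : List (Side a)} (hd : u ∉ d) :
    (d ++ [u]).IsChain (fun s t => A.Reach s.next t) ↔
      ((d ++ [u]).map (outer i f u k)).IsChain (fun s t => C.Reach s.next t) := by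
  refine isChain_append_singleton_map_iff fun s hs t => ?_
  rw [outer_of_ne _ _ (ne_of_mem_of_not_mem hs hd), Side.lift_next, H.reach_iff]

theorem flat (H : Half A C i f u k v) (hC : C.Flat) : A.Flat := by
  intro c
  by_cases hc₀ : A.glue c = c
  · exact .inl hc₀
  by_cases hc₁ : A.glue (A.rot c) = A.rot c
  · exact .inr (.inl hc₁)
  by_cases hc₂ : A.glue (A.rot (A.rot c)) = A.rot (A.rot c)
  · exact .inr (.inr (.inl hc₂))
  have u₀ := H.ne_u hc₀
  have u₁ := H.ne_u hc₁
  have u₂ := H.ne_u hc₂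
  have h := hC (Side.lift i c)
  rw [FlatAt, H.rot_lift u₀, H.rot_lift u₁, H.rot_lift u₂, H.free_lift u₀, H.free_lift u₁,
    H.free_lift u₂] at h
  obtain ⟨hfree, hrot⟩ := ((h.resolve_left hc₀).resolve_left hc₁).resolve_left hc₂
  have u₃ : A.rot (A.rot (A.rot c)) ≠ u := by
    intro e
    rw [e, H.rot_u] at hrot
    exact H.lift_ne _ _ hrot.symm
  rw [H.rot_lift u₃] at hrot
  exact .inr (.inr (.inr ⟨fun h => hfree ((H.free_lift u₃).2 h), H.lift_injective hrot⟩))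

theorem flatAt_lift (H : Half A C i f u k v) (hA : A.Flat)
    (hstart : ∀ c : Side a, c.2 = u.2 + 2 → A.start c ≠ A.start u) (c : Side a) :
    C.FlatAt (Side.lift i c) := by
  by_cases u₀ : c = u
  · subst u₀
    refine .inr (.inl ?_)
    rw [H.rot_u, H.free_one]
  by_cases hc₀ : A.glue c = c
  · exact .inl ((H.free_lift u₀).2 hc₀)
  rw [FlatAt, H.rot_lift u₀]
  by_cases u₁ : A.rot c = u
  · refine .inr (.inr (.inl ?_))
    rw [u₁, H.rot_u, H.free_one]
  by_cases hc₁ : A.glue (A.rot c) = A.rot c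
  · exact .inr (.inl ((H.free_lift u₁).2 hc₁))
  rw [H.rot_lift u₁]
  have u₂ : A.rot (A.rot c) ≠ u := by
    intro e
    refine hstart c ?_ (by rw [← e, A.start_rot hc₁, A.start_rot hc₀])
    rw [← e, A.rot_snd hc₁, A.rot_snd hc₀, add_assoc, add_assoc]
    exact (add_zero _).symm
  by_cases hc₂ : A.glue (A.rot (A.rot c)) = A.rot (A.rot c)
  · exact .inr (.inr (.inl ((H.free_lift u₂).2 hc₂)))
  obtain ⟨hc₃, hrot⟩ := (((hA c).resolve_left hc₀).resolve_left hc₁).resolve_left hc₂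
  have u₃ := H.ne_u hc₃
  rw [H.rot_lift u₂, H.rot_lift u₃, hrot]
  exact .inr (.inr (.inr ⟨fun h => hc₃ ((H.free_lift u₃).1 h), rfl⟩))

theorem flatAt_f (H : Half A C i f u k v)
    (hstart : ∀ c : Side a, c.2 = u.2 + 3 → A.start c ≠ A.start u.next) : C.FlatAt (f, k) := by
  have hne : A.start u.next ≠ A.start u := by
    have hcorner : ∀ l : Fin 4, cornerOffset (l + 1) ≠ cornerOffset l := by decide
    exact fun h => hcorner u.2 (add_left_cancel h)
  have u₀ : u.next ≠ u := fun h => hne (by rw [h])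
  rw [FlatAt, H.rot_f]
  by_cases hc₀ : A.glue u.next = u.next
  · exact .inr (.inl ((H.free_lift u₀).2 hc₀))
  have u₁ : A.rot u.next ≠ u := fun h => hne (by rw [← A.start_rot hc₀, h])
  rw [H.rot_lift u₀]
  by_cases hc₁ : A.glue (A.rot u.next) = A.rot u.next
  · exact .inr (.inr (.inl ((H.free_lift u₁).2 hc₁)))
  refine absurd ?_ (hstart (A.rot (A.rot u.next)) ?_)
  · rw [A.start_rot hc₁, A.start_rot hc₀]
  · rw [A.rot_snd hc₁, A.rot_snd hc₀, Side.next_snd]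
    simp only [add_assoc]
    rfl

theorem connected (H : Half A C i f u k v) (hC : C.Connected) : A.Connected := by
  -- Collapsing `f` and what lies beyond it onto the square of `u` maps paths to paths.
  let π : Fin n → Fin a := Function.extend i id fun _ => u.1
  have hπ (x : Fin a) : π (i x) = x := H.inj.extend_apply id _ x
  have hπ' (g : Fin n) (hg : ¬ ∃ x, i x = g) : π g = u.1 := Function.extend_apply' _ _ g hg
  have hglue (s : Side a) : π (C.glue (Side.lift i s)).1 = (A.glue s).1 := by
    by_cases hs : s = u
    · rw [hs, H.glue_u, H.free_u, hπ' f fun ⟨x, hx⟩ => H.ne_f x hx]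
    · rw [H.glue s hs]
      exact hπ _
  have hadj_range (x : Fin a) (g : Fin n) : C.Adj (i x) g → A.Adj x (π g) := by
    rintro ⟨l, rfl⟩
    exact ⟨l, (hglue (x, l)).symm⟩
  have hadj (g g' : Fin n) (h : C.Adj g g') : Relation.ReflTransGen A.Adj (π g) (π g') := by
    by_cases hg : ∃ x, i x = g
    · obtain ⟨x, rfl⟩ := hg
      exact .single (by simpa only [hπ] using hadj_range x g' h)
    by_cases hg' : ∃ x, i x = g'
    · obtain ⟨x, rfl⟩ := hg'
      exact .single (by simpa only [hπ] using (hadj_range x g h.symm).symm)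
    · rw [hπ' g hg, hπ' g' hg']
  intro x y
  simpa only [Function.onFun, hπ] using (hC (i x) (i y)).lift' π hadj

theorem connected_to (H : Half A C i f u k v) (hA : A.Connected) (x : Fin a) :
    Relation.ReflTransGen C.Adj (i x) f := by
  have hadj (g g' : Fin a) : A.Adj g g' → Relation.ReflTransGen C.Adj (i g) (i g') := by
    rintro ⟨l, rfl⟩
    by_cases hu : (g, l) = u
    · rw [hu, H.free_u, ← hu]
    · exact .single ⟨l, congrArg Prod.fst (H.glue _ hu)⟩
  exact ((hA x u.1).lift' i hadj).tail ⟨u.2, congrArg Prod.fst H.glue_u⟩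

end Half

end SquareSurface

namespace SquareSurface

/-! ### Two surfaces joined by a square -/

/-- `C` consists of copies of `A` and `B`, attached below and above the square `f`. -/
structure Join {a b n : ℕ} (A : SquareSurface a) (B : SquareSurface b) (C : SquareSurface n)
    (i : Fin a → Fin n) (j : Fin b → Fin n) (f : Fin n) (u : Side a) (w : Side b) (v : Pt) :
    Prop where
  lower : Half A C i f u 0 0
  upper : Half B C j f w 2 v
  disjoint : ∀ x y, i x ≠ j y
  cover : ∀ g, (∃ x, g = i x) ∨ (∃ y, g = j y) ∨ g = f

namespace Join

variable {a b n : ℕ} {A : SquareSurface a} {B : SquareSurface b} {C : SquareSurface n}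
  {i : Fin a → Fin n} {j : Fin b → Fin n} {f : Fin n} {u : Side a} {w : Side b} {v : Pt}

theorem outer_ne (J : Join A B C i j f u w v) (s : Side a) (t : Side b) :
    outer i f u 0 s ≠ outer j f w 2 t := by
  by_cases hs : s = u <;> by_cases ht : t = w
  · rw [hs, ht, outer_self, outer_self]
    simp
  · rw [hs, outer_self, outer_of_ne _ _ ht]
    exact (J.upper.lift_ne _ _).symm
  · rw [ht, outer_self, outer_of_ne _ _ hs]
    exact J.lower.lift_ne _ _
  · rw [outer_of_ne _ _ hs, outer_of_ne _ _ ht]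
    exact fun h => J.disjoint _ _ (congrArg Prod.fst h)

theorem free_iff (J : Join A B C i j f u w v) (s : Side n) :
    C.glue s = s ↔ (∃ t, A.glue t = t ∧ outer i f u 0 t = s) ∨
      ∃ t, B.glue t = t ∧ outer j f w 2 t = s := by
  constructor
  · intro hs
    obtain ⟨g, l⟩ := s
    rcases J.cover g with ⟨x, rfl⟩ | ⟨y, rfl⟩ | rfl
    · have hu : (x, l) ≠ u := by rintro rfl; exact J.lower.glue_u_ne hs
      have e : outer i f u 0 (x, l) = (i x, l) := outer_of_ne _ _ hu _
      exact .inl ⟨(x, l), (J.lower.free_outer _).1 (by rwa [e]), e⟩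
    · have hu : (y, l) ≠ w := by rintro rfl; exact J.upper.glue_u_ne hs
      have e : outer j f w 2 (y, l) = (j y, l) := outer_of_ne _ _ hu _
      exact .inr ⟨(y, l), (J.upper.free_outer _).1 (by rwa [e]), e⟩
    · have h₀ := J.lower.glue_f_ne
      have h₂ := J.upper.glue_f_ne
      fin_cases l
      · exact absurd hs h₀
      · exact .inl ⟨u, J.lower.free_u, outer_self _ _ _ _⟩
      · exact absurd hs h₂
      · exact .inr ⟨w, J.upper.free_u, outer_self _ _ _ _⟩
  · rintro (⟨t, ht, rfl⟩ | ⟨t, ht, rfl⟩)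
    · exact (J.lower.free_outer t).2 ht
    · exact (J.upper.free_outer t).2 ht

theorem nodup_iff (J : Join A B C i j f u w v) (l : List (Side a)) (m : List (Side b)) :
    (l.map (outer i f u 0) ++ m.map (outer j f w 2)).Nodup ↔ l.Nodup ∧ m.Nodup := by
  rw [List.nodup_append, List.nodup_map_iff J.lower.outer_injective,
    List.nodup_map_iff J.upper.outer_injective]
  refine and_congr_right fun _ => and_iff_left ?_
  simp only [List.forall_mem_map]
  exact fun s _ t _ => J.outer_ne s t

theorem mem_iff_free_iff (J : Join A B C i j f u w v) (l : List (Side a)) (m : List (Side b)) :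
    (∀ s, s ∈ l.map (outer i f u 0) ++ m.map (outer j f w 2) ↔ C.glue s = s) ↔
      (∀ s, s ∈ l ↔ A.glue s = s) ∧ ∀ s, s ∈ m ↔ B.glue s = s := by
  constructor
  · intro h
    constructor <;> intro s
    · rw [← J.lower.free_outer, ← h]
      refine Iff.trans ?_ List.mem_append.symm
      rw [List.mem_map_of_injective J.lower.outer_injective, or_iff_left]
      intro hs
      obtain ⟨t, -, ht⟩ := List.mem_map.1 hs
      exact J.outer_ne _ _ ht.symm
    · rw [← J.upper.free_outer, ← h]
      refine Iff.trans ?_ List.mem_append.symm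
      rw [List.mem_map_of_injective J.upper.outer_injective, or_iff_right]
      intro hs
      obtain ⟨t, -, ht⟩ := List.mem_map.1 hs
      exact J.outer_ne _ _ ht
  · rintro ⟨hl, hm⟩ s
    simp only [J.free_iff, List.mem_append, List.mem_map, hl, hm]

theorem chain_iff (J : Join A B C i j f u w v) {d : List (Side a)} {e : List (Side b)}
    (hd : u ∉ d) (he : w ∉ e) :
    (((d ++ [u]).map (outer i f u 0) ++ (e ++ [w]).map (outer j f w 2) : List (Side n)) :
        Cycle (Side n)).Chain (fun s t => C.Reach s.next t) ↔
      ((d ++ [u] : List (Side a)) : Cycle (Side a)).Chain (fun s t => A.Reach s.next t) ∧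
      ((e ++ [w] : List (Side b)) : Cycle (Side b)).Chain (fun s t => B.Reach s.next t) := by
  obtain ⟨x, hx⟩ : ∃ x, x ∈ (d ++ [u]).head? := by cases d <;> simp
  obtain ⟨y, hy⟩ : ∃ y, y ∈ (e ++ [w]).head? := by cases e <;> simp
  have hreach_upper : C.Reach (Side.next (f, 1)) (outer j f w 2 y) ↔ B.Reach w.next y :=
    J.upper.reach_f_iff.trans J.upper.reach_iff
  have hreach_lower : C.Reach (Side.next (f, 3)) (outer i f u 0 x) ↔ A.Reach u.next x :=
    J.lower.reach_f_iff.trans J.lower.reach_iff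
  have hlast : ((d ++ [u]).map (outer i f u 0)).getLast? = some (f, 1) := by
    simp [outer_self]
  have hhead_lower : ((d ++ [u]).map (outer i f u 0)).head? = some (outer i f u 0 x) := by
    rw [List.head?_map, Option.mem_def.1 hx]
    rfl
  have hhead_upper : ((e ++ [w]).map (outer j f w 2)).head? = some (outer j f w 2 y) := by
    rw [List.head?_map, Option.mem_def.1 hy]
    rfl
  have hsplit : (d ++ [u]).map (outer i f u 0) ++ (e ++ [w]).map (outer j f w 2) =
      ((d ++ [u]).map (outer i f u 0) ++ e.map (outer j f w 2)) ++ [(f, 3)] := by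
    simp [outer_self]
  have hhead : ((((d ++ [u]).map (outer i f u 0) ++ e.map (outer j f w 2)) ++ [(f, 3)]).head?) =
      some (outer i f u 0 x) := by
    rw [List.append_assoc, List.head?_append, hhead_lower]
    rfl
  rw [chain_append_singleton_iff hx, chain_append_singleton_iff hy, J.lower.isChain_iff hd,
    J.upper.isChain_iff he, hsplit, chain_append_singleton_iff hhead, ← hsplit,
    List.isChain_append, hlast, hhead_upper, hreach_lower]
  simp only [Option.mem_def, Option.some.injEq, forall_eq', hreach_upper]
  tauto

theorem boundaryList_iff (J : Join A B C i j f u w v) (d : List (Side a)) (e : List (Side b)) :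
    C.BoundaryList ((d ++ [u]).map (outer i f u 0) ++ (e ++ [w]).map (outer j f w 2)) ↔
      A.BoundaryList (d ++ [u]) ∧ B.BoundaryList (e ++ [w]) := by
  have hchain (hd : (d ++ [u]).Nodup) (he : (e ++ [w]).Nodup) :=
    J.chain_iff (fun h => List.disjoint_of_nodup_append hd h (List.mem_singleton_self u))
      (fun h => List.disjoint_of_nodup_append he h (List.mem_singleton_self w))
  constructor
  · rintro ⟨hnodup, hmem, hC⟩
    obtain ⟨hd, he⟩ := (J.nodup_iff _ _).1 hnodup
    obtain ⟨hmemA, hmemB⟩ := (J.mem_iff_free_iff _ _).1 hmem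
    obtain ⟨hA, hB⟩ := (hchain hd he).1 hC
    exact ⟨⟨hd, hmemA, hA⟩, ⟨he, hmemB, hB⟩⟩
  · rintro ⟨⟨hd, hmemA, hA⟩, ⟨he, hmemB, hB⟩⟩
    exact ⟨(J.nodup_iff _ _).2 ⟨hd, he⟩, (J.mem_iff_free_iff _ _).2 ⟨hmemA, hmemB⟩,
      (hchain hd he).2 ⟨hA, hB⟩⟩

theorem map_start (J : Join A B C i j f u w v) (d : List (Side a)) (e : List (Side b)) :
    (d.map (outer i f u 0) ++ e.map (outer j f w 2)).map C.start =
      d.map A.start ++ (e.map B.start).map (· + v) := by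
  rw [List.map_append, List.map_map, List.map_map, List.map_map]
  congr 1
  · refine List.map_congr_left fun s _ => ?_
    simp [J.lower.start_outer]
  · exact List.map_congr_left fun s _ => J.upper.start_outer s

theorem flat (J : Join A B C i j f u w v) (hA : A.Flat) (hB : B.Flat)
    (a₁ : ∀ c : Side a, c.2 = u.2 + 2 → A.start c ≠ A.start u)
    (a₂ : ∀ c : Side a, c.2 = u.2 + 3 → A.start c ≠ A.start u.next)
    (b₁ : ∀ c : Side b, c.2 = w.2 + 2 → B.start c ≠ B.start w)
    (b₂ : ∀ c : Side b, c.2 = w.2 + 3 → B.start c ≠ B.start w.next) : C.Flat := by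
  rintro ⟨g, l⟩
  rcases J.cover g with ⟨x, rfl⟩ | ⟨y, rfl⟩ | rfl
  · exact J.lower.flatAt_lift hA a₁ (x, l)
  · exact J.upper.flatAt_lift hB b₁ (y, l)
  · have h₀ := J.lower.flatAt_f a₂
    have h₂ := J.upper.flatAt_f b₂
    fin_cases l
    · exact h₀
    · exact .inl J.lower.free_one
    · exact h₂
    · exact .inl J.lower.free_three

theorem connected (J : Join A B C i j f u w v) (hA : A.Connected) (hB : B.Connected) :
    C.Connected := by
  have hf (g : Fin n) : Relation.ReflTransGen C.Adj g f := by
    rcases J.cover g with ⟨x, rfl⟩ | ⟨y, rfl⟩ | rfl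
    · exact J.lower.connected_to hA x
    · exact J.upper.connected_to hB y
    · exact .refl
  have : Std.Symm C.Adj := ⟨fun _ _ => Adj.symm⟩
  exact fun g g' => (hf g).trans (symm (hf g'))

end Join

theorem half_attach {a n : ℕ} {A : SquareSurface a} {D : SquareSurface n} {v : Pt} {u : Side a}
    {f : Fin n} {k : Fin 4} (hu : A.glue u = u) (hr : D.glue (f, k) = (f, k))
    (hur : A.start u + v = D.start (Side.next (f, k))) (hru : A.start u.next + v = D.start (f, k))
    (h₁ : D.glue (f, k + 1) = (f, k + 1)) (h₃ : D.glue (f, k + 3) = (f, k + 3)) :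
    Half A (attach A D hu hr hur hru) (Fin.castAdd n) (Fin.natAdd a f) u k v where
  inj := Fin.castAdd_injective _ _
  ne_f _ := castAdd_ne_natAdd
  tile _ := attach_tile_left ..
  glue _ hs := attach_glue_left _ _ _ _ _ _ hs
  free_u := hu
  glue_u := attach_glue_attached ..
  free_one := (attach_glue_right (s := (f, k + 1)) _ _ _ _ _ _ (by simp)).trans (congrArg _ h₁)
  free_three := (attach_glue_right (s := (f, k + 3)) _ _ _ _ _ _ (by simp)).trans (congrArg _ h₃)

theorem Half.attach_opposite {a b n : ℕ} {A : SquareSurface a} {B : SquareSurface b}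
    {D : SquareSurface n} {i : Fin a → Fin n} {f : Fin n} {u : Side a} {w : Side b} {k : Fin 4}
    {v v' : Pt} (H : Half A D i f u k v) (hw : B.glue w = w)
    (hr : D.glue (f, k + 2) = (f, k + 2)) (hwr : B.start w + v' = D.start (Side.next (f, k + 2)))
    (hrw : B.start w.next + v' = D.start (f, k + 2)) :
    Half A (attach B D hw hr hwr hrw) (Fin.natAdd b ∘ i) (Fin.natAdd b f) u k v where
  inj := (Fin.natAdd_injective _ _).comp H.inj
  ne_f x h := H.ne_f x (Fin.natAdd_injective _ _ h)
  tile x := (attach_tile_right ..).trans (H.tile x)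
  glue s hs := (attach_glue_right _ _ _ _ _ _ (H.lift_ne _ _)).trans (congrArg _ (H.glue s hs))
  free_u := H.free_u
  glue_u := (attach_glue_right _ _ _ _ _ _ (H.lift_ne _ _)).trans (congrArg _ H.glue_u)
  free_one :=
    (attach_glue_right (s := (f, k + 1)) _ _ _ _ _ _ (by simp)).trans (congrArg _ H.free_one)
  free_three :=
    (attach_glue_right (s := (f, k + 3)) _ _ _ _ _ _ (by simp)).trans (congrArg _ H.free_three)

theorem exists_join {a b : ℕ} {A : SquareSurface a} {B : SquareSurface b} {u : Side a}
    {w : Side b} {v P : Pt} (hu : A.glue u = u) (hw : B.glue w = w)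
    (hu_start : A.start u + 0 = P + cornerOffset 1)
    (hu_next : A.start u.next + 0 = P + cornerOffset 0)
    (hw_start : B.start w + v = P + cornerOffset 3)
    (hw_next : B.start w.next + v = P + cornerOffset 2) :
    ∃ (C : SquareSurface (b + (a + 1))) (i : Fin a → Fin (b + (a + 1)))
      (j : Fin b → Fin (b + (a + 1))) (f : Fin (b + (a + 1))), Join A B C i j f u w v := by
  let lower := attach A (square P) (v := 0) (r := (0, 0)) hu rfl hu_start hu_next
  have hlower : Half A lower _ _ u 0 0 := half_attach hu rfl _ _ rfl rfl
  have hfree (k : Fin 4) (hk : k ≠ 0) :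
      lower.glue (Fin.natAdd a 0, k) = (Fin.natAdd a 0, k) :=
    attach_glue_right (s := ((0 : Fin 1), k)) _ _ _ _ _ _ (by simpa using hk)
  have htile : lower.tile (Fin.natAdd a 0) = P := attach_tile_right ..
  have hwr : B.start w + v = lower.start (Side.next (Fin.natAdd a 0, 2)) := by
    rw [hw_start, start, Side.next_fst, htile]
    rfl
  have hrw : B.start w.next + v = lower.start (Fin.natAdd a 0, 2) := by
    rw [hw_next, start, htile]
  refine ⟨_, _, _, _, hlower.attach_opposite hw (hfree 2 (by decide)) hwr hrw,
    half_attach hw _ hwr hrw (hfree 3 (by decide)) (hfree 1 (by decide)),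
    fun _ _ => castAdd_ne_natAdd.symm, fun g => ?_⟩
  refine Fin.addCases (fun y => .inr (.inl ⟨y, rfl⟩)) (Fin.addCases (fun x => .inl ⟨x, rfl⟩) ?_) g
  exact fun z => .inr (.inr (by rw [Subsingleton.elim z 0]))

theorem exists_half {n : ℕ} (C : SquareSurface n) (S : Set (Fin n)) {f : Fin n} {k : Fin 4}
    (v : Pt) (hf : f ∉ S) (hk : (C.glue (f, k)).1 ∈ S)
    (hS : ∀ s : Side n, s.1 ∈ S → (C.glue s).1 ∈ S ∨ C.glue s = (f, k))
    (h₁ : C.glue (f, k + 1) = (f, k + 1)) (h₃ : C.glue (f, k + 3) = (f, k + 3)) :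
    ∃ (a : ℕ) (A : SquareSurface a) (i : Fin a → Fin n) (u : Side a),
      Half A C i f u k v ∧ Set.range i = S := by
  classical
  let i : Fin (Fintype.card S) ↪ Fin n :=
    (Fintype.equivFin S).symm.toEmbedding.trans (Function.Embedding.subtype _)
  have hrange (g : Fin n) : g ∈ Set.range i ↔ g ∈ S := by
    refine ⟨fun ⟨x, hx⟩ => hx ▸ ((Fintype.equivFin S).symm x).2, fun hg => ?_⟩
    exact ⟨Fintype.equivFin S ⟨g, hg⟩, congrArg Subtype.val (Equiv.symm_apply_apply _ _)⟩
  obtain ⟨x, hx⟩ : ∃ x, i x = (C.glue (f, k)).1 := (hrange _).2 hk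
  have hu : Side.lift i (x, (C.glue (f, k)).2) = C.glue (f, k) := Prod.ext hx rfl
  refine ⟨_, (C.restrict i).translate (-v), i, (x, (C.glue (f, k)).2), ⟨i.injective, ?_, ?_, ?_, ?_,
    ?_, h₁, h₃⟩, Set.ext hrange⟩
  · rintro y rfl
    exact hf ((hrange _).1 ⟨y, rfl⟩)
  · exact fun y => (neg_add_cancel_right _ _).symm
  · intro s hs
    obtain ⟨y, hy⟩ : (C.glue (Side.lift i s)).1 ∈ Set.range i := by
      rw [hrange]
      refine (hS _ ((hrange _).1 ⟨s.1, rfl⟩)).resolve_right fun h => hs ?_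
      refine Side.lift_injective i.injective ?_
      rw [hu, ← h, C.glue_glue]
    have ht : C.glue (Side.lift i s) = Side.lift i (y, (C.glue (Side.lift i s)).2) :=
      Prod.ext hy.symm rfl
    exact ht.trans (congrArg _ (restrict_glue_of_eq ht).symm)
  · refine restrict_glue_of_notMem ?_
    rw [hu, C.glue_glue, hrange]
    exact hf
  · rw [hu, C.glue_glue]

end SquareSurface

/-! ### Disks joined by a square -/

theorem exists_succ_of_isChain {α : Type*} {r : α → α → Prop} {d : List α} {v : α}
    (h : (d ++ [v]).IsChain r) {s : α} (hs : s ∈ d) : ∃ t ∈ d ++ [v], r s t := by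
  obtain ⟨l, m, rfl⟩ := List.append_of_mem hs
  obtain ⟨t, m', hm⟩ : ∃ t m', m ++ [v] = t :: m' := List.exists_cons_of_ne_nil (by simp)
  rw [List.append_assoc, List.cons_append, hm] at h ⊢
  exact ⟨t, by simp, (List.isChain_cons_cons.1 h.right_of_append).1⟩

/-- The closed path with successive points `root` lies on the far side of the line containing the
side `k` of the tile at `P`, and its last edge is this side, with the tile on the right. -/
structure AbutsTile (k : Fin 4) (P : Pt) (root : List Pt) : Prop where
  head : root.head? = some (P + cornerOffset k)
  last : root.getLast? = some (P + cornerOffset (k + 1))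
  le : ∀ Q ∈ root, height k (P + cornerOffset k) ≤ height k Q

namespace SquareSurface

section

variable {p : ℕ} {D : SquareSurface p} {d : List (Side p)} {u : Side p}

theorem adj_start (s : Side p) : SOPoly.Adj (D.start s) (D.start s.next) := by
  have hoffset : ∀ k, SOPoly.Adj (cornerOffset k) (cornerOffset (k + 1)) := by
    unfold SOPoly.Adj
    decide
  simpa [SOPoly.Adj, start] using hoffset s.2

theorem start_next_ne (s : Side p) : D.start s.next ≠ D.start s := by
  have hoffset : ∀ k, cornerOffset (k + 1) ≠ cornerOffset k := by decide
  exact fun h => hoffset s.2 (add_left_cancel h)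

theorem IsDisk.isClosedPath (hD : D.IsDisk) {b : List (Side p)} (h : D.BoundaryList b) :
    IsClosedPath (b.map D.start : List Pt) where
  chain := by
    have hchain := chain_iff_getElem.1 h.chain
    refine chain_iff_getElem.2 fun i hi => ?_
    simp only [List.length_map] at hi
    simp only [List.getElem_map, List.length_map, ← (hchain i hi).start_eq]
    exact adj_start _
  no_uturn P Q l e := by
    obtain ⟨k, hk⟩ := Cycle.coe_eq_coe.1 e.symm
    rw [← List.map_rotate] at hk
    have h := h.rotate k
    generalize b.rotate k = b' at hk h
    obtain _ | ⟨s, _ | ⟨t, b'⟩⟩ := b'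
    · simp at hk
    · simp at hk
    simp only [List.map_cons, List.cons.injEq] at hk
    obtain ⟨rfl, rfl, rfl⟩ := hk
    have hs : D.glue s = s := (h.mem_iff s).1 (by simp)
    have hchain := h.chain
    rw [Cycle.chain_coe_cons] at hchain
    simp only [List.cons_append, List.isChain_cons_cons] at hchain
    obtain ⟨hst, hchain⟩ := hchain
    have hne : D.start t.next ≠ D.start s := fun e =>
      hD.flat.snd_ne_add_two hs hst (eq_add_normal_of_add_cornerOffset_eq hst.start_eq.symm e).1
    obtain _ | ⟨c, b'⟩ := b'
    · exact absurd (List.isChain_cons_cons.1 hchain).1.start_eq hne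
    · exact ⟨D.start c, b'.map D.start, rfl,
        (List.isChain_cons_cons.1 hchain).1.start_eq ▸ hne⟩

theorem BoundaryList.exists_head_last (h : D.BoundaryList (d ++ [u])) :
    ∃ x y, d.head? = some x ∧ d.getLast? = some y ∧ D.Reach u.next x ∧ D.Reach y.next u := by
  obtain _ | ⟨x, d⟩ := d
  · exact absurd (h.start_next_last rfl) (start_next_ne u)
  · obtain ⟨hpath, hux⟩ := (chain_append_singleton_iff rfl).1 h.chain
    have hy := List.getLast?_eq_some_getLast (List.cons_ne_nil x d)
    exact ⟨x, _, rfl, hy, hux, (List.isChain_append.1 hpath).2.2 _ hy _ rfl⟩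

theorem IsDisk.pathSum_turn (hD : D.IsDisk) (h : D.BoundaryList (d ++ [u])) (hu : D.Extremal u) :
    pathSum turn ((u.2 + 1) :: (d.map Prod.snd ++ [u.2 + 3])) = 2 := by
  obtain ⟨x, y, hx, hy, hux, hyu⟩ := h.exists_head_last
  have hfree : ∀ s ∈ d ++ [u], D.glue s = s := fun s => (h.mem_iff s).1
  have x₂ : x.2 ≠ u.2 + 2 := hD.flat.snd_ne_add_two (hfree u (by simp)) hux
  have y₂ : u.2 ≠ y.2 + 2 :=
    hD.flat.snd_ne_add_two (hfree y (by simp [List.mem_of_getLast? hy])) hyu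
  have hdir : ∀ k : Fin 4, k + 3 ≠ k ∧ k + 3 ≠ k + 1 ∧ k + 2 ≠ k ∧ k + 2 ≠ k + 1 := by decide
  have x₃ : x.2 ≠ u.2 + 3 := fun e => by
    refine (hu.height_start_lt (s := x) (e ▸ (hdir _).1) (e ▸ (hdir _).2.1)).ne ?_
    rw [← hux.start_eq, height_start_next]
  have y₁ : y.2 + 1 ≠ u.2 + 2 := fun e => by
    refine (hu.height_start_lt (s := y.next) ?_ ?_).ne (congrArg _ hyu.start_eq) <;>
      rw [Side.next_snd, e]
    exacts [(hdir _).2.2.1, (hdir _).2.2.2]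
  -- Bypassing an extremal edge by the sides of a tile costs a quarter turn at both of its ends.
  have hturn : ∀ k x y : Fin 4, x ≠ k + 2 → x ≠ k + 3 → k ≠ y + 2 → y + 1 ≠ k + 2 →
      turn (k + 1) x + turn y (k + 3) = turn k x + turn y k - 2 := by decide
  have htotal := hD.cycSum_turn h
  have hx' : (d.map Prod.snd).head? = some x.2 := by simp [hx]
  have hy' : (d.map Prod.snd).getLast? = some y.2 := by simp [hy]
  rw [List.map_append, List.map_singleton, cycSum_append_singleton,
    pathSum_cons_append_singleton _ hx' hy'] at htotal
  rw [pathSum_cons_append_singleton _ hx' hy']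
  linarith [hturn u.2 x.2 y.2 x₂ x₃ y₂ y₁]

section AbutsTile

variable {k : Fin 4} {P v : Pt}

theorem BoundaryList.start_of_abutsTile (h : D.BoundaryList (d ++ [u]))
    (G : AbutsTile k P (((d ++ [u]).map D.start).map (· + v))) :
    D.start u + v = P + cornerOffset (k + 1) ∧ D.start u.next + v = P + cornerOffset k := by
  have hlast := G.last
  have hhead := G.head
  obtain ⟨x, hx⟩ : ∃ x, (d ++ [u]).head? = some x := by cases d <;> simp
  rw [h.start_next_last hx]
  simp only [List.getLast?_map, List.getLast?_concat, List.head?_map, hx, Option.map_some,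
    Option.some.injEq] at hlast hhead
  exact ⟨hlast, hhead⟩

theorem BoundaryList.extremal_of_abutsTile (h : D.BoundaryList (d ++ [u]))
    (G : AbutsTile k P (((d ++ [u]).map D.start).map (· + v))) : D.Extremal u := by
  obtain ⟨hstart, hnext⟩ := h.start_of_abutsTile G
  have hside : height k (cornerOffset (k + 1)) = height k (cornerOffset k) := by
    simp [height_cornerOffset k (k + 1)]
  have hstart := congrArg (height k) hstart
  have hnext := congrArg (height k) hnext
  simp only [height_add, hside] at hstart hnext
  refine (snd_eq_and_extremal_of_height (k := k + 2) ?_ fun s hs => ?_).2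
  · simp only [height_add_two]
    linarith
  · have hle := G.le _ (List.mem_map_of_mem (List.mem_map_of_mem ((h.mem_iff s).2 hs)))
    simp only [height_add] at hle
    simp only [height_add_two]
    linarith

end AbutsTile

end

section Join

variable {a b n : ℕ} {A : SquareSurface a} {B : SquareSurface b} {C : SquareSurface n}
  {i : Fin a → Fin n} {j : Fin b → Fin n} {f : Fin n} {u : Side a} {w : Side b} {v : Pt}

theorem Extremal.start_ne (h : A.Extremal u) {c : Side a} (hc : c.2 = u.2 + 2 ∨ c.2 = u.2 + 3) :
    A.start c ≠ A.start u ∧ A.start c ≠ A.start u.next := by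
  have hdir : ∀ l k : Fin 4, (l = k + 2 ∨ l = k + 3) → l ≠ k ∧ l ≠ k + 1 := by decide
  obtain ⟨h₀, h₁⟩ := hdir _ _ hc
  have hlt := h.height_start_lt h₀ h₁
  exact ⟨fun e => hlt.ne (congrArg _ e),
    fun e => hlt.ne ((congrArg _ e).trans (height_start_next u))⟩

theorem map_snd_outer {d : List (Side a)} (hd : u ∉ d) (i : Fin a → Fin n) (f : Fin n)
    (k : Fin 4) :
    ((d ++ [u]).map (outer i f u k)).map Prod.snd = d.map Prod.snd ++ [k + 1] := by
  simp only [List.map_append, List.map_singleton, outer_self, List.map_map]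
  refine congrArg (· ++ _) (List.map_congr_left fun s hs => ?_)
  rw [Function.comp_apply, outer_of_ne i f (ne_of_mem_of_not_mem hs hd)]
  rfl

theorem Join.isDisk (J : Join A B C i j f u w v) (hA : A.IsDisk) (hB : B.IsDisk)
    (hu : A.Extremal u) (hw : B.Extremal w) {d : List (Side a)} {e : List (Side b)}
    (bA : A.BoundaryList (d ++ [u])) (bB : B.BoundaryList (e ++ [w])) : C.IsDisk := by
  have bC := (J.boundaryList_iff d e).2 ⟨bA, bB⟩
  have hflat : C.Flat := J.flat hA.flat hB.flat
    (fun _ hc => (hu.start_ne (.inl hc)).1) (fun _ hc => (hu.start_ne (.inr hc)).2)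
    (fun _ hc => (hw.start_ne (.inl hc)).1) (fun _ hc => (hw.start_ne (.inr hc)).2)
  refine (isDisk_iff bC).2 ⟨Fin.pos f, J.connected hA.connected hB.connected, hflat, ?_⟩
  have hud : u ∉ d := fun h => List.disjoint_of_nodup_append bA.nodup h (by simp)
  have hwe : w ∉ e := fun h => List.disjoint_of_nodup_append bB.nodup h (by simp)
  have hlower := hA.pathSum_turn bA hu
  have hupper := hB.pathSum_turn bB hw
  rw [J.lower.u_snd] at hlower
  rw [J.upper.u_snd] at hupper
  have htotal : cycSum turn (((d ++ [u]).map (outer i f u 0) ++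
      (e ++ [w]).map (outer j f w 2)).map Prod.snd) = 2 + 2 :=
    calc _ = cycSum turn ((d.map Prod.snd ++ 1 :: e.map Prod.snd) ++ [3]) := by
          rw [List.map_append, map_snd_outer hud, map_snd_outer hwe]
          simp only [List.append_assoc, List.cons_append, List.nil_append]
          rfl
      _ = pathSum turn (3 :: (d.map Prod.snd ++ [1])) +
          pathSum turn (1 :: (e.map Prod.snd ++ [3])) := by
          rw [cycSum_append_singleton, List.append_assoc, List.cons_append, ← List.cons_append,
            pathSum_append_cons]
          rfl
      _ = 2 + 2 := congrArg₂ _ hlower hupper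
  linarith [hflat.four_mul_euler_eq_turn bC]

end Join

end SquareSurface

/-! ### Cutting a disk along a square -/

/-- The position of two paths before they are glued: `root₁` lies below the tile at `P`, the
translate of `root₂` by `v` above, and the sides of this tile are the last edges of both paths. -/
structure Gap (root₁ root₂ : List Pt) (P v : Pt) : Prop where
  lower : AbutsTile 0 P root₁
  upper : AbutsTile 2 P (root₂.map (· + v))

namespace SquareSurface

/-- The boundary of `C` consists of a path `d ++ [r]` beyond the side `k` of the tile at `P` and of
a path `d' ++ [t]` beyond the opposite side, where `r` and `t` are the edges that connect them. -/
structure GapBoundary {n : ℕ} (C : SquareSurface n) (k : Fin 4) (P : Pt) (d : List (Side n))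
    (r : Side n) (d' : List (Side n)) (t : Side n) : Prop where
  boundaryList : C.BoundaryList (d ++ [r] ++ (d' ++ [t]))
  abuts : AbutsTile k P ((d ++ [r]).map C.start)
  abuts_opposite : AbutsTile (k + 2) P ((d' ++ [t]).map C.start)

namespace GapBoundary

variable {n : ℕ} {C : SquareSurface n} {k : Fin 4} {P : Pt} {d d' : List (Side n)} {r t : Side n}

theorem swap (G : GapBoundary C k P d r d' t) : GapBoundary C (k + 2) P d' t d r where
  boundaryList := by
    simpa only [List.rotate_append_length_eq] using G.boundaryList.rotate (d ++ [r]).length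
  abuts := G.abuts_opposite
  abuts_opposite := by
    have htwo : ∀ k : Fin 4, k + 2 + 2 = k := by decide
    exact (htwo k).symm ▸ G.abuts

theorem free (G : GapBoundary C k P d r d' t) {s : Side n} (hs : s ∈ d ++ [r]) : C.glue s = s :=
  (G.boundaryList.mem_iff s).1 (List.mem_append_left _ hs)

theorem free_last (G : GapBoundary C k P d r d' t) : C.glue r = r := G.free (by simp)

theorem exists_head (G : GapBoundary C k P d r d' t) :
    ∃ x, (d ++ [r]).head? = some x ∧ (d ++ [r]).IsChain (fun s s' => C.Reach s.next s') ∧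
      C.Reach t.next x := by
  obtain ⟨x, hx⟩ : ∃ x, (d ++ [r]).head? = some x := by cases d <;> simp
  have hchain := G.boundaryList.chain
  have hhead : (d ++ [r] ++ d' ++ [t]).head? = some x := by
    rw [List.append_assoc, List.head?_append, hx, Option.some_or]
  rw [← List.append_assoc, chain_append_singleton_iff hhead] at hchain
  exact ⟨x, hx, hchain.1.left_of_append.left_of_append, hchain.2⟩

theorem start_next_last (G : GapBoundary C k P d r d' t) :
    C.start t.next = P + cornerOffset k := by
  obtain ⟨x, hx, -, htx⟩ := G.exists_head
  have hhead := G.abuts.head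
  rw [List.head?_map, hx, Option.map_some, Option.some.injEq] at hhead
  rw [htx.start_eq, hhead]

theorem last_eq (G : GapBoundary C k P d r d' t) : r.2 = k + 1 ∧ C.tile r.1 = P := by
  have hlast := G.abuts.last
  rw [List.getLast?_map, List.getLast?_concat, Option.map_some, Option.some.injEq] at hlast
  refine eq_of_add_cornerOffset_eq hlast (G.swap.start_next_last.trans ?_)
  have htwo : ∀ k : Fin 4, k + 2 = k + 1 + 1 := by decide
  rw [htwo]

theorem height_lt_or (G : GapBoundary C k P d r d' t) {s : Side n} (hs : s ∈ d) :
    height k P < height k (C.tile s.1) ∨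
      height k (C.tile s.1) = height k P ∧ s.2 = k := by
  obtain ⟨x, -, hchain, -⟩ := G.exists_head
  obtain ⟨s', hs', hreach⟩ := exists_succ_of_isChain hchain hs
  have hstart := G.abuts.le _ (List.mem_map_of_mem (List.mem_append_left _ hs))
  have hnext := G.abuts.le _ (List.mem_map_of_mem hs')
  have hdir : ∀ k l : Fin 4, (l = k ∨ l = k + 1) → (l + 1 = k ∨ l + 1 = k + 1) → l = k := by decide
  rw [height_add, height_start] at hstart
  rw [← hreach.start_eq, height_add, height_start, Side.next_fst, Side.next_snd] at hnext
  rcases lt_or_ge (height k P) (height k (C.tile s.1)) with hlt | hle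
  · exact .inl hlt
  · split_ifs at hstart hnext with h₀ h₁
    · exact .inr ⟨by linarith, hdir _ _ h₀ h₁⟩
    all_goals linarith

theorem eq_last (G : GapBoundary C k P d r d' t) {s : Side n} (hs : C.glue s = s)
    (hrow : height k (C.tile s.1) = height k P) (hdir : s.2 = k + 1) : s = r := by
  have hne : ∀ k : Fin 4, k + 1 ≠ k ∧ k + 1 ≠ k + 2 ∧ k + 1 ≠ k + 2 + 1 := by decide
  have hmem := (G.boundaryList.mem_iff s).2 hs
  simp only [List.mem_append, List.mem_singleton] at hmem
  rcases hmem with (hd | hr) | hd' | rfl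
  · rcases G.height_lt_or hd with hlt | ⟨-, h⟩
    · exact absurd hrow hlt.ne'
    · exact absurd (hdir.symm.trans h) (hne k).1
  · exact hr
  · rcases G.swap.height_lt_or hd' with hlt | ⟨-, h⟩
    · rw [height_add_two, height_add_two, hrow] at hlt
      exact absurd hlt (lt_irrefl _)
    · exact absurd (hdir.symm.trans h) (hne k).2.1
  · exact absurd (hdir.symm.trans G.swap.last_eq.1) (hne k).2.2

theorem height_add_one_le (G : GapBoundary C k P d r d' t) {g : Fin n}
    (hg : height k (C.tile g) = height k P) :
    height (k + 1) (C.tile g) ≤ height (k + 1) P := by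
  have hperp : ∀ k, height k (normal (k + 1)) = 0 := height_normal_add_one
  obtain ⟨g', hg', hfree, hmax⟩ := C.exists_free_of_height_maximal (k + 1)
    (fun g => height k (C.tile g) = height k P)
    (fun g hg hne => by rw [(glue_snd_and_tile _ hne).2, height_add, hperp, hg, add_zero]) hg
  have hr := G.eq_last hfree hg' rfl
  have htile := G.last_eq.2
  rw [← hr] at htile
  exact htile ▸ hmax g hg

theorem tile_eq (G : GapBoundary C k P d r d' t) {g : Fin n}
    (hg : height k (C.tile g) = height k P) : C.tile g = P := by
  refine eq_of_height_eq hg (le_antisymm (G.height_add_one_le hg) ?_)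
  have hle := G.swap.height_add_one_le (g := g) (by rw [height_add_two, height_add_two, hg])
  rw [add_right_comm, height_add_two, height_add_two] at hle
  linarith

theorem last_eq_of_height_eq (G : GapBoundary C k P d r d' t) {g : Fin n}
    (hg : height k (C.tile g) = height k P) : r = (g, k + 1) := by
  refine (G.eq_last ?_ hg rfl).symm
  by_contra hne
  have htile := (glue_snd_and_tile _ hne).2
  have hle := G.height_add_one_le (g := (C.glue (g, k + 1)).1)
    (by rw [htile, height_add, height_normal_add_one, hg, add_zero])
  rw [htile, height_add, height_normal_self, G.tile_eq hg] at hle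
  linarith

theorem eq_fst_last (G : GapBoundary C k P d r d' t) {g : Fin n}
    (hg : height k (C.tile g) = height k P) : g = r.1 := by
  rw [G.last_eq_of_height_eq hg]

theorem last_eq_mk (G : GapBoundary C k P d r d' t) : r = (r.1, k + 1) :=
  Prod.ext rfl G.last_eq.1

theorem opposite_last_eq_mk (G : GapBoundary C k P d r d' t) : t = (r.1, k + 3) := by
  have hthree : ∀ k : Fin 4, k + 2 + 1 = k + 3 := by decide
  rw [← hthree]
  exact G.swap.last_eq_of_height_eq (congrArg _ G.last_eq.2)

theorem glue_ne (G : GapBoundary C k P d r d' t) (hlength : 3 ≤ (d ++ [r]).length) :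
    C.glue (r.1, k) ≠ (r.1, k) := by
  intro hfree
  obtain ⟨x, hx, hchain, htx⟩ := G.exists_head
  have hfour : ∀ k : Fin 4, k + 3 + 1 = k := by decide
  have ht : t.next = (r.1, k) := by rw [G.opposite_last_eq_mk, Side.next, hfour]
  obtain rfl : x = (r.1, k) := Reach.eq_of_free (ht ▸ htx) hfree
  have hnodup := G.boundaryList.nodup.of_append_left
  obtain _ | ⟨y, _ | ⟨z, d⟩⟩ := d
  · simp at hlength
  · simp at hlength
  · obtain rfl : y = (r.1, k) := by simpa using hx
    obtain rfl : z = r := by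
      refine Reach.eq_of_free (D := C) (c := r) ?_ G.free_last
      rw [G.last_eq_mk]
      exact (List.isChain_cons_cons.1 hchain).1
    simp at hnodup

theorem mem_or_glue_eq (G : GapBoundary C k P d r d' t) {s : Side n}
    (hs : height k P < height k (C.tile s.1)) :
    height k P < height k (C.tile (C.glue s).1) ∨ C.glue s = (r.1, k) := by
  by_cases hfree : C.glue s = s
  · exact .inl (hfree.symm ▸ hs)
  obtain ⟨hdir, htile⟩ := glue_snd_and_tile _ hfree
  refine or_iff_not_imp_left.2 fun hle => ?_
  rw [htile, height_add] at hle
  have hback : s.2 = k + 2 := eq_add_two_of_height_normal_lt (by linarith)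
  have hnormal := neg_one_le_height_normal k s.2
  have hfour : ∀ k : Fin 4, k + 2 + 2 = k := by decide
  refine Prod.ext (G.eq_fst_last ?_) (by rw [hdir, hback, hfour])
  rw [htile, height_add]
  linarith

theorem exists_half (G : GapBoundary C k P d r d' t) (hlength : 3 ≤ (d ++ [r]).length) (v : Pt) :
    ∃ (a : ℕ) (A : SquareSurface a) (i : Fin a → Fin n) (u : Side a) (e : List (Side a)),
      Half A C i r.1 u k v ∧ Set.range i = {g | height k P < height k (C.tile g)} ∧
        (e ++ [u]).map (outer i r.1 u k) = d ++ [r] := by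
  have hne := G.glue_ne hlength
  obtain ⟨a, A, i, u, H, hrange⟩ := SquareSurface.exists_half C
    {g | height k P < height k (C.tile g)} v (f := r.1) (k := k)
    (by simp [G.last_eq.2])
    (by
      rw [Set.mem_ofPred_eq, (glue_snd_and_tile _ hne).2, height_add, G.last_eq.2,
        height_normal_self]
      exact lt_add_one _)
    (fun s => G.mem_or_glue_eq) (G.last_eq_mk ▸ G.free_last)
    (G.opposite_last_eq_mk ▸ G.swap.free_last)
  have hd : ∀ s ∈ d, s ∈ Set.range (outer i r.1 u k) := by
    intro s hs
    have hfree := G.free (List.mem_append_left _ hs)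
    obtain ⟨x, hx⟩ : s.1 ∈ Set.range i := by
      rw [hrange]
      refine (G.height_lt_or hs).resolve_right fun ⟨hrow, hdir⟩ => hne ?_
      rw [← G.eq_fst_last hrow, ← hdir]
      exact hfree
    have hlift : Side.lift i (x, s.2) = s := Prod.ext hx rfl
    refine ⟨(x, s.2), (outer_of_ne i _ ?_ k).trans hlift⟩
    rintro rfl
    exact H.glue_u_ne (hlift.symm ▸ hfree)
  obtain ⟨e, rfl⟩ : d ∈ Set.range (List.map (outer i r.1 u k)) := by
    rwa [Set.range_list_map]
  refine ⟨a, A, i, u, e, H, hrange, ?_⟩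
  rw [List.map_append, List.map_singleton, outer_self, ← G.last_eq_mk]

end GapBoundary

theorem exists_cut {n : ℕ} {C : SquareSurface n} {root₁ root₂ : List Pt} {P v : Pt}
    (G : Gap root₁ root₂ P v) (h₁ : 3 ≤ root₁.length) (h₂ : 3 ≤ root₂.length)
    {b : List (Side n)} (hb : C.BoundaryList b)
    (hroot : b.map C.start = root₁ ++ root₂.map (· + v)) :
    ∃ (a : ℕ) (A : SquareSurface a) (m : ℕ) (B : SquareSurface m) (i : Fin a → Fin n)
      (j : Fin m → Fin n) (f : Fin n) (u : Side a) (w : Side m) (d : List (Side a))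
      (e : List (Side m)), Join A B C i j f u w v ∧ A.BoundaryList (d ++ [u]) ∧
        (d ++ [u]).map A.start = root₁ ∧ B.BoundaryList (e ++ [w]) ∧
        (e ++ [w]).map B.start = root₂ := by
  obtain ⟨b₁, b₂, rfl, hb₁, hb₂⟩ := List.map_eq_append_iff.1 hroot
  have hlength₁ := congrArg List.length hb₁
  have hlength₂ := congrArg List.length hb₂
  rw [List.length_map] at hlength₁
  rw [List.length_map, List.length_map] at hlength₂
  obtain ⟨d₁, r, rfl⟩ := (List.eq_nil_or_concat' b₁).resolve_left
    (List.length_pos_iff.1 (by lia))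
  obtain ⟨d₂, t, rfl⟩ := (List.eq_nil_or_concat' b₂).resolve_left
    (List.length_pos_iff.1 (by lia))
  have K : GapBoundary C 0 P d₁ r d₂ t := ⟨hb, hb₁.symm ▸ G.lower, hb₂.symm ▸ G.upper⟩
  obtain ⟨a, A, i, u, d, HA, hi, hd⟩ := K.exists_half (hlength₁ ▸ h₁) 0
  obtain ⟨m, B, j, w, e, HB, hj, he⟩ := K.swap.exists_half (hlength₂ ▸ h₂) v
  rw [← K.swap.eq_fst_last (congrArg _ K.last_eq.2), zero_add] at HB he
  have hlower (g : Fin n) : g ∈ Set.range i ↔ height 0 P < height 0 (C.tile g) := by rw [hi]; rfl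
  have hupper (g : Fin n) : g ∈ Set.range j ↔ height 0 (C.tile g) < height 0 P := by
    rw [hj, Set.mem_ofPred_eq, height_add_two, height_add_two, neg_lt_neg_iff]
  have J : Join A B C i j r.1 u w v := by
    refine ⟨HA, HB, fun x y hxy => ?_, fun g => ?_⟩
    · exact lt_asymm ((hlower _).1 ⟨x, rfl⟩) ((hupper _).1 ⟨y, hxy.symm⟩)
    · rcases lt_trichotomy (height 0 P) (height 0 (C.tile g)) with h | h | h
      · exact .inl (((hlower g).2 h).imp fun _ => Eq.symm)
      · exact .inr (.inr (K.eq_fst_last h.symm))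
      · exact .inr (.inl (((hupper g).2 h).imp fun _ => Eq.symm))
  rw [← hd, ← he] at hb hroot
  obtain ⟨bA, bB⟩ := (J.boundaryList_iff d e).1 hb
  rw [J.map_start] at hroot
  have hlength : ((d ++ [u]).map A.start).length = root₁.length := by
    rw [← hlength₁, ← hd, List.length_map, List.length_map]
  obtain ⟨hA, hB⟩ := List.append_inj hroot hlength
  exact ⟨a, A, m, B, i, j, r.1, u, w, d, e, J, bA, hA, bB,
    List.map_injective_iff.2 (add_left_injective v) hB⟩

end SquareSurface

/-! ### Renumbering the squares -/

namespace SquareSurface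

/-- `e` is a renumbering of the squares that turns `D` into `D'`. -/
structure IsIso {p q : ℕ} (D : SquareSurface p) (D' : SquareSurface q) (e : Fin p ≃ Fin q) :
    Prop where
  tile : ∀ f, D'.tile (e f) = D.tile f
  glue : ∀ s, D'.glue (Side.lift e s) = Side.lift e (D.glue s)

section IsIso

variable {p q : ℕ} {D : SquareSurface p} {D' : SquareSurface q} {e : Fin p ≃ Fin q}

theorem IsIso.free_iff (h : IsIso D D' e) (s : Side p) :
    D'.glue (Side.lift e s) = Side.lift e s ↔ D.glue s = s := by
  rw [h.glue, (Side.lift_injective e.injective).eq_iff]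

theorem IsIso.reach (h : IsIso D D' e) {c t : Side p} (hr : D.Reach c t) :
    D'.Reach (Side.lift e c) (Side.lift e t) := by
  induction hr with
  | refl ht => exact .refl ((h.free_iff _).2 ht)
  | step hc _ ih =>
    refine .step (fun h' => hc ((h.free_iff _).1 h')) ?_
    rwa [rot, h.glue]

theorem IsIso.boundaryList (h : IsIso D D' e) {b : List (Side p)} (hb : D.BoundaryList b) :
    D'.BoundaryList (b.map (Side.lift e)) where
  nodup := hb.nodup.map (Side.lift_injective e.injective)
  mem_iff s := by
    obtain ⟨t, rfl⟩ : ∃ t, Side.lift e t = s :=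
      ⟨(e.symm s.1, s.2), Prod.ext (e.apply_symm_apply _) rfl⟩
    rw [List.mem_map_of_injective (Side.lift_injective e.injective), h.free_iff, hb.mem_iff]
  chain := (Cycle.chain_map (s := b) (Side.lift e)).2 (hb.chain.imp fun _ _ => h.reach)

theorem IsIso.start (h : IsIso D D' e) (s : Side p) : D'.start (Side.lift e s) = D.start s := by
  rw [SquareSurface.start, SquareSurface.start, ← h.tile]
  rfl

theorem IsIso.lift_last (h : IsIso D D' e) (hD' : D'.IsDisk) {d : List (Side p)} {u : Side p}
    {d' : List (Side q)} {u' : Side q} (b : D.BoundaryList (d ++ [u]))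
    (b' : D'.BoundaryList (d' ++ [u'])) (hs : (d ++ [u]).map D.start = (d' ++ [u']).map D'.start) :
    Side.lift e u = u' := by
  have hmap : ((d ++ [u]).map (Side.lift e)).map D'.start = (d' ++ [u']).map D'.start := by
    rw [← hs, List.map_map]
    exact List.map_congr_left fun s _ => h.start s
  simpa using congrArg List.getLast? (hD'.boundaryList_unique b' (h.boundaryList b) hmap)

end IsIso

section Half

variable {a n a' n' : ℕ} {A : SquareSurface a} {C : SquareSurface n} {A' : SquareSurface a'}
  {C' : SquareSurface n'} {i : Fin a → Fin n} {i' : Fin a' → Fin n'} {f : Fin n} {f' : Fin n'}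
  {u : Side a} {u' : Side a'} {k : Fin 4} {v : Pt}

theorem Half.exists_isIso (H : Half A C i f u k v) (H' : Half A' C' i' f' u' k v)
    {e : Fin n ≃ Fin n'} (h : IsIso C C' e) (hf : e f = f')
    (hr : ∀ g, g ∈ Set.range i ↔ e g ∈ Set.range i') : ∃ e', IsIso A A' e' := by
  choose φ hφ using fun x => (hr (i x)).1 ⟨x, rfl⟩
  have hbij : Function.Bijective φ := by
    refine ⟨fun x y hxy => H.inj (e.injective ?_), fun y => ?_⟩
    · rw [← hφ, ← hφ, hxy]
    · obtain ⟨x, hx⟩ := (hr (e.symm (i' y))).2 ⟨y, (e.apply_symm_apply _).symm⟩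
      exact ⟨x, H'.inj (by rw [hφ, hx, e.apply_symm_apply])⟩
  have hlift (s) : Side.lift i' (Side.lift φ s) = Side.lift e (Side.lift i s) :=
    Prod.ext (hφ s.1) rfl
  have hu : Side.lift φ u = u' := by
    apply H'.lift_injective
    rw [hlift, ← H.glue_f, ← h.glue, ← H'.glue_f]
    exact congrArg _ (Prod.ext hf rfl)
  refine ⟨Equiv.ofBijective φ hbij, fun x => ?_, fun s => ?_⟩
  · apply add_right_cancel (b := v)
    rw [← H.tile, Equiv.ofBijective_apply, ← H'.tile, hφ, h.tile]
  · change A'.glue (Side.lift φ s) = Side.lift φ (A.glue s)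
    by_cases hs : s = u
    · rw [hs, H.free_u, hu, H'.free_u]
    · have hs' : Side.lift φ s ≠ u' := fun h' => hs (Side.lift_injective hbij.1 (h'.trans hu.symm))
      apply H'.lift_injective
      rw [← H'.glue _ hs', hlift, h.glue, H.glue _ hs, hlift]

theorem Half.glue_lift_eq (H : Half A C i f u k v) (H' : Half A' C' i' f' u' k v)
    {e₁ : Fin a ≃ Fin a'} (h₁ : IsIso A A' e₁) (hu : Side.lift e₁ u = u') {e : Fin n ≃ Fin n'}
    (he : ∀ x, e (i x) = i' (e₁ x)) (hf : e f = f') (s : Side a) :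
    C'.glue (Side.lift e (Side.lift i s)) = Side.lift e (C.glue (Side.lift i s)) := by
  have hlift (s) : Side.lift e (Side.lift i s) = Side.lift i' (Side.lift e₁ s) :=
    Prod.ext (he s.1) rfl
  rw [hlift]
  by_cases hs : s = u
  · rw [hs, hu, H'.glue_u, H.glue_u]
    exact Prod.ext hf.symm rfl
  · have hs' : Side.lift e₁ s ≠ u' :=
      fun h => hs (Side.lift_injective e₁.injective (h.trans hu.symm))
    rw [H'.glue _ hs', h₁.glue, H.glue _ hs, hlift]

theorem Half.glue_f_eq (H : Half A C i f u k v) (H' : Half A' C' i' f' u' k v)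
    {e₁ : Fin a ≃ Fin a'} (hu : Side.lift e₁ u = u') {e : Fin n ≃ Fin n'}
    (he : ∀ x, e (i x) = i' (e₁ x)) : C'.glue (f', k) = Side.lift e (C.glue (f, k)) := by
  rw [H'.glue_f, H.glue_f, ← hu]
  exact Prod.ext (he _).symm rfl

theorem Half.tile_f_add (H : Half A C i f u k v) :
    C.tile f + cornerOffset (k + 1) = A.start u + v := by
  rw [← H.start_outer, outer_self]
  rfl

theorem Half.height_lt (H : Half A C i f u k v) (hu : A.Extremal u) (x : Fin a) :
    height k (C.tile f) < height k (C.tile (i x)) := by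
  have hle := hu x
  have htile := congrArg (height k) H.tile_u
  rw [H.u_snd, height_add_two, height_add_two] at hle
  rw [height_add, height_add, height_normal_self] at htile
  rw [H.tile, height_add]
  linarith

end Half

section Join

variable {a b n a' b' n' : ℕ} {A : SquareSurface a} {B : SquareSurface b} {C : SquareSurface n}
  {i : Fin a → Fin n} {j : Fin b → Fin n} {f : Fin n} {u : Side a} {w : Side b}
  {A' : SquareSurface a'} {B' : SquareSurface b'} {C' : SquareSurface n'}
  {i' : Fin a' → Fin n'} {j' : Fin b' → Fin n'} {f' : Fin n'} {u' : Side a'} {w' : Side b'}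
  {v : Pt}

theorem Join.exists_equiv (J : Join A B C i j f u w v) :
    ∃ E : (Fin a ⊕ Fin b) ⊕ Unit ≃ Fin n, (∀ x, E (.inl (.inl x)) = i x) ∧
      (∀ y, E (.inl (.inr y)) = j y) ∧ E (.inr ()) = f := by
  refine ⟨Equiv.ofBijective (Sum.elim (Sum.elim i j) fun _ => f) ⟨?_, ?_⟩, fun _ => rfl,
    fun _ => rfl, rfl⟩
  · refine Function.Injective.sumElim (Function.Injective.sumElim J.lower.inj J.upper.inj
      J.disjoint) (fun _ _ _ => rfl) ?_
    rintro (x | y) -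
    exacts [J.lower.ne_f x, J.upper.ne_f y]
  · intro g
    rcases J.cover g with ⟨x, rfl⟩ | ⟨y, rfl⟩ | rfl
    exacts [⟨.inl (.inl x), rfl⟩, ⟨.inl (.inr y), rfl⟩, ⟨.inr (), rfl⟩]

theorem Join.isIso (J : Join A B C i j f u w v) (J' : Join A' B' C' i' j' f' u' w' v)
    {e₁ : Fin a ≃ Fin a'} {e₂ : Fin b ≃ Fin b'} {e : Fin n ≃ Fin n'} (h₁ : IsIso A A' e₁)
    (h₂ : IsIso B B' e₂) (hu : Side.lift e₁ u = u') (hw : Side.lift e₂ w = w')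
    (hi : ∀ x, e (i x) = i' (e₁ x)) (hj : ∀ y, e (j y) = j' (e₂ y)) (hf : e f = f') :
    IsIso C C' e where
  tile g := by
    rcases J.cover g with ⟨x, rfl⟩ | ⟨y, rfl⟩ | rfl
    · rw [hi, J'.lower.tile, J.lower.tile, h₁.tile]
    · rw [hj, J'.upper.tile, J.upper.tile, h₂.tile]
    · refine add_right_cancel (b := cornerOffset (0 + 1)) ?_
      rw [hf, J'.lower.tile_f_add, J.lower.tile_f_add, ← hu, h₁.start]
  glue s := by
    obtain ⟨g, l⟩ := s
    rcases J.cover g with ⟨x, rfl⟩ | ⟨y, rfl⟩ | rfl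
    · exact J.lower.glue_lift_eq J'.lower h₁ hu hi hf (x, l)
    · exact J.upper.glue_lift_eq J'.upper h₂ hw hj hf (y, l)
    · have hlift : Side.lift e (g, l) = (f', l) := Prod.ext hf rfl
      rw [hlift]
      fin_cases l
      · exact J.lower.glue_f_eq J'.lower hu hi
      · exact J'.lower.free_one.trans (hlift.symm.trans (congrArg _ J.lower.free_one.symm))
      · exact J.upper.glue_f_eq J'.upper hw hj
      · exact J'.lower.free_three.trans (hlift.symm.trans (congrArg _ J.lower.free_three.symm))

theorem Join.exists_isIso (J : Join A B C i j f u w v) (J' : Join A' B' C' i' j' f' u' w' v)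
    {e₁ : Fin a ≃ Fin a'} {e₂ : Fin b ≃ Fin b'} (h₁ : IsIso A A' e₁) (h₂ : IsIso B B' e₂)
    (hu : Side.lift e₁ u = u') (hw : Side.lift e₂ w = w') : ∃ e, IsIso C C' e := by
  obtain ⟨E, hi, hj, hf⟩ := J.exists_equiv
  obtain ⟨E', hi', hj', hf'⟩ := J'.exists_equiv
  exact ⟨(E.symm.trans (Equiv.sumCongr (Equiv.sumCongr e₁ e₂) (Equiv.refl _))).trans E',
    J.isIso J' h₁ h₂ hu hw (fun x => by simp [← hi, ← hi']) (fun y => by simp [← hj, ← hj'])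
      (by simp [← hf, ← hf'])⟩

theorem Join.mem_iff_height (J : Join A B C i j f u w v) (hu : A.Extremal u) (hw : B.Extremal w)
    (g : Fin n) : (g ∈ Set.range i ↔ height 0 (C.tile f) < height 0 (C.tile g)) ∧
      (g ∈ Set.range j ↔ height 0 (C.tile g) < height 0 (C.tile f)) ∧
      (g = f ↔ height 0 (C.tile g) = height 0 (C.tile f)) := by
  have hi (x : Fin a) := J.lower.height_lt hu x
  have hj (y : Fin b) : height 0 (C.tile (j y)) < height 0 (C.tile f) := by
    have hlt := J.upper.height_lt hw y
    rwa [← zero_add (2 : Fin 4), height_add_two, height_add_two, neg_lt_neg_iff] at hlt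
  have hlower : g ∈ Set.range i → height 0 (C.tile f) < height 0 (C.tile g) := by
    rintro ⟨x, rfl⟩
    exact hi x
  have hupper : g ∈ Set.range j → height 0 (C.tile g) < height 0 (C.tile f) := by
    rintro ⟨y, rfl⟩
    exact hj y
  have hmiddle : g = f → height 0 (C.tile g) = height 0 (C.tile f) := fun hg => by rw [hg]
  have hcover : g ∈ Set.range i ∨ g ∈ Set.range j ∨ g = f := by
    simpa only [Set.mem_range, eq_comm] using J.cover g
  grind

theorem Join.exists_isIso_parts (J : Join A B C i j f u w v)
    (J' : Join A' B' C' i' j' f' u' w' v) (hu : A.Extremal u) (hw : B.Extremal w)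
    (hu' : A'.Extremal u') (hw' : B'.Extremal w') (hstart : A.start u = A'.start u')
    {e : Fin n ≃ Fin n'} (h : IsIso C C' e) :
    (∃ e₁, IsIso A A' e₁) ∧ ∃ e₂, IsIso B B' e₂ := by
  have htile : C.tile f = C'.tile f' := add_right_cancel (b := cornerOffset (0 + 1)) (by
    rw [J.lower.tile_f_add, J'.lower.tile_f_add, hstart])
  have hmem (g : Fin n) := J.mem_iff_height hu hw g
  have hmem' (g : Fin n) := J'.mem_iff_height hu' hw' (e g)
  simp only [h.tile, ← htile] at hmem'
  have hf : e f = f' := (hmem' f).2.2.2 rfl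
  exact ⟨J.lower.exists_isIso J'.lower h hf fun g => (hmem g).1.trans (hmem' g).1.symm,
    J.upper.exists_isIso J'.upper h hf fun g => (hmem g).2.1.trans (hmem' g).2.1.symm⟩

end Join

end SquareSurface

/-! ### Disks bounded by a glued path -/

theorem Filling.iso_iff {γ : Cycle Pt} {A B : Filling γ} :
    A.Iso B ↔ ∃ e, SquareSurface.IsIso A.disk B.disk e :=
  exists_congr fun _ => ⟨fun h => ⟨h.1, h.2⟩, fun h => ⟨h.tile, h.glue⟩⟩

/-- `C` is obtained from `A` and from the translate of `B` by `v` by inserting a square between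
their boundary edges that end at the first points of `root₁` and of `root₂`. -/
def IsJoin {root₁ root₂ : List Pt} (v : Pt) (A : Filling root₁) (B : Filling root₂)
    (C : Filling (root₁ ++ root₂.map (· + v) : List Pt)) : Prop :=
  ∃ i j f u w d e, SquareSurface.Join A.disk B.disk C.disk i j f u w v ∧
    A.disk.BoundaryList (d ++ [u]) ∧ (d ++ [u]).map A.disk.start = root₁ ∧
    B.disk.BoundaryList (e ++ [w]) ∧ (e ++ [w]).map B.disk.start = root₂

theorem Filling.exists_boundaryList_append {root : List Pt} (A : Filling root) :
    ∃ d u, A.disk.BoundaryList (d ++ [u]) ∧ (d ++ [u]).map A.disk.start = root := by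
  obtain ⟨b, hb, hroot⟩ := A.exists_boundaryList
  obtain ⟨d, u, rfl⟩ := (List.eq_nil_or_concat' b).resolve_left (A.isDisk.boundary_ne_nil hb)
  exact ⟨d, u, hb, hroot⟩

theorem SquareSurface.Flat.isDisk_of_map_start_eq {p q : ℕ} {D : SquareSurface p}
    {D' : SquareSurface q} (hD : D.Flat) (hpos : 0 < p) (hconn : D.Connected) (hD' : D'.IsDisk)
    {b : List (Side p)} {b' : List (Side q)} (h : D.BoundaryList b) (h' : D'.BoundaryList b')
    (e : b'.map D'.start = b.map D.start) : D.IsDisk := by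
  have hsnd : b'.map Prod.snd = b.map Prod.snd := by
    simpa [Function.comp_def] using congrArg (List.map Prod.snd)
      (h.map_tile_snd_eq h' (v := 0) (by rw [e]; simp [Function.comp_def]))
  have hturn := hD'.cycSum_turn h'
  rw [hsnd, ← hD.four_mul_euler_eq_turn h] at hturn
  exact (isDisk_iff h).2 ⟨hpos, hconn, hD, by omega⟩

namespace Gap

variable {root₁ root₂ : List Pt} {P v : Pt}

section

variable {p : ℕ} {D : SquareSurface p} {d : List (Side p)} {u : Side p}

theorem lower_add_zero (G : Gap root₁ root₂ P v) (hroot : (d ++ [u]).map D.start = root₁) :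
    AbutsTile 0 P (((d ++ [u]).map D.start).map (· + 0)) := by
  simpa only [hroot, add_zero, List.map_id'] using G.lower

theorem upper_map (G : Gap root₁ root₂ P v) (hroot : (d ++ [u]).map D.start = root₂) :
    AbutsTile 2 P (((d ++ [u]).map D.start).map (· + v)) :=
  hroot ▸ G.upper

end

theorem exists_filling (G : Gap root₁ root₂ P v) (A : Filling root₁) (B : Filling root₂) :
    ∃ C, IsJoin v A B C ∧ C.faces = A.faces + B.faces + 1 := by
  obtain ⟨d, u, hA, hroot₁⟩ := A.exists_boundaryList_append
  obtain ⟨e, w, hB, hroot₂⟩ := B.exists_boundaryList_append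
  have hlower := G.lower_add_zero hroot₁
  have hupper := G.upper_map hroot₂
  obtain ⟨hu_start, hu_next⟩ := hA.start_of_abutsTile hlower
  obtain ⟨hw_start, hw_next⟩ := hB.start_of_abutsTile hupper
  obtain ⟨C, i, j, f, J⟩ := SquareSurface.exists_join ((hA.mem_iff u).1 (by simp))
    ((hB.mem_iff w).1 (by simp)) hu_start hu_next hw_start hw_next
  have hC : C.IsDisk := J.isDisk A.isDisk B.isDisk (hA.extremal_of_abutsTile hlower)
    (hB.extremal_of_abutsTile hupper) hA hB
  have hbounds : C.Bounds (root₁ ++ root₂.map (· + v) : List Pt) :=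
    SquareSurface.bounds_coe_iff.2
      ⟨_, (J.boundaryList_iff d e).2 ⟨hA, hB⟩, by rw [J.map_start, hroot₁, hroot₂]⟩
  exact ⟨⟨_, C, hC, hbounds⟩, ⟨i, j, f, u, w, d, e, J, hA, hroot₁, hB, hroot₂⟩,
    by dsimp only; omega⟩

theorem exists_isJoin (G : Gap root₁ root₂ P v) (h₁ : 3 ≤ root₁.length)
    (h₂ : 3 ≤ root₂.length) (A₀ : Filling root₁) (B₀ : Filling root₂)
    (C : Filling (root₁ ++ root₂.map (· + v) : List Pt)) : ∃ A B, IsJoin v A B C := by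
  obtain ⟨b, hb, hroot⟩ := C.exists_boundaryList
  obtain ⟨a, A, m, B, i, j, f, u, w, d, e, J, hA, hroot₁, hB, hroot₂⟩ :=
    SquareSurface.exists_cut G h₁ h₂ hb hroot
  obtain ⟨bA, hA₀, hrootA⟩ := A₀.exists_boundaryList
  obtain ⟨bB, hB₀, hrootB⟩ := B₀.exists_boundaryList
  have hA_disk : A.IsDisk := (J.lower.flat C.isDisk.flat).isDisk_of_map_start_eq (Fin.pos u.1)
    (J.lower.connected C.isDisk.connected) A₀.isDisk hA hA₀ (hrootA.trans hroot₁.symm)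
  have hB_disk : B.IsDisk := (J.upper.flat C.isDisk.flat).isDisk_of_map_start_eq (Fin.pos w.1)
    (J.upper.connected C.isDisk.connected) B₀.isDisk hB hB₀ (hrootB.trans hroot₂.symm)
  exact ⟨⟨a, A, hA_disk, SquareSurface.bounds_coe_iff.2 ⟨_, hA, hroot₁⟩⟩,
    ⟨m, B, hB_disk, SquareSurface.bounds_coe_iff.2 ⟨_, hB, hroot₂⟩⟩,
    i, j, f, u, w, d, e, J, hA, hroot₁, hB, hroot₂⟩

theorem iso_iff (G : Gap root₁ root₂ P v) {A A' : Filling root₁} {B B' : Filling root₂}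
    {C C' : Filling (root₁ ++ root₂.map (· + v) : List Pt)} (h : IsJoin v A B C)
    (h' : IsJoin v A' B' C') : A.Iso A' ∧ B.Iso B' ↔ C.Iso C' := by
  obtain ⟨i, j, f, u, w, d, e, J, hA, hroot₁, hB, hroot₂⟩ := h
  obtain ⟨i', j', f', u', w', d', e', J', hA', hroot₁', hB', hroot₂'⟩ := h'
  simp only [Filling.iso_iff]
  constructor
  · rintro ⟨⟨e₁, h₁⟩, e₂, h₂⟩
    exact J.exists_isIso J' h₁ h₂ (h₁.lift_last A'.isDisk hA hA' (hroot₁.trans hroot₁'.symm))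
      (h₂.lift_last B'.isDisk hB hB' (hroot₂.trans hroot₂'.symm))
  · rintro ⟨e, h⟩
    have hstart : A.disk.start u = A'.disk.start u' := by
      simpa using congrArg List.getLast? (hroot₁.trans hroot₁'.symm)
    exact J.exists_isIso_parts J' (hA.extremal_of_abutsTile (G.lower_add_zero hroot₁))
      (hB.extremal_of_abutsTile (G.upper_map hroot₂))
      (hA'.extremal_of_abutsTile (G.lower_add_zero hroot₁'))
      (hB'.extremal_of_abutsTile (G.upper_map hroot₂')) hstart h

end Gap

theorem card_quotient_eq_mul {X Y Z : Type*} {sX : Setoid X} {sY : Setoid Y} {sZ : Setoid Z}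
    (R : X → Y → Z → Prop) (hleft : ∀ x y, ∃ z, R x y z) (hright : ∀ z, ∃ x y, R x y z)
    (hR : ∀ {x y z x' y' z'}, R x y z → R x' y' z' → (sX x x' ∧ sY y y' ↔ sZ z z')) :
    Nat.card (Quotient sZ) = Nat.card (Quotient sX) * Nat.card (Quotient sY) := by
  choose F hF using hleft
  rw [← Nat.card_prod]
  refine (Nat.card_congr (Equiv.ofBijective
    (fun q : Quotient sX × Quotient sY => Quotient.mk sZ (F q.1.out q.2.out)) ⟨?_, ?_⟩)).symm
  · intro q q' h
    obtain ⟨hx, hy⟩ := (hR (hF _ _) (hF _ _)).2 (Quotient.exact h)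
    exact Prod.ext (Quotient.out_equiv_out.1 hx) (Quotient.out_equiv_out.1 hy)
  · rintro ⟨z⟩
    obtain ⟨x, y, h⟩ := hright z
    exact ⟨(Quotient.mk sX x, Quotient.mk sY y), Quotient.sound ((hR (hF _ _) h).1
      ⟨Quotient.mk_out x, Quotient.mk_out y⟩)⟩

theorem Gap.multiplicity_eq {root₁ root₂ : List Pt} {P v : Pt} (G : Gap root₁ root₂ P v)
    (h₁ : 3 ≤ root₁.length) (h₂ : 3 ≤ root₂.length) (A₀ : Filling root₁) (B₀ : Filling root₂) :
    multiplicity (root₁ ++ root₂.map (· + v) : List Pt) =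
      multiplicity root₁ * multiplicity root₂ :=
  card_quotient_eq_mul (IsJoin v) (fun A B => (G.exists_filling A B).imp fun _ h => h.1)
    (G.exists_isJoin h₁ h₂ A₀ B₀) G.iso_iff

/-! ### Gluing two self-overlapping polygons -/

theorem IsClosedPath.three_le_length {root : List Pt} (h : IsClosedPath (root : Cycle Pt))
    (hne : root ≠ []) : 3 ≤ root.length := by
  obtain _ | ⟨P, _ | ⟨Q, l⟩⟩ := root
  · exact absurd rfl hne
  · have hadj : Adj P P := by simpa using h.chain
    simp [Adj] at hadj
  · obtain ⟨R, l', rfl, -⟩ := h.no_uturn P Q l rfl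
    simp

theorem UpperEdge.getLast_eq {γ : Cycle Pt} (u : UpperEdge γ) (h : IsSOP γ) :
    u.root.getLast u.ne_nil = u.root.head u.ne_nil + (1, 0) := by
  obtain ⟨root, hne, rfl, hor, hhigh⟩ := u
  obtain ⟨A⟩ := h.2
  have hedge := A.getLast_add_cornerOffset hne (k := 2) (by simpa only [height_two] using hor)
    (by simpa only [height_two] using hhigh)
  have hside : cornerOffset 2 = (1, 0) + cornerOffset (2 + 1) := by decide
  rw [hside, ← add_assoc] at hedge
  exact add_right_cancel hedge

theorem LowerEdge.head_eq {γ : Cycle Pt} (l : LowerEdge γ) (h : IsSOP γ) :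
    l.root.head l.ne_nil = l.root.getLast l.ne_nil + (1, 0) := by
  obtain ⟨root, hne, rfl, hor, hlow⟩ := l
  obtain ⟨A⟩ := h.2
  have hedge := A.getLast_add_cornerOffset hne (k := 0)
    (by simpa only [height_zero, neg_inj] using hor)
    (by simpa only [height_zero, neg_le_neg_iff] using hlow)
  exact (add_zero _).symm.trans hedge.symm

/-- The translation applied to the second path in the gluing of the upper edge `u` with the lower
edge `l`. -/
def shift {γ₁ γ₂ : Cycle Pt} (u : UpperEdge γ₁) (l : LowerEdge γ₂) : Pt :=
  u.root.head u.ne_nil + ((0, 1) : Pt) - l.root.getLast l.ne_nil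

theorem LowerEdge.lt_snd_of_mem_map_shift {γ₁ γ₂ : Cycle Pt} (u : UpperEdge γ₁) (l : LowerEdge γ₂)
    {Q : Pt} (hQ : Q ∈ l.root.map (· + shift u l)) : (u.root.head u.ne_nil).2 < Q.2 := by
  obtain ⟨R, hR, rfl⟩ := List.mem_map.1 hQ
  have hlow := l.lowest R hR
  have hhor := l.horizontal
  simp only [shift, Prod.snd_add, Prod.snd_sub]
  linarith

theorem gap_shift {γ₁ γ₂ : Cycle Pt} (h₁ : IsSOP γ₁) (h₂ : IsSOP γ₂) (u : UpperEdge γ₁)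
    (l : LowerEdge γ₂) : Gap u.root l.root (u.root.head u.ne_nil) (shift u l) where
  lower :=
    { head := (List.head?_eq_some_head u.ne_nil).trans (congrArg some (add_zero _).symm)
      last := (List.getLast?_eq_some_getLast u.ne_nil).trans (congrArg some (u.getLast_eq h₁))
      le Q hQ := by
        simpa [height_zero, cornerOffset] using u.highest Q hQ }
  upper :=
    { head := by
        rw [List.head?_map, List.head?_eq_some_head l.ne_nil, Option.map_some, l.head_eq h₂, shift]
        have hcorner : cornerOffset 2 = (1, 0) + (0, 1) := by decide
        rw [hcorner]
        congr 1
        abel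
      last := by
        rw [List.getLast?_map, List.getLast?_eq_some_getLast l.ne_nil, Option.map_some, shift]
        exact congrArg some (add_sub_cancel _ _)
      le Q hQ := by
        have hlt := l.lt_snd_of_mem_map_shift u hQ
        simpa [height_two, cornerOffset] using hlt }

section Gluing

variable {γ₁ γ₂ : Cycle Pt} (u : UpperEdge γ₁) (l : LowerEdge γ₂)

theorem length_gluing : (gluing u l).length = γ₁.length + γ₂.length := by
  obtain ⟨_, _, rfl, _, _⟩ := u
  obtain ⟨_, _, rfl, _, _⟩ := l
  exact List.length_append.trans (congrArg _ (List.length_map _))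

variable {u l}

theorem HasArea.gluing (h₁ : IsSOP γ₁) (h₂ : IsSOP γ₂) {p₁ p₂ : ℕ} (hp₁ : HasArea γ₁ p₁)
    (hp₂ : HasArea γ₂ p₂) : HasArea (gluing u l) (p₁ + p₂ + 1) := by
  have G := gap_shift h₁ h₂ u l
  obtain ⟨root₁, ne₁, rfl, hor₁, hhigh⟩ := u
  obtain ⟨root₂, ne₂, rfl, hor₂, hlow⟩ := l
  obtain ⟨A, rfl⟩ := hp₁
  obtain ⟨B, rfl⟩ := hp₂
  obtain ⟨C, -, hC⟩ := G.exists_filling A B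
  exact ⟨C, hC⟩

theorem IsSOP.gluing (h₁ : IsSOP γ₁) (h₂ : IsSOP γ₂) : IsSOP (gluing u l) := by
  obtain ⟨A⟩ := h₁.2
  obtain ⟨B⟩ := h₂.2
  obtain ⟨C, -⟩ := HasArea.gluing h₁ h₂ ⟨A, rfl⟩ ⟨B, rfl⟩ (u := u) (l := l)
  obtain ⟨b, hb, hroot⟩ := C.exists_boundaryList
  have hclosed := C.isDisk.isClosedPath hb
  rw [hroot] at hclosed
  exact ⟨hclosed, ⟨C⟩⟩

theorem multiplicity_gluing (h₁ : IsSOP γ₁) (h₂ : IsSOP γ₂) :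
    multiplicity (gluing u l) = multiplicity γ₁ * multiplicity γ₂ := by
  have G := gap_shift h₁ h₂ u l
  obtain ⟨root₁, ne₁, rfl, hor₁, hhigh⟩ := u
  obtain ⟨root₂, ne₂, rfl, hor₂, hlow⟩ := l
  obtain ⟨A⟩ := h₁.2
  obtain ⟨B⟩ := h₂.2
  exact G.multiplicity_eq (h₁.1.three_le_length ne₁) (h₂.1.three_le_length ne₂) A B

end Gluing

/-! ### Classes modulo translations -/

theorem toClass_eq_iff {γ γ' : Cycle Pt} : toClass γ = toClass γ' ↔ Translate γ γ' :=
  Quotient.eq (r := (⟨Translate, translate_equivalence⟩ : Setoid (Cycle Pt)))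

theorem toClass_map_add (γ : Cycle Pt) (v : Pt) : toClass (γ.map (· + v)) = toClass γ :=
  (toClass_eq_iff.2 ⟨v, rfl⟩).symm

theorem map_coe (l : List Pt) (v : Pt) :
    (l : Cycle Pt).map (· + v) = ((l.map (· + v) : List Pt) : Cycle Pt) := rfl

/-- The upper edge of the translate of `γ` by `a` that corresponds to `u`. -/
def UpperEdge.translate {γ : Cycle Pt} (u : UpperEdge γ) (a : Pt) :
    UpperEdge (γ.map (· + a)) where
  root := u.root.map (· + a)
  ne_nil := by simpa using u.ne_nil
  coe_root := by rw [← map_coe, u.coe_root]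
  horizontal := by simpa using u.horizontal
  highest Q hQ := by
    obtain ⟨R, hR, rfl⟩ := List.mem_map.1 hQ
    simpa using u.highest R hR

/-- The lower edge of the translate of `γ` by `a` that corresponds to `l`. -/
def LowerEdge.translate {γ : Cycle Pt} (l : LowerEdge γ) (a : Pt) :
    LowerEdge (γ.map (· + a)) where
  root := l.root.map (· + a)
  ne_nil := by simpa using l.ne_nil
  coe_root := by rw [← map_coe, l.coe_root]
  horizontal := by simpa using l.horizontal
  lowest Q hQ := by
    obtain ⟨R, hR, rfl⟩ := List.mem_map.1 hQ
    simpa using l.lowest R hR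

theorem gluing_translate {γ₁ γ₂ : Cycle Pt} (u : UpperEdge γ₁) (l : LowerEdge γ₂) (a b : Pt) :
    gluing (u.translate a) (l.translate b) = (gluing u l).map (· + a) := by
  rw [gluing, gluing, map_coe, List.map_append]
  simp only [UpperEdge.translate, LowerEdge.translate, List.map_map]
  congr 2
  refine List.map_congr_left fun Q _ => ?_
  simp only [Function.comp_apply, List.head_map, List.getLast_map]
  abel

theorem exists_toClass_gluing_eq {γ₁ γ₂ γ₁' γ₂' : Cycle Pt} (h₁ : toClass γ₁ = toClass γ₁')
    (h₂ : toClass γ₂ = toClass γ₂') (u : UpperEdge γ₁) (l : LowerEdge γ₂) :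
    ∃ (u' : UpperEdge γ₁') (l' : LowerEdge γ₂'),
      toClass (gluing u l) = toClass (gluing u' l') := by
  obtain ⟨a, rfl⟩ := toClass_eq_iff.1 h₁
  obtain ⟨b, rfl⟩ := toClass_eq_iff.1 h₂
  exact ⟨u.translate a, l.translate b, by rw [gluing_translate, toClass_map_add]⟩

theorem exists_isGluingMap : ∃ G, IsGluingMap G := by
  classical
  have hsurj (c : PathClass) : ∃ γ, toClass γ = c := Quotient.exists_rep c
  choose rep hrep using hsurj
  refine ⟨fun c => if h : Nonempty (UpperEdge (rep c.1)) ∧ Nonempty (LowerEdge (rep c.2)) then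
    toClass (gluing h.1.some h.2.some) else c.1, fun γ₁ γ₂ h₁ h₂ => ?_⟩
  obtain ⟨u⟩ := h₁.nonempty_upperEdge
  obtain ⟨l⟩ := h₂.nonempty_lowerEdge
  obtain ⟨u', l', -⟩ := exists_toClass_gluing_eq (hrep _).symm (hrep _).symm u l
  dsimp only
  rw [dif_pos ⟨⟨u'⟩, ⟨l'⟩⟩]
  exact exists_toClass_gluing_eq (hrep _) (hrep _) _ _

/-! ### Finiteness -/

theorem natAbs_sub_le_of_isChain {P : Pt} {l : List Pt} (h : (P :: l).IsChain Adj) :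
    ∀ Q ∈ P :: l, (Q.1 - P.1).natAbs ≤ l.length ∧ (Q.2 - P.2).natAbs ≤ l.length := by
  induction l generalizing P with
  | nil => simp
  | cons R l ih =>
    rw [List.isChain_cons_cons] at h
    intro Q hQ
    rcases List.mem_cons.1 hQ with rfl | hQ
    · simp
    · have hQR := ih h.2 Q hQ
      have hPR := h.1
      simp only [Adj, List.length_cons] at hPR ⊢
      omega

theorem exists_map_add_mem_Icc {l : List Pt} (h : (l : Cycle Pt).Chain Adj) :
    ∃ v, ∀ Q ∈ l.map (· + v),
      Q ∈ Set.Icc ((-l.length, -l.length) : Pt) (l.length, l.length) := by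
  obtain _ | ⟨P, l⟩ := l
  · simp
  · rw [Cycle.chain_coe_cons, ← List.cons_append, List.isChain_append] at h
    refine ⟨-P, fun Q hQ => ?_⟩
    obtain ⟨R, hR, rfl⟩ := List.mem_map.1 hQ
    have hR := natAbs_sub_le_of_isChain h.1 R hR
    simp only [Set.mem_Icc, Prod.le_def, Prod.fst_add, Prod.snd_add, Prod.fst_neg, Prod.snd_neg,
      List.length_cons]
    omega

theorem sopLength_finite (n : ℕ) : (sopLength n).Finite := by
  let X := Set.Icc ((-(2 * n : ℕ), -(2 * n : ℕ)) : Pt) ((2 * n : ℕ), (2 * n : ℕ))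
  have hX : Finite X := (Set.finite_Icc _ _).to_subtype
  refine ((List.finite_length_eq X (2 * n)).image fun l =>
    toClass (l.map Subtype.val : List Pt)).subset ?_
  rintro _ ⟨γ, ⟨hγ, hlen⟩, rfl⟩
  induction γ using Quotient.inductionOn' with
  | h l =>
    obtain ⟨v, hv⟩ := exists_map_add_mem_Icc (l := l) hγ.1.chain
    have hlen : l.length = 2 * n := hlen
    rw [hlen] at hv
    obtain ⟨l', hl'⟩ : ∃ l' : List X, l'.map Subtype.val = l.map (· + v) :=
      ⟨(l.map (· + v)).attach.map fun Q => ⟨Q.1, hv _ Q.2⟩, by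
        rw [List.map_map]
        exact List.attach_map_subtype_val _⟩
    refine ⟨l', ?_, ?_⟩
    · simpa [hlen] using congrArg List.length hl'
    · simp only [hl']
      exact toClass_map_add (l : Cycle Pt) v

/-! ### Injectivity -/

theorem not_of_append_perm_append {α : Type*} {p : α → Prop} {a b c d : List α}
    (h : (a ++ b).Perm (c ++ d)) (hlength : a.length = c.length) (ha : ∀ x ∈ a, p x)
    (hb : ∀ x ∈ b, ¬p x) (hc : ∀ x ∈ c, p x) : ∀ x ∈ d, ¬p x := by
  classical
  have hcount := h.countP_eq (fun x => decide (p x))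
  have ha : a.countP (fun x => decide (p x)) = a.length := List.countP_eq_length.2 (by simpa)
  have hb : b.countP (fun x => decide (p x)) = 0 := List.countP_eq_zero.2 (by simpa)
  have hc : c.countP (fun x => decide (p x)) = c.length := List.countP_eq_length.2 (by simpa)
  rw [List.countP_append, List.countP_append, ha, hb, hc, hlength, Nat.add_left_cancel_iff,
    eq_comm, List.countP_eq_zero] at hcount
  simpa using hcount

theorem append_inj_of_isRotated {α : Type*} {p : α → Prop} {a b c d : List α}
    (h : a ++ b ~r c ++ d) (hlength : a.length = c.length) (ha_nil : a ≠ []) (hb_nil : b ≠ [])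
    (ha : ∀ x ∈ a, p x) (hb : ∀ x ∈ b, ¬p x) (hc : ∀ x ∈ c, p x) : a = c ∧ b = d := by
  have hd := not_of_append_perm_append h.perm hlength ha hb hc
  have hlength' : b.length = d.length := by
    simpa [hlength] using h.perm.length_eq
  obtain ⟨k, hk, hrot⟩ := List.isRotated_iff_mod.1 h
  rw [List.rotate_eq_drop_append_take hk] at hrot
  obtain ⟨x, y, hab, hcd⟩ : ∃ x y, a ++ b = x ++ y ∧ c ++ d = y ++ x :=
    ⟨_, _, (List.take_append_drop k _).symm, hrot.symm⟩
  obtain ⟨q, c', rfl⟩ := List.exists_cons_of_ne_nil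
    (List.ne_nil_of_length_pos (hlength ▸ List.length_pos_of_ne_nil ha_nil))
  obtain ⟨d', r, rfl⟩ := (List.eq_nil_or_concat' d).resolve_left
    (List.ne_nil_of_length_pos (hlength' ▸ List.length_pos_of_ne_nil hb_nil))
  suffices hnil : x = [] ∨ y = [] by
    refine List.append_inj ?_ hlength
    rcases hnil with rfl | rfl
    all_goals simpa [hab] using hcd.symm
  by_contra! hne
  obtain ⟨x', s, rfl⟩ := (List.eq_nil_or_concat' x).resolve_left hne.1
  obtain ⟨t, y', rfl⟩ := List.exists_cons_of_ne_nil hne.2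
  have hr : r = s := by
    simpa only [← List.append_assoc, ← List.cons_append, List.getLast?_concat, Option.some_inj]
      using congrArg List.getLast? hcd
  have hq : q = t := by simpa using congrArg List.head? hcd
  have hs : ¬p s := hr ▸ hd r (by simp)
  have ht : p t := hq ▸ hc q (by simp)
  rcases List.append_eq_append_iff.1 hab with ⟨m, -, hm⟩ | ⟨m, hx, -⟩
  · exact hb t (hm ▸ by simp) ht
  · exact hs (ha s (hx ▸ by simp))

theorem roots_eq_of_gluing_eq {γ₁ γ₂ γ₁' γ₂' : Cycle Pt} {u : UpperEdge γ₁} {l : LowerEdge γ₂}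
    {u' : UpperEdge γ₁'} {l' : LowerEdge γ₂'} (hlength : u.root.length = u'.root.length)
    (h : gluing u l = gluing u' l') :
    u.root = u'.root ∧ l.root.map (· + shift u l) = l'.root.map (· + shift u' l') := by
  wlog hle : (u'.root.head u'.ne_nil).2 ≤ (u.root.head u.ne_nil).2 generalizing γ₁ γ₂ γ₁' γ₂'
  · exact (this hlength.symm h.symm (le_of_not_ge hle)).imp Eq.symm Eq.symm
  exact append_inj_of_isRotated (p := fun Q => Q.2 ≤ (u.root.head u.ne_nil).2)
    (Cycle.coe_eq_coe.1 h) hlength u.ne_nil (by simpa using l.ne_nil) u.highest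
    (fun Q hQ => (l.lt_snd_of_mem_map_shift u hQ).not_ge) fun Q hQ => (u'.highest Q hQ).trans hle

theorem toClass_eq_of_toClass_gluing_eq {γ₁ γ₂ γ₁' γ₂' : Cycle Pt}
    (hlength : γ₁.length = γ₁'.length) {u : UpperEdge γ₁} {l : LowerEdge γ₂} {u' : UpperEdge γ₁'}
    {l' : LowerEdge γ₂'} (h : toClass (gluing u l) = toClass (gluing u' l')) :
    toClass γ₁ = toClass γ₁' ∧ toClass γ₂ = toClass γ₂' := by
  obtain ⟨a, ha⟩ := toClass_eq_iff.1 h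
  rw [← gluing_translate u l a 0] at ha
  have hroot : (u.translate a).root.length = u'.root.length := by
    rw [← u.coe_root, ← u'.coe_root] at hlength
    exact (List.length_map _).trans hlength
  obtain ⟨hupper, hlower⟩ := roots_eq_of_gluing_eq hroot ha.symm
  have h₁ : γ₁.map (· + a) = γ₁' := by
    rw [← (u.translate a).coe_root, hupper, u'.coe_root]
  have h₂ := congrArg (fun L : List Pt => toClass (L : Cycle Pt)) hlower
  simp only [← map_coe, LowerEdge.coe_root, toClass_map_add] at h₂
  exact ⟨by rw [← h₁, toClass_map_add], h₂⟩

/-! ### Gluing maps -/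

namespace IsGluingMap

variable {G : PathClass × PathClass → PathClass}

theorem injOn (hG : IsGluingMap G) {n₁ n₂ : ℕ} {S T : Set PathClass} (hS : S ⊆ sopLength n₁)
    (hT : T ⊆ sopLength n₂) : Set.InjOn G (S ×ˢ T) := by
  refine Set.InjOn.mono (Set.prod_mono hS hT) ?_
  rintro ⟨_, _⟩ ⟨⟨γ₁, ⟨h₁, len₁⟩, rfl⟩, ⟨γ₂, ⟨h₂, -⟩, rfl⟩⟩ ⟨_, _⟩
    ⟨⟨γ₁', ⟨h₁', len₁'⟩, rfl⟩, ⟨γ₂', ⟨h₂', -⟩, rfl⟩⟩ h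
  obtain ⟨u, l, hul⟩ := hG γ₁ γ₂ h₁ h₂
  obtain ⟨u', l', hul'⟩ := hG γ₁' γ₂' h₁' h₂'
  rw [hul, hul'] at h
  exact Prod.ext_iff.2 (toClass_eq_of_toClass_gluing_eq (len₁.trans len₁'.symm) h)

theorem mapsTo_length (hG : IsGluingMap G) (n₁ n₂ : ℕ) :
    Set.MapsTo G (sopLength n₁ ×ˢ sopLength n₂) (sopLength (n₁ + n₂)) := by
  rintro ⟨_, _⟩ ⟨⟨γ₁, ⟨h₁, len₁⟩, rfl⟩, ⟨γ₂, ⟨h₂, len₂⟩, rfl⟩⟩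
  obtain ⟨u, l, hul⟩ := hG γ₁ γ₂ h₁ h₂
  exact ⟨_, ⟨h₁.gluing h₂, by rw [length_gluing, len₁, len₂, mul_add]⟩, hul.symm⟩

theorem mapsTo_area (hG : IsGluingMap G) (n₁ n₂ p₁ p₂ : ℕ) :
    Set.MapsTo G (sopArea n₁ p₁ ×ˢ sopArea n₂ p₂) (sopArea (n₁ + n₂) (p₁ + p₂ + 1)) := by
  rintro ⟨_, _⟩ ⟨⟨γ₁, ⟨h₁, len₁, area₁⟩, rfl⟩, ⟨γ₂, ⟨h₂, len₂, area₂⟩, rfl⟩⟩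
  obtain ⟨u, l, hul⟩ := hG γ₁ γ₂ h₁ h₂
  exact ⟨_, ⟨h₁.gluing h₂, by rw [length_gluing, len₁, len₂, mul_add],
    area₁.gluing h₁ h₂ area₂⟩, hul.symm⟩

theorem mapsTo_mult (hG : IsGluingMap G) (n₁ n₂ p₁ p₂ μ₁ μ₂ : ℕ) :
    Set.MapsTo G (sopMult n₁ p₁ μ₁ ×ˢ sopMult n₂ p₂ μ₂)
      (sopMult (n₁ + n₂) (p₁ + p₂ + 1) (μ₁ * μ₂)) := by
  rintro ⟨_, _⟩ ⟨⟨γ₁, ⟨h₁, len₁, area₁, mult₁⟩, rfl⟩, ⟨γ₂, ⟨h₂, len₂, area₂, mult₂⟩, rfl⟩⟩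
  obtain ⟨u, l, hul⟩ := hG γ₁ γ₂ h₁ h₂
  exact ⟨_, ⟨h₁.gluing h₂, by rw [length_gluing, len₁, len₂, mul_add], area₁.gluing h₁ h₂ area₂,
    by rw [multiplicity_gluing h₁ h₂, mult₁, mult₂]⟩, hul.symm⟩

end IsGluingMap

theorem sopMult_subset (n p μ : ℕ) : sopMult n p μ ⊆ sopLength n :=
  Set.image_mono fun _ h => ⟨h.1, h.2.1⟩

theorem sopArea_subset (n p : ℕ) : sopArea n p ⊆ sopLength n :=
  Set.image_mono fun _ h => ⟨h.1, h.2.1⟩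

theorem ncard_mul_ncard_le_of_injOn {X : Type*} {G : X × X → X} {S T U : Set X}
    (hmaps : Set.MapsTo G (S ×ˢ T) U) (hinj : Set.InjOn G (S ×ˢ T)) (hU : U.Finite) :
    S.ncard * T.ncard ≤ U.ncard := by
  rw [← Set.ncard_prod]
  exact Set.ncard_le_ncard_of_injOn G hmaps hinj hU

end SOPoly

theorem mainTheorem3 :
    -- The counting numbers, the area and the multiplicity are well defined.
    (∀ n : ℕ, (SOPoly.sopLength n).Finite) ∧
    (∀ γ : Cycle SOPoly.Pt, Finite (SOPoly.DistortedDisk γ)) ∧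
    (∀ γ : Cycle SOPoly.Pt, SOPoly.IsSOP γ → ∃! p : ℕ, SOPoly.HasArea γ p) ∧
    -- Any SOP has an upper edge and a lower edge, so that gluing maps exist.
    (∀ γ : Cycle SOPoly.Pt, SOPoly.IsSOP γ →
      Nonempty (SOPoly.UpperEdge γ) ∧ Nonempty (SOPoly.LowerEdge γ)) ∧
    (∃ G : SOPoly.PathClass × SOPoly.PathClass → SOPoly.PathClass, SOPoly.IsGluingMap G) ∧
    -- Gluing two SOP yields a SOP, of known length, area and multiplicity.
    (∀ (γ₁ γ₂ : Cycle SOPoly.Pt), SOPoly.IsSOP γ₁ → SOPoly.IsSOP γ₂ →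
      ∀ (u : SOPoly.UpperEdge γ₁) (l : SOPoly.LowerEdge γ₂),
        SOPoly.IsSOP (SOPoly.gluing u l) ∧
        (SOPoly.gluing u l).length = γ₁.length + γ₂.length ∧
        (∀ p₁ p₂ : ℕ, SOPoly.HasArea γ₁ p₁ → SOPoly.HasArea γ₂ p₂ →
          SOPoly.HasArea (SOPoly.gluing u l) (p₁ + p₂ + 1)) ∧
        SOPoly.multiplicity (SOPoly.gluing u l) =
          SOPoly.multiplicity γ₁ * SOPoly.multiplicity γ₂) ∧
    -- For any choice of the edges, the gluing is injective once the lengths are fixed.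
    (∀ G : SOPoly.PathClass × SOPoly.PathClass → SOPoly.PathClass, SOPoly.IsGluingMap G →
      (∀ n₁ n₂ p₁ p₂ μ₁ μ₂ : ℕ,
        Set.MapsTo G (SOPoly.sopMult n₁ p₁ μ₁ ×ˢ SOPoly.sopMult n₂ p₂ μ₂)
          (SOPoly.sopMult (n₁ + n₂) (p₁ + p₂ + 1) (μ₁ * μ₂)) ∧
        Set.InjOn G (SOPoly.sopMult n₁ p₁ μ₁ ×ˢ SOPoly.sopMult n₂ p₂ μ₂)) ∧
      (∀ n₁ n₂ p₁ p₂ : ℕ,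
        Set.MapsTo G (SOPoly.sopArea n₁ p₁ ×ˢ SOPoly.sopArea n₂ p₂)
          (SOPoly.sopArea (n₁ + n₂) (p₁ + p₂ + 1)) ∧
        Set.InjOn G (SOPoly.sopArea n₁ p₁ ×ˢ SOPoly.sopArea n₂ p₂)) ∧
      (∀ n₁ n₂ : ℕ,
        Set.MapsTo G (SOPoly.sopLength n₁ ×ˢ SOPoly.sopLength n₂)
          (SOPoly.sopLength (n₁ + n₂)) ∧
        Set.InjOn G (SOPoly.sopLength n₁ ×ˢ SOPoly.sopLength n₂))) ∧
    -- The supermultiplicativity inequalities.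
    (∀ n₁ n₂ p₁ p₂ μ₁ μ₂ : ℕ,
      SOPoly.calW n₁ p₁ μ₁ * SOPoly.calW n₂ p₂ μ₂ ≤
        SOPoly.calW (n₁ + n₂) (p₁ + p₂ + 1) (μ₁ * μ₂)) ∧
    (∀ n₁ n₂ p₁ p₂ : ℕ,
      SOPoly.hatW n₁ p₁ * SOPoly.hatW n₂ p₂ ≤ SOPoly.hatW (n₁ + n₂) (p₁ + p₂ + 1)) ∧
    (∀ n₁ n₂ : ℕ, SOPoly.hatw n₁ * SOPoly.hatw n₂ ≤ SOPoly.hatw (n₁ + n₂)) := by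
  obtain ⟨G₀, hG₀⟩ := SOPoly.exists_isGluingMap
  have hmult := SOPoly.sopMult_subset
  have harea := SOPoly.sopArea_subset
  have hfinite := SOPoly.sopLength_finite
  refine ⟨hfinite, fun γ => inferInstance, fun γ h => h.existsUnique_area,
    fun γ h => ⟨h.nonempty_upperEdge, h.nonempty_lowerEdge⟩, ⟨G₀, hG₀⟩,
    fun γ₁ γ₂ h₁ h₂ u l => ⟨h₁.gluing h₂, SOPoly.length_gluing u l,
      fun p₁ p₂ hp₁ hp₂ => hp₁.gluing h₁ h₂ hp₂, SOPoly.multiplicity_gluing h₁ h₂⟩,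
    fun G hG => ⟨fun n₁ n₂ p₁ p₂ μ₁ μ₂ => ⟨hG.mapsTo_mult n₁ n₂ p₁ p₂ μ₁ μ₂,
        hG.injOn (hmult n₁ p₁ μ₁) (hmult n₂ p₂ μ₂)⟩,
      fun n₁ n₂ p₁ p₂ => ⟨hG.mapsTo_area n₁ n₂ p₁ p₂, hG.injOn (harea n₁ p₁) (harea n₂ p₂)⟩,
      fun n₁ n₂ => ⟨hG.mapsTo_length n₁ n₂, hG.injOn subset_rfl subset_rfl⟩⟩,
    fun n₁ n₂ p₁ p₂ μ₁ μ₂ => ?_, fun n₁ n₂ p₁ p₂ => ?_, fun n₁ n₂ => ?_⟩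
  · exact SOPoly.ncard_mul_ncard_le_of_injOn (hG₀.mapsTo_mult n₁ n₂ p₁ p₂ μ₁ μ₂)
      (hG₀.injOn (hmult _ _ _) (hmult _ _ _)) ((hfinite _).subset (hmult _ _ _))
  · exact SOPoly.ncard_mul_ncard_le_of_injOn (hG₀.mapsTo_area n₁ n₂ p₁ p₂)
      (hG₀.injOn (harea _ _) (harea _ _)) ((hfinite _).subset (harea _ _))
  · exact SOPoly.ncard_mul_ncard_le_of_injOn (hG₀.mapsTo_length n₁ n₂)
      (hG₀.injOn subset_rfl subset_rfl) (hfinite _)
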